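/- Let $V=\mathbb R^{4,3}$ be $\mathbb R^7$ with basis $b_1,\dots,b_7$, dual basis $b^1,\dots,b^7$ and inner product $\langle\cdot,\cdot\rangle = 2(b^1\cdot b^5+b^2\cdot b^6+b^3\cdot b^7)-(b^4)^2$, and let $\mathfrak g_2^*\subset\mathfrak{so}(4,3)$ be the Lie algebra of the stabiliser $\mathrm G_2^*$ of the 3-form $\omega=\sqrt2\,(b^{167}+b^{235})-b^4\wedge(b^{15}-b^{26}-b^{37})$. For a Lie subalgebra $\mathfrak h\subset\mathfrak{gl}(7,\mathbb R)$ let $\mathcal K(\mathfrak h)$ be the space of alternating bilinear maps $R:V\times V\to\mathfrak h$ with $R(X,Y)Z+R(Y,Z)X+R(Z,X)Y=0$ for all $X,Y,Z\in V$. Call $\mathfrak h$ a *possible holonomy algebra of Type III* if (a) $\mathfrak h\subset\mathfrak g_2^*$; (b) $\mathfrak h$ is indecomposable, i.e. leaves invariant no proper non-zero subspace of $V$ on which $\langle\cdot,\cdot\rangle$ is non-degenerate; (c) $\mathfrak h$ satisfies Berger's first criterion $\mathfrak h=\mathrm{span}\{R(X,Y)\mid R\in\mathcal K(\mathfrak h),\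 X,Y\in V\}$; (d) the socle of $V$ (the sum of all irreducible $\mathfrak h$-subrepresentations of $V$) has dimension $3$. For $A=\begin{pmatrix}a_1&a_2\\a_3&a_4\end{pmatrix}\in\mathfrak{gl}(2,\mathbb R)$, $v\in\mathbb R$, $y=(y_1,y_2)^\top\in\mathbb R^2$ put $$h(A,v,y)=\begin{pmatrix} \mathrm{tr}A&0&0&\sqrt2v&0&-y_1&-y_2\\ 0&a_1&a_2&0&y_1&0&v\\ 0&a_3&a_4&0&y_2&-v&0\\ 0&0&0&0&\sqrt2v&0&0\\ 0&0&0&0&-\mathrm{tr}A&0&0\\ 0&0&0&0&0&-a_1&-a_3\\ 0&0&0&0&0&-a_2&-a_4\end{pmatrix},$$ and for a Lie subalgebra $\mathfrak a\subset\mathfrak{gl}(2,\mathbb R)$ let $\mathfrak a\ltimes\mathfrak m(1,2)=\{h(A,v,y)\mid A\in\mathfrak a,\ v\in\mathbb R,\ y\in\mathbb R^2\}$ and $\mathfrak a\ltimes\mathfrak m(1,1)=\{h(A,v,(y_1,0)^\top)\mid A\in\mathfrak a,\ v,y_1\in\mathbb R\}$. **Theorem.** Every possible holonomy algebra $\mathfrak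 h$ of Type III is the holonomy algebra of a pseudo-Riemannian metric of signature $(4,3)$: there are a non-empty simply connected open set $U\subset\mathbb R^7$, a real-analytic metric $g$ of signature $(4,3)$ on $U$ (i.e. each $(T_xU,g_x)$ is isometric to $V$), a point $p\in U$ and a linear isometry $P:V\to T_pU$ such that the Lie algebra of the holonomy group at $p$ of the Levi-Civita connection of $g$ equals $P\,\mathfrak h\,P^{-1}$. Moreover, up to conjugation in $\mathrm{SO}(4,3)$ the possible holonomy algebras of Type III are the following eight algebras: $\mathfrak a\ltimes\mathfrak m(1,2)$ with $\mathfrak a\in\{\mathfrak{gl}(2,\mathbb R),\mathfrak{sl}(2,\mathbb R),\mathfrak{co}(2),\mathfrak d\}$, and $\mathfrak a\ltimes\mathfrak m(1,k)$ with $\mathfrak a\in\{\mathbb R\cdot\mathrm{diag}(1,0),0\}$ and $k=1,2$. That is, every possible holonomy algebra of Type III is conjugate in $\mathrm{SO}(4,3)$ to one of these eight, and each of these eight is a possible holonomy algebra of Type III. Here $\mathfrak{co}(2)=\left\{\begin{pmatrix}a&-b\\b&a\end{pmatrix}\right\}$ and $\mathfrak d$ is the algebra of diagonal $2\times2$ matrices.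 -/

import Mathlib

open scoped Matrix ContDiff

attribute [local instance 100] LieRing.ofAssociativeRing

noncomputable section

namespace G2Hol

/-! ### The pseudo-Euclidean space `ℝ^{4,3}` and the Lie algebra `𝔤₂*`

Vectors are `Fin 7 → ℝ`; the basis vector `b_i` (`i = 1, …, 7`) has index `i - 1`. -/

/-- Real `7 × 7` matrices. -/
abbrev M7 : Type := Matrix (Fin 7) (Fin 7) ℝ

/-- Real `2 × 2` matrices. -/
abbrev M2 : Type := Matrix (Fin 2) (Fin 2) ℝ

/-- Gram matrix of `2 (b¹·b⁵ + b²·b⁶ + b³·b⁷) - (b⁴)²`: three positive and four negative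
directions. This is the model of signature `(4,3)`. -/
def eta : M7 :=
  !![0, 0, 0,  0, 1, 0, 0;
     0, 0, 0,  0, 0, 1, 0;
     0, 0, 0,  0, 0, 0, 1;
     0, 0, 0, -1, 0, 0, 0;
     1, 0, 0,  0, 0, 0, 0;
     0, 1, 0,  0, 0, 0, 0;
     0, 0, 1,  0, 0, 0, 0]

/-- The group `SO(4,3)`, as a set of matrices. -/
def SO43 : Set M7 := {P | Pᵀ * eta * P = eta ∧ P.det = 1}

/-- The elementary 3-form `bⁱ ∧ bʲ ∧ bᵏ` (with indices `0, …, 6`). -/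
def wedge3 (i j k : Fin 7) (x y z : Fin 7 → ℝ) : ℝ :=
  x i * (y j * z k - y k * z j) - x j * (y i * z k - y k * z i) + x k * (y i * z j - y j * z i)

/-- The generic 3-form
`ω = √2 (b¹⁶⁷ + b²³⁵) - b⁴ ∧ (b¹⁵ - b²⁶ - b³⁷)`. -/
def omega (x y z : Fin 7 → ℝ) : ℝ :=
  √2 * (wedge3 0 5 6 x y z + wedge3 1 2 4 x y z)
    - (wedge3 3 0 4 x y z - wedge3 3 1 5 x y z - wedge3 3 2 6 x y z)

theorem omega_sub_left (x x' y z : Fin 7 → ℝ) :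
    omega (x - x') y z = omega x y z - omega x' y z := by
  simp only [omega, wedge3, Pi.sub_apply]; ring

theorem omega_sub_mid (x y y' z : Fin 7 → ℝ) :
    omega x (y - y') z = omega x y z - omega x y' z := by
  simp only [omega, wedge3, Pi.sub_apply]; ring

theorem omega_sub_right (x y z z' : Fin 7 → ℝ) :
    omega x y (z - z') = omega x y z - omega x y z' := by
  simp only [omega, wedge3, Pi.sub_apply]; ring

/-- The Lie algebra `𝔤₂*` of the stabiliser `G₂*` of `ω`. -/
def g2Star : LieSubalgebra ℝ M7 where
  carrier := {X | ∀ x y z : Fin 7 → ℝ,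
    omega (X *ᵥ x) y z + omega x (X *ᵥ y) z + omega x y (X *ᵥ z) = 0}
  zero_mem' := by
    intro x y z
    simp [omega, wedge3]
  add_mem' := by
    intro X Y hX hY x y z
    have h1 := hX x y z
    have h2 := hY x y z
    simp only [omega, wedge3, Matrix.add_mulVec, Pi.add_apply] at *
    linear_combination h1 + h2
  smul_mem' := by
    intro c X hX x y z
    have h1 := hX x y z
    simp only [omega, wedge3, Matrix.smul_mulVec, Pi.smul_apply, smul_eq_mul] at *
    linear_combination c * h1
  lie_mem' := by
    intro X Y hX hY x y z
    simp only [Ring.lie_def, Matrix.sub_mulVec, ← Matrix.mulVec_mulVec, omega_sub_left,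
      omega_sub_mid, omega_sub_right]
    linear_combination hX (Y *ᵥ x) y z + hX x (Y *ᵥ y) z + hX x y (Y *ᵥ z)
      - hY (X *ᵥ x) y z - hY x (X *ᵥ y) z - hY x y (X *ᵥ z)

/-! ### Possible holonomy algebras of Type III -/

/-- `W` is an `𝔥`-invariant subspace of `ℝ^{4,3}`. -/
def IsInvariant (h : LieSubalgebra ℝ M7) (W : Submodule ℝ (Fin 7 → ℝ)) : Prop :=
  ∀ X ∈ h, ∀ w ∈ W, X *ᵥ w ∈ W

/-- The inner product is non-degenerate on `W`. -/
def IsNondegenerate (W : Submodule ℝ (Fin 7 → ℝ)) : Prop :=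
  ∀ v ∈ W, (∀ w ∈ W, v ⬝ᵥ (eta *ᵥ w) = 0) → v = 0

/-- `𝔥` leaves invariant no proper non-zero non-degenerate subspace. -/
def IsIndecomposable (h : LieSubalgebra ℝ M7) : Prop :=
  ∀ W, IsInvariant h W → IsNondegenerate W → W = ⊥ ∨ W = ⊤

/-- `W` is an irreducible subrepresentation of `𝔥`. -/
def IsIrreducibleSub (h : LieSubalgebra ℝ M7) (W : Submodule ℝ (Fin 7 → ℝ)) : Prop :=
  IsInvariant h W ∧ W ≠ ⊥ ∧ ∀ W' ≤ W, IsInvariant h W' → W' = ⊥ ∨ W' = W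

/-- The socle: the maximal semisimple subrepresentation, i.e. the sum of all irreducible ones. -/
def socle (h : LieSubalgebra ℝ M7) : Submodule ℝ (Fin 7 → ℝ) :=
  sSup {W | IsIrreducibleSub h W}

/-- The space `𝒦(𝔥)` of algebraic curvature endomorphisms with values in `𝔥`. -/
def curvatureSpace (h : LieSubalgebra ℝ M7) :
    Set ((Fin 7 → ℝ) →ₗ[ℝ] (Fin 7 → ℝ) →ₗ[ℝ] M7) :=
  {R | (∀ x, R x x = 0) ∧ (∀ x y, R x y ∈ h) ∧
    ∀ x y z, R x y *ᵥ z + R y z *ᵥ x + R z x *ᵥ y = 0}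

/-- Berger's first criterion: `𝔥` is spanned by the values of its algebraic curvature
endomorphisms. -/
def IsBerger (h : LieSubalgebra ℝ M7) : Prop :=
  h.toSubmodule = Submodule.span ℝ {X | ∃ R ∈ curvatureSpace h, ∃ x y, X = R x y}

/-- A possible holonomy algebra of Type III: an indecomposable Berger algebra contained in
`𝔤₂*` whose socle has dimension three. -/
structure IsPossibleTypeIII (h : LieSubalgebra ℝ M7) : Prop where
  le_g2Star : h ≤ g2Star
  indecomposable : IsIndecomposable h
  berger : IsBerger h
  finrank_socle : Module.finrank ℝ (socle h) = 3

/-! ### The eight algebras -/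

/-- The matrix `h(A, v, y)`. -/
def hMat (A : M2) (v : ℝ) (y : Fin 2 → ℝ) : M7 :=
  !![A.trace, 0, 0, √2 * v, 0, -y 0, -y 1;
     0, A 0 0, A 0 1, 0, y 0, 0, v;
     0, A 1 0, A 1 1, 0, y 1, -v, 0;
     0, 0, 0, 0, √2 * v, 0, 0;
     0, 0, 0, 0, -A.trace, 0, 0;
     0, 0, 0, 0, 0, -A 0 0, -A 1 0;
     0, 0, 0, 0, 0, -A 0 1, -A 1 1]

theorem hMat_add (A B : M2) (v w : ℝ) (y z : Fin 2 → ℝ) :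
    hMat A v y + hMat B w z = hMat (A + B) (v + w) (y + z) := by
  ext i j
  fin_cases i <;> fin_cases j <;> simp [hMat] <;> ring

theorem hMat_smul (c : ℝ) (A : M2) (v : ℝ) (y : Fin 2 → ℝ) :
    c • hMat A v y = hMat (c • A) (c * v) (c • y) := by
  ext i j
  fin_cases i <;> fin_cases j <;> simp [hMat] <;> ring

theorem hMat_mulVec (A : M2) (v : ℝ) (y : Fin 2 → ℝ) (x : Fin 7 → ℝ) :
    hMat A v y *ᵥ x =
      ![A.trace * x 0 + √2 * v * x 3 - y 0 * x 5 - y 1 * x 6,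
        A 0 0 * x 1 + A 0 1 * x 2 + y 0 * x 4 + v * x 6,
        A 1 0 * x 1 + A 1 1 * x 2 + y 1 * x 4 - v * x 5,
        √2 * v * x 4,
        -A.trace * x 4,
        -A 0 0 * x 5 - A 1 0 * x 6,
        -A 0 1 * x 5 - A 1 1 * x 6] := by
  ext i
  fin_cases i <;> simp [hMat, Matrix.mulVec, dotProduct, Fin.sum_univ_seven] <;> ring

theorem hMat_lie (A B : M2) (v w : ℝ) (y z : Fin 2 → ℝ) :
    ⁅hMat A v y, hMat B w z⁆ =
      hMat ⁅A, B⁆ (A.trace * w - v * B.trace)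
        ((A *ᵥ z + A.trace • z) - (B *ᵥ y + B.trace • y)) := by
  apply Matrix.ext_of_mulVec_single
  intro k
  generalize (Pi.single k 1 : Fin 7 → ℝ) = x
  rw [Ring.lie_def, Matrix.sub_mulVec, ← Matrix.mulVec_mulVec, ← Matrix.mulVec_mulVec]
  simp only [hMat_mulVec]
  ext i
  fin_cases i <;>
    simp [Ring.lie_def, Matrix.mul_apply, Matrix.trace_fin_two, Matrix.vecHead, Matrix.vecTail] <;>
    ring

/-- The algebra `𝔞 ⋉ {h(0, v, y) | v ∈ ℝ, y ∈ Y} = {h(A, v, y) | A ∈ 𝔞, v ∈ ℝ, y ∈ Y}`, for a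
subspace `Y` of `ℝ²` invariant under `𝔞`. -/
def semidirect (a : LieSubalgebra ℝ M2) (Y : Submodule ℝ (Fin 2 → ℝ))
    (hY : ∀ A ∈ a, ∀ y ∈ Y, A *ᵥ y ∈ Y) : LieSubalgebra ℝ M7 where
  carrier := {X | ∃ A ∈ a, ∃ v : ℝ, ∃ y ∈ Y, X = hMat A v y}
  zero_mem' := ⟨0, a.zero_mem, 0, 0, Y.zero_mem, by
    ext i j
    fin_cases i <;> fin_cases j <;> simp [hMat]⟩
  add_mem' := by
    rintro _ _ ⟨A, hA, v, y, hy, rfl⟩ ⟨B, hB, w, z, hz, rfl⟩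
    exact ⟨_, a.add_mem hA hB, _, _, Y.add_mem hy hz, hMat_add A B v w y z⟩
  smul_mem' := by
    rintro c _ ⟨A, hA, v, y, hy, rfl⟩
    exact ⟨_, a.smul_mem c hA, _, _, Y.smul_mem c hy, hMat_smul c A v y⟩
  lie_mem' := by
    rintro _ _ ⟨A, hA, v, y, hy, rfl⟩ ⟨B, hB, w, z, hz, rfl⟩
    exact ⟨_, a.lie_mem hA hB, _, _,
      Y.sub_mem (Y.add_mem (hY A hA z hz) (Y.smul_mem _ hz))
        (Y.add_mem (hY B hB y hy) (Y.smul_mem _ hy)), hMat_lie A B v w y z⟩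

/-- `𝔠𝔬(2)`, the matrices `(a, -b; b, a)`. -/
def co2 : LieSubalgebra ℝ M2 where
  carrier := {A | A 0 0 = A 1 1 ∧ A 0 1 = -A 1 0}
  zero_mem' := by simp
  add_mem' := by
    rintro A B ⟨h1, h2⟩ ⟨h3, h4⟩
    exact ⟨by simp [h1, h3], by simp [h2, h4]; ring⟩
  smul_mem' := by
    rintro c A ⟨h1, h2⟩
    exact ⟨by simp [h1], by simp [h2]⟩
  lie_mem' := by
    rintro A B ⟨h1, h2⟩ ⟨h3, h4⟩
    constructor <;> simp [Ring.lie_def, Matrix.mul_apply, Fin.sum_univ_two, h1, h2, h3, h4] <;>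
      ring

/-- `𝔡`, the diagonal matrices. -/
def diag2 : LieSubalgebra ℝ M2 where
  carrier := {A | A 0 1 = 0 ∧ A 1 0 = 0}
  zero_mem' := by simp
  add_mem' := by
    rintro A B ⟨h1, h2⟩ ⟨h3, h4⟩
    exact ⟨by simp [h1, h3], by simp [h2, h4]⟩
  smul_mem' := by
    rintro c A ⟨h1, h2⟩
    exact ⟨by simp [h1], by simp [h2]⟩
  lie_mem' := by
    rintro A B ⟨h1, h2⟩ ⟨h3, h4⟩
    constructor <;> simp [Ring.lie_def, Matrix.mul_apply, Fin.sum_univ_two, h1, h2, h3, h4]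

/-- `ℝ · diag(1, 0)`. -/
def line10 : LieSubalgebra ℝ M2 where
  carrier := {A | ∃ c : ℝ, A = !![c, 0; 0, 0]}
  zero_mem' := ⟨0, by ext i j; fin_cases i <;> fin_cases j <;> simp⟩
  add_mem' := by
    rintro _ _ ⟨c, rfl⟩ ⟨d, rfl⟩
    exact ⟨c + d, by ext i j; fin_cases i <;> fin_cases j <;> simp⟩
  smul_mem' := by
    rintro r _ ⟨c, rfl⟩
    exact ⟨r * c, by ext i j; fin_cases i <;> fin_cases j <;> simp⟩
  lie_mem' := by
    rintro _ _ ⟨c, rfl⟩ ⟨d, rfl⟩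
    exact ⟨0, by
      ext i j
      fin_cases i <;> fin_cases j <;> simp [Ring.lie_def, mul_comm]⟩

/-- The line `{(y₁, 0)ᵀ}` in `ℝ²`. -/
def lineY : Submodule ℝ (Fin 2 → ℝ) where
  carrier := {y | y 1 = 0}
  zero_mem' := by simp
  add_mem' := by
    intro y z (hy : y 1 = 0) (hz : z 1 = 0)
    simp [hy, hz]
  smul_mem' := by
    intro c y (hy : y 1 = 0)
    simp [hy]

/-- `𝔞 ⋉ 𝔪(1,2)`. -/
def semi12 (a : LieSubalgebra ℝ M2) : LieSubalgebra ℝ M7 :=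
  semidirect a ⊤ fun _ _ _ _ => Submodule.mem_top

/-- `ℝ · diag(1, 0) ⋉ 𝔪(1,1)`. -/
def line10Semi11 : LieSubalgebra ℝ M7 :=
  semidirect line10 lineY (by
    rintro _ ⟨c, rfl⟩ y (_ : y 1 = 0)
    change (!![c, 0; 0, 0] *ᵥ y) 1 = 0
    simp [Matrix.mulVec, dotProduct])

/-- `0 ⋉ 𝔪(1,1) = 𝔪(1,1)`. -/
def zeroSemi11 : LieSubalgebra ℝ M7 :=
  semidirect ⊥ lineY (by
    intro A hA y _
    rw [LieSubalgebra.mem_bot] at hA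
    rw [hA, Matrix.zero_mulVec]
    exact lineY.zero_mem)

/-- The eight Type III algebras. -/
def typeIIIList : Set (LieSubalgebra ℝ M7) :=
  {semi12 ⊤, semi12 (LieAlgebra.SpecialLinear.sl (Fin 2) ℝ), semi12 co2, semi12 diag2,
    line10Semi11, semi12 line10, zeroSemi11, semi12 ⊥}

/-! ### Pseudo-Riemannian metrics on open subsets of `ℝ⁷` and their holonomy -/

/-- A real-analytic pseudo-Riemannian metric of signature `(4,3)` on `U ⊆ ℝ⁷`, given by its
Gram matrices `g x = (g_{ij}(x))` in the standard coordinates. -/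
structure IsMetric43 (U : Set (Fin 7 → ℝ)) (g : (Fin 7 → ℝ) → M7) : Prop where
  analytic : ∀ i j, AnalyticOnNhd ℝ (fun x => g x i j) U
  symm : ∀ x ∈ U, (g x).IsSymm
  signature : ∀ x ∈ U, ∃ P : M7, IsUnit P ∧ Pᵀ * g x * P = eta

/-- The partial derivative `∂_i f`. -/
def pderiv (i : Fin 7) (f : (Fin 7 → ℝ) → ℝ) (x : Fin 7 → ℝ) : ℝ :=
  fderiv ℝ f x (Pi.single i 1)

/-- The Christoffel symbol `Γ^k_{ij}` of the Levi-Civita connection of `g`. -/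
def christoffel (g : (Fin 7 → ℝ) → M7) (x : Fin 7 → ℝ) (k i j : Fin 7) : ℝ :=
  1 / 2 * ∑ l, (g x)⁻¹ k l *
    (pderiv i (fun y => g y j l) x + pderiv j (fun y => g y i l) x
      - pderiv l (fun y => g y i j) x)

/-- The matrix `(Γ(u))^k_j = ∑_i Γ^k_{ij} uⁱ`, so that `∇_{γ'} w = w' + Γ(γ') w` for a vector
field `w` along a curve `γ`. -/
def connMatrix (g : (Fin 7 → ℝ) → M7) (x u : Fin 7 → ℝ) : M7 :=
  Matrix.of fun k j => ∑ i, christoffel g x k i j * u i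

/-- `IsParallelTransport U g p q T`: the map `T : T_pU → T_qU` is the Levi-Civita parallel
transport along some piecewise smooth curve in `U` from `p` to `q`. The first constructor treats
a smooth curve `γ : [0,1] → U`; there the columns of `W t` are the parallel fields along `γ` which
start at the standard basis vectors. The second one treats concatenations. -/
inductive IsParallelTransport (U : Set (Fin 7 → ℝ)) (g : (Fin 7 → ℝ) → M7) :
    (Fin 7 → ℝ) → (Fin 7 → ℝ) → M7 → Prop
  | smooth (γ : ℝ → Fin 7 → ℝ) (W : ℝ → M7) (hγ : ContDiff ℝ ∞ γ)
      (hU : ∀ t ∈ Set.Icc (0 : ℝ) 1, γ t ∈ U) (h0 : W 0 = 1)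
      (hW : ∀ t ∈ Set.Icc (0 : ℝ) 1, ∀ i j, HasDerivWithinAt (fun s => W s i j)
        ((-(connMatrix g (γ t) (deriv γ t) * W t)) i j) (Set.Icc 0 1) t) :
      IsParallelTransport U g (γ 0) (γ 1) (W 1)
  | comp {p q r : Fin 7 → ℝ} {S T : M7} (hS : IsParallelTransport U g p q S)
      (hT : IsParallelTransport U g q r T) : IsParallelTransport U g p r (T * S)

/-- The holonomy group at `p`: parallel transports around piecewise smooth loops based at `p`. -/
def holonomyGroup (U : Set (Fin 7 → ℝ)) (g : (Fin 7 → ℝ) → M7) (p : Fin 7 → ℝ) : Set M7 :=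
  {T | IsParallelTransport U g p p T}

/-- The Lie algebra of a group of matrices: the velocities at the identity of the `C¹` curves in
the matrix space which run in the group. (On a Lie subgroup, embedded or not, these are the
tangent vectors at the identity.) -/
def lieAlgebraOf (H : Set M7) : Set M7 :=
  {X | ∃ c : ℝ → M7, (∀ i j, ContDiff ℝ 1 fun t => c t i j) ∧ (∀ t, c t ∈ H) ∧ c 0 = 1 ∧
    ∀ i j, deriv (fun t => c t i j) 0 = X i j}

/-- The holonomy algebra at `p`. -/
def holonomyAlgebra (U : Set (Fin 7 → ℝ)) (g : (Fin 7 → ℝ) → M7) (p : Fin 7 → ℝ) : Set M7 :=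
  lieAlgebraOf (holonomyGroup U g p)

/-- `𝔥` is the holonomy algebra of a real-analytic pseudo-Riemannian metric of signature `(4,3)`
on a non-empty simply connected open subset of `ℝ⁷`: for some base point `p`, an isometry
`P : ℝ^{4,3} → T_pU` carries `𝔥` to the holonomy algebra at `p`. -/
def IsRealised (h : LieSubalgebra ℝ M7) : Prop :=
  ∃ (U : Set (Fin 7 → ℝ)) (g : (Fin 7 → ℝ) → M7),
    IsOpen U ∧ SimplyConnectedSpace U ∧ IsMetric43 U g ∧
    ∃ p ∈ U, ∃ P : M7, IsUnit P ∧ Pᵀ * g p * P = eta ∧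
      holonomyAlgebra U g p = {Z | ∃ X ∈ h, Z = P * X * P⁻¹}

/-- `𝔥` and `𝔥₀` are conjugate in `SO(4,3)`. -/
def IsConjugate (h h₀ : LieSubalgebra ℝ M7) : Prop :=
  ∃ P ∈ SO43, (h : Set M7) = {Z | ∃ X ∈ h₀, Z = P * X * P⁻¹}

end G2Hol

end

noncomputable section

namespace G2Hol

open scoped Matrix.Norms.Operator

/-! ### Calculus of curves of matrices -/

/-! Classification. The cross product given by ⟨x × y, z⟩ = ω(x, y, z) satisfies a quadratic
identity, and 𝔤₂* acts on it by derivations. Let S be the three-dimensional socle. A complement of S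
∩ S^⊥ in S is non-degenerate, so indecomposability makes S totally isotropic; if ω were non-zero on
S, then S + S × S would be a proper non-degenerate invariant subspace. Hence S × S lies in S,
because three is the maximal isotropic dimension, and it is a line ℝb₁. Semisimplicity of S supplies
an invariant plane spanned by b₂, b₃ complementary to this line, and cross products with a null
vector b₅ dual to b₁ complete an isometric copy of the standard basis. In it 𝔥 consists of matrices
h(A, v, y) (`IsPossibleTypeIII.exists_adaptedFrame`, `AdaptedFrame.exists_matrix`).

The matrices A form a subalgebra 𝔞 which acts completely reducibly on ℝ², so up to conjugation it is
diagonal or contains a matrix with non-real eigenvalues (`exists_conj_diagonal_or_rotation`). Pair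
symmetry and the Bianchi identity describe all curvature endomorphisms with values h(A, v, y) by a
few parameters (`exists_curvatureData`), and Berger's criterion says that their values span 𝔥. This
produces a non-zero h(0, 0, y) in 𝔥 and restricts 𝔞 to 0, a coordinate line or 𝔡 in the diagonal
case; otherwise 𝔞 is 𝔠𝔬(2), 𝔰𝔩(2) or 𝔤𝔩(2). Indecomposability prevents v from being a fixed multiple
of the trace, which yields an element h(0, 1, y). The listed forms follow, after a unipotent shear
when the translations y form only a line.

Conversely, the smallest of the eight algebras is already indecomposable, the nilpotent element h(0,
1, 0) confines the socle to the span of b₁, b₂, b₃, and explicit curvature endomorphisms verify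
Berger's criterion.

Realisation. A family of polynomial metrics on ℝ⁷ has, in a polynomial coframe, a connection form Ω
with values h(A, v, y). For the upper bound, parallel transport in the coframe solves V' = -ΩV, so
it stays in any matrix algebra containing the values of Ω and preserves ω; matrix algebra and 𝔤₂*
together cut out the required 𝔥. For the lower bound, loops shaped like rectangles with three
trivial sides have holonomy exp(tΩ), and the values of Ω found in this way generate 𝔥 under brackets
(`WaveData.exp_mem_holonomyGroup`, `WaveData.isRealised_of_bounds`). Conjugate algebras are realised
by the same metric with another identification of the tangent space. -/

theorem hasDerivWithinAt_matrix_iff {c : ℝ → M7} {X : M7} {s : Set ℝ} {t : ℝ} :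
    HasDerivWithinAt c X s t ↔ ∀ i j, HasDerivWithinAt (fun r => c r i j) (X i j) s t := by
  constructor
  · intro h i j
    let φ : M7 →L[ℝ] ℝ := LinearMap.toContinuousLinearMap (Matrix.entryLinearMap ℝ ℝ i j)
    exact φ.hasFDerivAt.comp_hasDerivWithinAt t h
  · intro h
    have h1 : HasDerivWithinAt (fun r => (fun i j => c r i j : Fin 7 → Fin 7 → ℝ))
        (fun i j => X i j) s t :=
      hasDerivWithinAt_pi.2 fun i => hasDerivWithinAt_pi.2 fun j => h i j
    let φ : (Fin 7 → Fin 7 → ℝ) →L[ℝ] M7 :=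
      LinearMap.toContinuousLinearMap (Matrix.ofLinearEquiv ℝ).toLinearMap
    exact φ.hasFDerivAt.comp_hasDerivWithinAt t h1

theorem hasDerivAt_matrix_iff {c : ℝ → M7} {X : M7} {t : ℝ} :
    HasDerivAt c X t ↔ ∀ i j, HasDerivAt (fun r => c r i j) (X i j) t := by
  refine hasDerivWithinAt_univ.symm.trans (hasDerivWithinAt_matrix_iff.trans ?_)
  simp only [hasDerivWithinAt_univ]

theorem contDiff_matrix_iff {c : ℝ → M7} {n : WithTop ℕ∞} :
    ContDiff ℝ n c ↔ ∀ i j, ContDiff ℝ n fun r => c r i j := by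
  constructor
  · intro h i j
    let φ : M7 →L[ℝ] ℝ := LinearMap.toContinuousLinearMap (Matrix.entryLinearMap ℝ ℝ i j)
    exact φ.contDiff.comp h
  · intro h
    have h1 : ContDiff ℝ n (fun r => (fun i j => c r i j : Fin 7 → Fin 7 → ℝ)) :=
      contDiff_pi.2 fun i => contDiff_pi.2 fun j => h i j
    let φ : (Fin 7 → Fin 7 → ℝ) →L[ℝ] M7 :=
      LinearMap.toContinuousLinearMap (Matrix.ofLinearEquiv ℝ).toLinearMap
    exact φ.contDiff.comp h1

theorem hasDerivWithinAt_mulVec {c : ℝ → M7} {X : M7} {s : Set ℝ} {t : ℝ}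
    (h : HasDerivWithinAt c X s t) (x : Fin 7 → ℝ) (i : Fin 7) :
    HasDerivWithinAt (fun r => (c r *ᵥ x) i) ((X *ᵥ x) i) s t := by
  simp only [Matrix.mulVec, dotProduct]
  exact HasDerivWithinAt.fun_sum fun j _ =>
    (hasDerivWithinAt_matrix_iff.1 h i j).mul_const (x j)

theorem hasDerivWithinAt_wedge3 (i j k : Fin 7) {a b c : ℝ → Fin 7 → ℝ} {a' b' c' : Fin 7 → ℝ}
    {s : Set ℝ} {t : ℝ} (ha : ∀ l, HasDerivWithinAt (fun r => a r l) (a' l) s t)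
    (hb : ∀ l, HasDerivWithinAt (fun r => b r l) (b' l) s t)
    (hc : ∀ l, HasDerivWithinAt (fun r => c r l) (c' l) s t) :
    HasDerivWithinAt (fun r => wedge3 i j k (a r) (b r) (c r))
      (wedge3 i j k a' (b t) (c t) + wedge3 i j k (a t) b' (c t)
        + wedge3 i j k (a t) (b t) c') s t := by
  have key : ∀ l m n : Fin 7, HasDerivWithinAt
      (fun r => a r l * (b r m * c r n - b r n * c r m))
      (a' l * (b t m * c t n - b t n * c t m)
        + a t l * ((b' m * c t n + b t m * c' n) - (b' n * c t m + b t n * c' m))) s t :=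
    fun l m n => (ha l).mul (((hb m).mul (hc n)).sub ((hb n).mul (hc m)))
  have h := ((key i j k).sub (key j i k)).add (key k i j)
  unfold wedge3
  refine h.congr_deriv ?_
  ring

theorem hasDerivWithinAt_omega {a b c : ℝ → Fin 7 → ℝ} {a' b' c' : Fin 7 → ℝ}
    {s : Set ℝ} {t : ℝ} (ha : ∀ l, HasDerivWithinAt (fun r => a r l) (a' l) s t)
    (hb : ∀ l, HasDerivWithinAt (fun r => b r l) (b' l) s t)
    (hc : ∀ l, HasDerivWithinAt (fun r => c r l) (c' l) s t) :
    HasDerivWithinAt (fun r => omega (a r) (b r) (c r))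
      (omega a' (b t) (c t) + omega (a t) b' (c t) + omega (a t) (b t) c') s t := by
  have h := fun i j k => hasDerivWithinAt_wedge3 i j k ha hb hc
  have h' := (((h 0 5 6).add (h 1 2 4)).const_mul (√2)).sub
    (((h 3 0 4).sub (h 3 1 5)).sub (h 3 2 6))
  unfold omega
  refine h'.congr_deriv ?_
  ring

/-- The velocity of a curve in a linear subspace belongs to the subspace. -/
theorem mem_of_hasDerivAt {S : Submodule ℝ M7} {c : ℝ → M7} {X : M7} {t : ℝ}
    (h : HasDerivAt c X t) (hc : ∀ r, c r ∈ S) : X ∈ S := by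
  by_contra hX
  -- A functional that vanishes on `S` but not at `X` is constant along the curve, although its
  -- derivative would be `f X`.
  obtain ⟨f, hf, hle⟩ := Submodule.exists_le_ker_of_notMem hX
  have h1 : HasDerivAt (fun r => f (c r)) (f X) t :=
    (LinearMap.toContinuousLinearMap f).hasFDerivAt.comp_hasDerivAt t h
  have h2 : (fun r => f (c r)) = fun _ => 0 := funext fun r => hle (hc r)
  rw [h2] at h1
  exact hf (h1.unique (hasDerivAt_const t 0))

/-! ### Linear differential equations with values in a matrix algebra -/

/-- Grönwall's inequality. Derivatives are taken within the closed unit interval because parallel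
fields are only prescribed there. -/
theorem eq_zero_of_linear_ode {E : Type*} [NormedAddCommGroup E] [NormedSpace ℝ E]
    {u u' : ℝ → E} {K : ℝ} (hu : ∀ t ∈ Set.Icc (0 : ℝ) 1, HasDerivWithinAt u (u' t) (Set.Icc 0 1) t)
    (h0 : u 0 = 0) (hK : ∀ t ∈ Set.Icc (0 : ℝ) 1, ‖u' t‖ ≤ K * ‖u t‖) : u 1 = 0 := by
  refine eq_zero_of_abs_deriv_le_mul_abs_self_of_eq_zero_right (a := 0) (b := 1) (f := u)
    (f' := u') (K := K) (fun t ht => (hu t ht).continuousWithinAt) (fun t ht => ?_) h0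
    (fun t ht => hK t ⟨ht.1, ht.2.le⟩) 1 (by simp)
  exact (hu t ⟨ht.1, ht.2.le⟩).mono_of_mem_nhdsWithin (Icc_mem_nhdsGE_of_mem ht)

/-- A solution of `W' = -Ω W` stays in a matrix algebra which contains the values of `Ω`. -/
theorem ode_solution_mem_subalgebra {𝔸 : Type*} [NormedRing 𝔸] [NormedAlgebra ℝ 𝔸]
    [FiniteDimensional ℝ 𝔸] {L : Subalgebra ℝ 𝔸} {W Ω : ℝ → 𝔸} (hΩ : Continuous Ω)
    (hL : ∀ t, Ω t ∈ L) (h0 : W 0 ∈ L)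
    (hW : ∀ t ∈ Set.Icc (0 : ℝ) 1, HasDerivWithinAt W (-(Ω t * W t)) (Set.Icc 0 1) t) :
    W 1 ∈ L := by
  -- `π` is a linear projection onto `L`, so `Φ = id - π` has kernel `L`; finite dimension makes it
  -- continuous. It remains to see that `Φ ∘ W` obeys a linear differential inequality.
  obtain ⟨π, hπ⟩ := LinearMap.exists_leftInverse_of_injective
    (Subalgebra.toSubmodule L).subtype (Submodule.ker_subtype _)
  have hπ' : ∀ X : Subalgebra.toSubmodule L, π X = X := fun X => LinearMap.congr_fun hπ X
  let Φ : 𝔸 →ₗ[ℝ] 𝔸 := LinearMap.id - (Subalgebra.toSubmodule L).subtype ∘ₗ π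
  have hΦ : ∀ X, Φ X = X - π X := fun X => rfl
  have hΦ0 : ∀ X, X ∈ L → Φ X = 0 := by
    intro X hX
    rw [hΦ]
    have := hπ' ⟨X, hX⟩
    simp only at this
    rw [this, sub_self]
  have hΦmem : ∀ X, Φ X = 0 → X ∈ L := by
    intro X hX
    rw [hΦ, sub_eq_zero] at hX
    rw [hX]
    exact (π X).2
  let Ψ : 𝔸 →L[ℝ] 𝔸 := LinearMap.toContinuousLinearMap Φ
  obtain ⟨K, hK⟩ := (isCompact_Icc (a := (0 : ℝ)) (b := 1)).exists_bound_of_continuousOn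
    hΩ.continuousOn
  apply hΦmem
  refine eq_zero_of_linear_ode (u := fun t => Ψ (W t)) (u' := fun t => Ψ (-(Ω t * W t)))
    (K := ‖Ψ‖ * K) (fun t ht => Ψ.hasFDerivAt.comp_hasDerivWithinAt t (hW t ht)) (hΦ0 _ h0) ?_
  intro t ht
  -- The difference of the two sides is the image of `Ω t * π (W t)`, a product of elements of `L`;
  -- closure under multiplication enters here.
  have h1 : Ψ (-(Ω t * W t)) = -Ψ (Ω t * Ψ (W t)) := by
    have h2 : Φ (Ω t * (π (W t) : 𝔸)) = 0 := hΦ0 _ (L.mul_mem (hL t) (π (W t)).2)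
    change Φ (-(Ω t * W t)) = -Φ (Ω t * Φ (W t))
    rw [hΦ (W t), mul_sub, map_sub, h2, sub_zero, map_neg]
  rw [h1, norm_neg]
  calc ‖Ψ (Ω t * Ψ (W t))‖ ≤ ‖Ψ‖ * (‖Ω t‖ * ‖Ψ (W t)‖) :=
        (Ψ.le_opNorm _).trans (mul_le_mul_of_nonneg_left (norm_mul_le _ _) (norm_nonneg _))
    _ ≤ ‖Ψ‖ * (K * ‖Ψ (W t)‖) := by gcongr; exact hK t ht
    _ = ‖Ψ‖ * K * ‖Ψ (W t)‖ := by ring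

/-- A solution of `W' = -Ω W` with `Ω` in `𝔤₂*` leaves `ω` invariant. -/
theorem ode_solution_preserves_omega {W Ω : ℝ → M7} (hL : ∀ t, Ω t ∈ g2Star) (h0 : W 0 = 1)
    (hW : ∀ t ∈ Set.Icc (0 : ℝ) 1, HasDerivWithinAt W (-(Ω t * W t)) (Set.Icc 0 1) t)
    (x y z : Fin 7 → ℝ) : omega (W 1 *ᵥ x) (W 1 *ᵥ y) (W 1 *ᵥ z) = omega x y z := by
  -- The quantity is constant, its derivative being the infinitesimal invariance of `ω`; hence the
  -- bound `K = 0`.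
  have h := eq_zero_of_linear_ode (K := 0)
    (u := fun t => omega (W t *ᵥ x) (W t *ᵥ y) (W t *ᵥ z) - omega x y z) (u' := fun _ => 0)
    (fun t ht => ?_) (by simp [h0]) (by simp)
  · linarith
  have hd := fun x => hasDerivWithinAt_mulVec (hW t ht) x
  refine ((hasDerivWithinAt_omega (hd x) (hd y) (hd z)).sub_const _).congr_deriv ?_
  have h1 := hL t (W t *ᵥ x) (W t *ᵥ y) (W t *ᵥ z)
  simp only [Matrix.neg_mulVec, ← Matrix.mulVec_mulVec]
  have n1 : ∀ a b c : Fin 7 → ℝ, omega (-a) b c = -omega a b c := by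
    intro a b c; simp only [omega, wedge3, Pi.neg_apply]; ring
  have n2 : ∀ a b c : Fin 7 → ℝ, omega a (-b) c = -omega a b c := by
    intro a b c; simp only [omega, wedge3, Pi.neg_apply]; ring
  have n3 : ∀ a b c : Fin 7 → ℝ, omega a b (-c) = -omega a b c := by
    intro a b c; simp only [omega, wedge3, Pi.neg_apply]; ring
  rw [n1, n2, n3]
  linarith

/-- The matrices of a matrix algebra which preserve `ω`. -/
def omegaStabilizer (L : Subalgebra ℝ M7) : Set M7 :=
  {T | T ∈ L ∧ ∀ x y z, omega (T *ᵥ x) (T *ᵥ y) (T *ᵥ z) = omega x y z}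

/-- Differentiation of a linear condition and of the constant function ω(c x, c y, c z). An
associative algebra alone is too coarse an upper bound; the equations of 𝔤₂* couple the entries
which `L` leaves free. -/
theorem mem_of_mem_lieAlgebraOf_omegaStabilizer {L : Subalgebra ℝ M7} {X : M7}
    (hX : X ∈ lieAlgebraOf (omegaStabilizer L)) : X ∈ L ∧ X ∈ g2Star := by
  obtain ⟨c, hc, hm, h0, hd⟩ := hX
  have hd' : HasDerivAt c X 0 := hasDerivAt_matrix_iff.2 fun i j => by
    rw [← hd i j]
    exact ((hc i j).differentiable one_ne_zero 0).hasDerivAt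
  refine ⟨mem_of_hasDerivAt (S := Subalgebra.toSubmodule L) hd' fun r => (hm r).1, ?_⟩
  intro x y z
  have hv := fun x => hasDerivWithinAt_mulVec (s := Set.univ) hd'.hasDerivWithinAt x
  have h1 := hasDerivWithinAt_omega (hv x) (hv y) (hv z)
  simp only [(hm _).2, h0, Matrix.one_mulVec, hasDerivWithinAt_univ] at h1
  exact h1.unique (hasDerivAt_const _ _)

/-! ### The Lie algebra of a set of matrices closed under multiplication -/

/-- The product of two curves through the identity has the sum of their velocities as its velocity
there. -/
theorem add_mem_lieAlgebraOf {H : Set M7} (hH : ∀ S ∈ H, ∀ T ∈ H, S * T ∈ H) {X Y : M7}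
    (hX : X ∈ lieAlgebraOf H) (hY : Y ∈ lieAlgebraOf H) : X + Y ∈ lieAlgebraOf H := by
  obtain ⟨c, hc, hcH, hc0, hcd⟩ := hX
  obtain ⟨d, hd, hdH, hd0, hdd⟩ := hY
  refine ⟨fun t => c t * d t, ?_, fun t => hH _ (hcH t) _ (hdH t), by simp [hc0, hd0], ?_⟩
  · exact contDiff_matrix_iff.1 ((contDiff_matrix_iff.2 hc).mul (contDiff_matrix_iff.2 hd))
  · intro i j
    have h1 : HasDerivAt c X 0 := hasDerivAt_matrix_iff.2 fun i j => by
      rw [← hcd i j]; exact ((hc i j).differentiable one_ne_zero 0).hasDerivAt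
    have h2 : HasDerivAt d Y 0 := hasDerivAt_matrix_iff.2 fun i j => by
      rw [← hdd i j]; exact ((hd i j).differentiable one_ne_zero 0).hasDerivAt
    have h3 := h1.mul h2
    rw [hc0, hd0, mul_one, one_mul] at h3
    exact (hasDerivAt_matrix_iff.1 h3 i j).deriv

theorem smul_mem_lieAlgebraOf {H : Set M7} (r : ℝ) {X : M7} (hX : X ∈ lieAlgebraOf H) :
    r • X ∈ lieAlgebraOf H := by
  obtain ⟨c, hc, hcH, hc0, hcd⟩ := hX
  refine ⟨fun t => c (r * t), ?_, fun t => hcH _, by simp [hc0], ?_⟩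
  · intro i j
    exact (hc i j).comp (contDiff_const.mul contDiff_id)
  · intro i j
    have h1 : HasDerivAt (fun t => c t i j) (X i j) (r * 0) := by
      rw [mul_zero, ← hcd i j]; exact ((hc i j).differentiable one_ne_zero 0).hasDerivAt
    have h2 : HasDerivAt (fun t : ℝ => r * t) r 0 := by
      simpa using (hasDerivAt_id (0 : ℝ)).const_mul r
    have h3 := HasDerivAt.comp (0 : ℝ) h1 h2
    rw [Matrix.smul_apply, smul_eq_mul, mul_comm]
    exact h3.deriv

/-- The Lie algebra of a set of matrices closed under multiplication, as a linear subspace. -/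
def lieSubmodule (H : Set M7) (h1 : 1 ∈ H) (hH : ∀ S ∈ H, ∀ T ∈ H, S * T ∈ H) :
    Submodule ℝ M7 where
  carrier := lieAlgebraOf H
  zero_mem' := ⟨fun _ => 1, fun _ _ => contDiff_const, fun _ => h1, rfl, fun i j => by simp⟩
  add_mem' := add_mem_lieAlgebraOf hH
  smul_mem' := fun r _ hX => smul_mem_lieAlgebraOf r hX

theorem contDiff_exp_smul (M : M7) : ContDiff ℝ 1 fun t : ℝ => NormedSpace.exp (t • M) := by
  rw [contDiff_one_iff_deriv]
  have h := fun t : ℝ => hasDerivAt_exp_smul_const M t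
  refine ⟨fun t => (h t).differentiableAt, ?_⟩
  have h2 : Continuous fun t : ℝ => NormedSpace.exp (t • M) * M :=
    (continuous_iff_continuousAt.2 fun t => (h t).continuousAt).mul continuous_const
  exact h2.congr fun t => (h t).deriv.symm

theorem mem_lieAlgebraOf_of_exp {H : Set M7} {M : M7}
    (hM : ∀ t : ℝ, NormedSpace.exp (t • M) ∈ H) : M ∈ lieAlgebraOf H := by
  refine ⟨fun t => NormedSpace.exp (t • M), contDiff_matrix_iff.1 (contDiff_exp_smul M), hM,
    by simp, fun i j => ?_⟩
  have h := hasDerivAt_exp_smul_const M (0 : ℝ)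
  rw [zero_smul, NormedSpace.exp_zero, one_mul] at h
  exact (hasDerivAt_matrix_iff.1 h i j).deriv

/-- The bracket is the velocity at `s = 0` of the curve exp(sM) Y exp(-sM), which runs in the
subspace. Having the whole one-parameter group of `M` in `H` makes any knowledge of `H` as a Lie
group unnecessary. -/
theorem lie_mem_lieSubmodule {H : Set M7} (h1 : 1 ∈ H) (hH : ∀ S ∈ H, ∀ T ∈ H, S * T ∈ H)
    {M Y : M7} (hM : ∀ t : ℝ, NormedSpace.exp (t • M) ∈ H) (hY : Y ∈ lieSubmodule H h1 hH) :
    ⁅M, Y⁆ ∈ lieSubmodule H h1 hH := by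
  have hconj : ∀ s : ℝ, NormedSpace.exp (s • M) * Y * NormedSpace.exp (s • (-M)) ∈
      lieSubmodule H h1 hH := by
    intro s
    obtain ⟨c, hc, hcH, hc0, hcd⟩ := hY
    have hc' := contDiff_matrix_iff.2 hc
    have hd : HasDerivAt c Y 0 := hasDerivAt_matrix_iff.2 fun i j => by
      rw [← hcd i j]; exact ((hc i j).differentiable one_ne_zero 0).hasDerivAt
    refine ⟨fun t => NormedSpace.exp (s • M) * c t * NormedSpace.exp (s • (-M)),
      contDiff_matrix_iff.1 ((contDiff_const.mul hc').mul contDiff_const), fun t => ?_, ?_,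
      fun i j => ?_⟩
    · refine hH _ (hH _ (hM s) _ (hcH t)) _ ?_
      rw [smul_neg, ← neg_smul]
      exact hM (-s)
    · change NormedSpace.exp (s • M) * c 0 * NormedSpace.exp (s • (-M)) = 1
      rw [hc0, mul_one, smul_neg, ← Matrix.exp_add_of_commute (s • M) _
        (Commute.refl (s • M)).neg_right,
        add_neg_cancel, NormedSpace.exp_zero]
    · exact (hasDerivAt_matrix_iff.1 ((hd.const_mul (NormedSpace.exp (s • M))).mul_const
        (NormedSpace.exp (s • (-M)))) i j).deriv
  have h2 : HasDerivAt (fun s : ℝ => NormedSpace.exp (s • M) * Y * NormedSpace.exp (s • (-M)))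
      ⁅M, Y⁆ 0 := by
    have h3 := ((hasDerivAt_exp_smul_const M (0 : ℝ)).mul_const Y).mul
      (hasDerivAt_exp_smul_const (-M) (0 : ℝ))
    refine h3.congr_deriv ?_
    simp only [zero_smul, NormedSpace.exp_zero, one_mul, mul_one, mul_neg, Ring.lie_def]
    abel
  exact mem_of_hasDerivAt h2 hconj

end G2Hol

end

noncomputable section

namespace G2Hol

open scoped Matrix.Norms.Operator

/-! ### Parallel transport in a moving frame -/

/-- `E` is a field of coframes with inverse `F` and differential `dE` in which the Levi-Civita
connection of `g` has the connection form `Ω`. -/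
structure IsGauge (g E F : (Fin 7 → ℝ) → M7) (dE Ω : (Fin 7 → ℝ) → (Fin 7 → ℝ) → M7) : Prop where
  mul_inv : ∀ x, E x * F x = 1
  inv_mul : ∀ x, F x * E x = 1
  deriv : ∀ {γ : ℝ → Fin 7 → ℝ} {γ' : Fin 7 → ℝ} {s : Set ℝ} {t : ℝ},
    HasDerivWithinAt γ γ' s t → HasDerivWithinAt (fun r => E (γ r)) (dE (γ t) γ') s t
  deriv_inv : ∀ {γ : ℝ → Fin 7 → ℝ} {γ' : Fin 7 → ℝ} {s : Set ℝ} {t : ℝ},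
    HasDerivWithinAt γ γ' s t →
      HasDerivWithinAt (fun r => F (γ r)) (-(F (γ t) * dE (γ t) γ' * F (γ t))) s t
  conn : ∀ x u, connMatrix g x u = F x * (Ω x u * E x + dE x u)
  continuous : Continuous fun z : (Fin 7 → ℝ) × (Fin 7 → ℝ) => Ω z.1 z.2

variable {g E F : (Fin 7 → ℝ) → M7} {dE Ω : (Fin 7 → ℝ) → (Fin 7 → ℝ) → M7}

theorem ode_solution_mem_matrix_subalgebra {L : Subalgebra ℝ M7} {W Ω : ℝ → M7}
    (hΩ : Continuous Ω) (hL : ∀ t, Ω t ∈ L) (h0 : W 0 ∈ L)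
    (hW : ∀ t ∈ Set.Icc (0 : ℝ) 1, HasDerivWithinAt W (-(Ω t * W t)) (Set.Icc 0 1) t) :
    W 1 ∈ L :=
  ode_solution_mem_subalgebra (𝔸 := M7) (L := L) hΩ hL h0 hW

/-- The algebra behind the change of frame: if W solves the transport equation in coordinates, then
`E * W * G` with constant `G` solves the one for the connection form `Ω`. -/
theorem gauge_transform {R : Type*} [Ring R] {E F : R} (h : E * F = 1) (D W Ω G : R) :
    (D * W + E * -(F * (Ω * E + D) * W)) * G = -(Ω * (E * W * G)) := by
  have e : E * -(F * (Ω * E + D) * W) = -((E * F) * (Ω * E + D) * W) := by noncomm_ring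
  rw [e, h]
  noncomm_ring

/-- The converse change of frame, used to turn an exponential solving the equation in the frame into
a coordinate solution. -/
theorem inverse_gauge_transform {R : Type*} [Ring R] {E F : R} (h : E * F = 1) (D N X G : R) :
    (-(F * D * F) * X + F * (-N * X)) * G = -(F * (N * E + D) * (F * X * G)) := by
  have e : F * (N * E + D) * (F * X * G) = F * N * (E * F) * X * G + F * D * F * X * G := by
    noncomm_ring
  rw [e, h]
  noncomm_ring

/-- In the frame, transport along a smooth curve solves V' = -ΩV with V(0) = 1, so the two results
on linear equations apply. For a concatenation the frame at the intermediate point cancels, and both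
conditions are stable under products. -/
theorem IsGauge.transport_mem (hG : IsGauge g E F dE Ω) {L : Subalgebra ℝ M7}
    (hL : ∀ x u, Ω x u ∈ L) (hg : ∀ x u, Ω x u ∈ g2Star) {U : Set (Fin 7 → ℝ)}
    {p q : Fin 7 → ℝ} {T : M7} (h : IsParallelTransport U g p q T) :
    E q * T * F p ∈ omegaStabilizer L := by
  induction h with
  | smooth γ W hγ hU h0 hW =>
    have hγ1 : ContDiff ℝ 1 γ := hγ.of_le (by exact_mod_cast le_top)
    have hγd : ∀ t, HasDerivAt γ (_root_.deriv γ t) t := fun t =>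
      (hγ1.differentiable one_ne_zero t).hasDerivAt
    set V : ℝ → M7 := fun t => E (γ t) * W t * F (γ 0) with hV
    have hV0 : V 0 = 1 := by rw [hV]; simp only [h0, mul_one, hG.mul_inv]
    have hVd : ∀ t ∈ Set.Icc (0 : ℝ) 1,
        HasDerivWithinAt V (-(Ω (γ t) (_root_.deriv γ t) * V t)) (Set.Icc 0 1) t := by
      intro t ht
      have h1 := ((hG.deriv (hγd t).hasDerivWithinAt).mul
        (hasDerivWithinAt_matrix_iff.2 (hW t ht))).mul_const (F (γ 0))
      refine h1.congr_deriv ?_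
      rw [hG.conn]
      exact gauge_transform (hG.mul_inv _) _ _ _ _
    have hΩc : Continuous fun t => Ω (γ t) (_root_.deriv γ t) :=
      hG.continuous.comp (hγ1.continuous.prodMk (hγ1.continuous_deriv le_rfl))
    have hm : V 0 ∈ L := by rw [hV0]; exact L.one_mem
    have hg' : ∀ t, Ω (γ t) (_root_.deriv γ t) ∈ g2Star := fun t => hg _ _
    have hω := ode_solution_preserves_omega hg' hV0 hVd
    exact ⟨ode_solution_mem_matrix_subalgebra hΩc (fun t => hL _ _) hm hVd, hω⟩
  | @comp p q r S T hS hT ihS ihT =>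
    have e : E r * (T * S) * F p = (E r * T * F q) * (E q * S * F p) := by
      rw [mul_assoc (E r * T) (F q), ← mul_assoc (F q), ← mul_assoc (F q), hG.inv_mul, one_mul]
      noncomm_ring
    rw [e]
    generalize E r * T * F q = X at ihT
    generalize E q * S * F p = Y at ihS
    refine ⟨L.mul_mem ihT.1 ihS.1, fun x y z => ?_⟩
    simp only [← Matrix.mulVec_mulVec]
    rw [ihT.2, ihS.2]

/-- Parallel transport along a segment on which the connection form is constant. -/
theorem IsGauge.transport_segment (hG : IsGauge g E F dE Ω) {U : Set (Fin 7 → ℝ)}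
    (a v : Fin 7 → ℝ) (N : M7) (hU : ∀ t ∈ Set.Icc (0 : ℝ) 1, a + t • v ∈ U)
    (hN : ∀ t : ℝ, Ω (a + t • v) v = N) :
    IsParallelTransport U g a (a + v) (F (a + v) * NormedSpace.exp (-N) * E a) := by
  have hd : ∀ t : ℝ, HasDerivAt (fun t : ℝ => a + t • v) v t := by
    intro t
    simpa using ((hasDerivAt_id t).smul_const v).const_add a
  have h := IsParallelTransport.smooth (U := U) (g := g) (fun t : ℝ => a + t • v)
    (fun t => F (a + t • v) * NormedSpace.exp (t • (-N)) * E a)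
    (contDiff_const.add (contDiff_id.smul contDiff_const)) hU
    (by simp [hG.inv_mul]) ?_
  · simpa using h
  intro t ht
  apply hasDerivWithinAt_matrix_iff.1
  have h1 := ((hG.deriv_inv (hd t).hasDerivWithinAt).mul
    (hasDerivAt_exp_smul_const' (-N) t).hasDerivWithinAt).mul_const (E a) (s := Set.Icc 0 1)
  refine h1.congr_deriv ?_
  rw [(hd t).deriv, hG.conn, hN]
  exact inverse_gauge_transform (hG.mul_inv _) _ _ _ _

theorem IsGauge.transport_flat_segment (hG : IsGauge g E F dE Ω) {U : Set (Fin 7 → ℝ)}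
    (a b : Fin 7 → ℝ) (hU : ∀ t ∈ Set.Icc (0 : ℝ) 1, a + t • (b - a) ∈ U)
    (hN : ∀ t : ℝ, Ω (a + t • (b - a)) (b - a) = 0) :
    IsParallelTransport U g a b (F b * E a) := by
  have h := hG.transport_segment a (b - a) 0 hU hN
  simpa using h

theorem IsGauge.transport_comp (hG : IsGauge g E F dE Ω) {U : Set (Fin 7 → ℝ)}
    {a b c : Fin 7 → ℝ} {S T : M7} (hS : IsParallelTransport U g a b (F b * S * E a))
    (hT : IsParallelTransport U g b c (F c * T * E b)) :
    IsParallelTransport U g a c (F c * (T * S) * E a) := by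
  have h := hS.comp hT
  have e : F c * T * E b * (F b * S * E a) = F c * (T * S) * E a := by
    have : F c * T * E b * (F b * S * E a) = F c * T * (E b * F b) * S * E a := by noncomm_ring
    rw [this, hG.mul_inv, mul_one]
    noncomm_ring
  rwa [e] at h

/-! ### Characterisation of the Levi-Civita connection -/

/-- Uniqueness of the Levi-Civita connection by the Koszul formula: in the alternating sum of
derivatives of `g`, symmetry of `C` in its lower indices cancels all but two equal terms. -/
theorem christoffel_eq {g : (Fin 7 → ℝ) → M7} {x : Fin 7 → ℝ} {C : Fin 7 → M7}
    (hsymm : (g x).IsSymm) (hdet : IsUnit (g x).det) (htor : ∀ i j k, C i k j = C j k i)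
    (hmet : ∀ i a b, pderiv i (fun y => g y a b) x = ((C i)ᵀ * g x + g x * C i) a b)
    (k i j : Fin 7) : christoffel g x k i j = C i k j := by
  have hs : ∀ a b, g x a b = g x b a := fun a b => hsymm.apply b a
  have h1 : ∀ l, pderiv i (fun y => g y j l) x + pderiv j (fun y => g y i l) x
      - pderiv l (fun y => g y i j) x = 2 * (g x * C i) l j := by
    intro l
    rw [hmet, hmet, hmet]
    simp only [Matrix.add_apply, Matrix.mul_apply, Matrix.transpose_apply]
    have e1 : ∑ m, C i m j * g x m l = ∑ m, g x l m * C i m j :=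
      Finset.sum_congr rfl fun m _ => by rw [hs m l, mul_comm]
    have e2 : ∑ m, C j m i * g x m l = ∑ m, g x l m * C i m j :=
      Finset.sum_congr rfl fun m _ => by rw [hs m l, mul_comm, htor j i m]
    have e3 : ∑ m, g x i m * C j m l = ∑ m, C l m i * g x m j - ∑ m, C l m i * g x m j
        + ∑ m, g x i m * C l m j :=
      by rw [sub_self, zero_add]; exact Finset.sum_congr rfl fun m _ => by rw [htor j l m]
    have e4 : ∑ m, C l m i * g x m j = ∑ m, g x j m * C i m l :=
      Finset.sum_congr rfl fun m _ => by rw [hs m j, mul_comm, htor l i m]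
    rw [e1, e2, e3, e4]
    ring
  unfold christoffel
  simp only [h1]
  have h2 : ∑ l, (g x)⁻¹ k l * (2 * (g x * C i) l j) = 2 * ((g x)⁻¹ * (g x * C i)) k j := by
    rw [Matrix.mul_apply, Finset.mul_sum]
    exact Finset.sum_congr rfl fun l _ => by ring
  have h3 : (g x)⁻¹ * (g x * C i) = C i := by
    rw [← mul_assoc, Matrix.nonsing_inv_mul _ hdet, one_mul]
  rw [h2, h3]
  ring

theorem connMatrix_eq {g : (Fin 7 → ℝ) → M7} {x : Fin 7 → ℝ} {C : (Fin 7 → ℝ) →ₗ[ℝ] M7}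
    (hsymm : (g x).IsSymm) (hdet : IsUnit (g x).det) (htor : ∀ u v, C u *ᵥ v = C v *ᵥ u)
    (hmet : ∀ i a b, pderiv i (fun y => g y a b) x
      = ((C (Pi.single i 1))ᵀ * g x + g x * C (Pi.single i 1)) a b)
    (u : Fin 7 → ℝ) : connMatrix g x u = C u := by
  have hC : ∀ i j k, C (Pi.single i 1) k j = C (Pi.single j 1) k i := by
    intro i j k
    have := congrFun (htor (Pi.single i 1) (Pi.single j 1)) k
    simpa using this
  ext k j
  have hu : C u = ∑ i, u i • C (Pi.single i 1) := by
    conv_lhs => rw [pi_eq_sum_univ' u]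
    rw [map_sum]
    refine Finset.sum_congr rfl fun i _ => ?_
    rw [map_smul]
  rw [hu, Matrix.sum_apply]
  simp only [connMatrix, Matrix.of_apply, Matrix.smul_apply, smul_eq_mul]
  refine Finset.sum_congr rfl fun i _ => ?_
  rw [christoffel_eq (C := fun i => C (Pi.single i 1)) hsymm hdet hC hmet, mul_comm]

end G2Hol

end

noncomputable section

namespace G2Hol

open scoped Matrix.Norms.Operator

/-! ### A family of polynomial metrics -/

theorem eta_mul_eta : eta * eta = 1 := by
  ext i j
  fin_cases i <;> fin_cases j <;> simp [eta, Matrix.mul_apply, Fin.sum_univ_seven]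

theorem eta_transpose : etaᵀ = eta := by
  ext i j
  fin_cases i <;> fin_cases j <;> simp [eta]

theorem hMat_skew (A : M2) (v : ℝ) (y : Fin 2 → ℝ) :
    (hMat A v y)ᵀ * eta + eta * hMat A v y = 0 := by
  ext i j
  fin_cases i <;> fin_cases j <;>
    simp [hMat, eta, Matrix.mul_apply, Fin.sum_univ_seven, Matrix.vecHead, Matrix.vecTail]

/-- Coefficients of two binary quadratic forms `p`, `q`, and of a further term of the metric. -/
structure WaveData where
  (p₁ p₂ p₃ q₁ q₂ q₃ κ : ℝ)

namespace WaveData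

variable (d : WaveData)

/-- The coframe is `θⁱ = dxⁱ + (shift x)ⁱ dx⁵`. -/
def shift (x : Fin 7 → ℝ) : Fin 7 → ℝ :=
  ![-((d.p₁ * x 5 + d.p₂ * x 6) + (d.q₂ * x 5 + d.q₃ * x 6)) * x 0
      + √2 * ((1 / 2) * (x 5 * x 5)) * x 3 + d.κ * ((1 / 2) * (x 6 * x 6)),
    -(d.p₁ * x 5 + d.p₂ * x 6) * x 1 - (d.q₁ * x 5 + d.q₂ * x 6) * x 2
      + (1 / 2) * (x 5 * x 5 * x 6),
    -(d.p₂ * x 5 + d.p₃ * x 6) * x 1 - (d.q₂ * x 5 + d.q₃ * x 6) * x 2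
      - (1 / 6) * (x 5 * x 5 * x 5),
    0, 0,
    (1 / 2) * (d.p₁ * (x 5 * x 5) + 2 * d.p₂ * (x 5 * x 6) + d.p₃ * (x 6 * x 6)),
    (1 / 2) * (d.q₁ * (x 5 * x 5) + 2 * d.q₂ * (x 5 * x 6) + d.q₃ * (x 6 * x 6))]

/-- The differential of `shift`. -/
def shiftDeriv (x u : Fin 7 → ℝ) : Fin 7 → ℝ :=
  ![-((d.p₁ * u 5 + d.p₂ * u 6) + (d.q₂ * u 5 + d.q₃ * u 6)) * x 0
      - ((d.p₁ * x 5 + d.p₂ * x 6) + (d.q₂ * x 5 + d.q₃ * x 6)) * u 0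
      + √2 * (x 5 * u 5) * x 3 + √2 * ((1 / 2) * (x 5 * x 5)) * u 3 + d.κ * (x 6 * u 6),
    -(d.p₁ * u 5 + d.p₂ * u 6) * x 1 - (d.p₁ * x 5 + d.p₂ * x 6) * u 1
      - (d.q₁ * u 5 + d.q₂ * u 6) * x 2 - (d.q₁ * x 5 + d.q₂ * x 6) * u 2
      + (x 5 * u 5 * x 6) + (1 / 2) * (x 5 * x 5 * u 6),
    -(d.p₂ * u 5 + d.p₃ * u 6) * x 1 - (d.p₂ * x 5 + d.p₃ * x 6) * u 1
      - (d.q₂ * u 5 + d.q₃ * u 6) * x 2 - (d.q₂ * x 5 + d.q₃ * x 6) * u 2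
      - (1 / 2) * (x 5 * x 5 * u 5),
    0, 0,
    d.p₁ * (x 5 * u 5) + d.p₂ * (x 5 * u 6 + u 5 * x 6) + d.p₃ * (x 6 * u 6),
    d.q₁ * (x 5 * u 5) + d.q₂ * (x 5 * u 6 + u 5 * x 6) + d.q₃ * (x 6 * u 6)]

/-- The matrix of the coframe. -/
def frame (x : Fin 7 → ℝ) : M7 := 1 + Matrix.vecMulVec (d.shift x) (Pi.single 4 1)

/-- The inverse of the coframe. -/
def frameInv (x : Fin 7 → ℝ) : M7 := 1 - Matrix.vecMulVec (d.shift x) (Pi.single 4 1)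

/-- The differential of the coframe. -/
def frameDeriv (x u : Fin 7 → ℝ) : M7 := Matrix.vecMulVec (d.shiftDeriv x u) (Pi.single 4 1)

/-- The metric `2 (θ¹·θ⁵ + θ²·θ⁶ + θ³·θ⁷) - (θ⁴)²`. -/
def metric (x : Fin 7 → ℝ) : M7 := (d.frame x)ᵀ * eta * d.frame x

/-- The coefficients `∂_i y_j` (`i, j` in the last two coordinates) of the connection form. -/
def hess (x : Fin 7 → ℝ) : M2 :=
  !![d.p₁ * x 1 + d.q₁ * x 2 - x 5 * x 6, d.p₂ * x 1 + d.q₂ * x 2;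
     d.p₂ * x 1 + d.q₂ * x 2, d.p₃ * x 1 + d.q₃ * x 2]

/-- The connection form in the coframe `θ`. -/
def connForm (x u : Fin 7 → ℝ) : M7 :=
  hMat (u 4 • !![-(d.p₁ * x 5 + d.p₂ * x 6), -(d.q₁ * x 5 + d.q₂ * x 6);
      -(d.p₂ * x 5 + d.p₃ * x 6), -(d.q₂ * x 5 + d.q₃ * x 6)])
    (u 4 * ((1 / 2) * (x 5 * x 5)))
    (d.hess x *ᵥ ![u 5, u 6] + u 4 • (d.hess x *ᵥ ![d.shift x 5, d.shift x 6]
      + ![(d.p₁ + d.q₂) * x 0 - √2 * x 5 * x 3, (d.p₂ + d.q₃) * x 0 - d.κ * x 6]))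

theorem frame_mulVec (x v : Fin 7 → ℝ) : d.frame x *ᵥ v = v + v 4 • d.shift x := by
  rw [frame, Matrix.add_mulVec, Matrix.one_mulVec, Matrix.vecMulVec_mulVec]
  simp

theorem frameDeriv_mulVec (x u v : Fin 7 → ℝ) :
    d.frameDeriv x u *ᵥ v = v 4 • d.shiftDeriv x u := by
  rw [frameDeriv, Matrix.vecMulVec_mulVec]
  simp

/-- The shift has no component of index 4, so the coframe is 1 + N with N² = 0 and its inverse is 1
- N. -/
theorem vecMulVec_mul_vecMulVec_single (a b : Fin 7 → ℝ) (hb : b 4 = 0) :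
    Matrix.vecMulVec a (Pi.single (4 : Fin 7) 1) * Matrix.vecMulVec b (Pi.single (4 : Fin 7) 1)
      = 0 := by
  rw [Matrix.vecMulVec_mul_vecMulVec]
  simp [hb]

theorem frame_mul_frameInv (x : Fin 7 → ℝ) : d.frame x * d.frameInv x = 1 := by
  have h := vecMulVec_mul_vecMulVec_single (d.shift x) (d.shift x) rfl
  rw [frame, frameInv, add_mul, mul_sub, mul_sub, h]
  simp

theorem frameInv_mul_frame (x : Fin 7 → ℝ) : d.frameInv x * d.frame x = 1 := by
  have h := vecMulVec_mul_vecMulVec_single (d.shift x) (d.shift x) rfl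
  rw [frame, frameInv, sub_mul, mul_add, mul_add, h]
  simp

theorem hasDerivWithinAt_shift {γ : ℝ → Fin 7 → ℝ} {γ' : Fin 7 → ℝ} {s : Set ℝ} {t : ℝ}
    (h : HasDerivWithinAt γ γ' s t) (i : Fin 7) :
    HasDerivWithinAt (fun r => d.shift (γ r) i) (d.shiftDeriv (γ t) γ' i) s t := by
  have c : ∀ i, HasDerivWithinAt (fun r => γ r i) (γ' i) s t := hasDerivWithinAt_pi.1 h
  have l : ∀ a b : ℝ, HasDerivWithinAt (fun r => a * γ r 5 + b * γ r 6) (a * γ' 5 + b * γ' 6) s t :=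
    fun a b => ((c 5).const_mul a).add ((c 6).const_mul b)
  have hq : ∀ a b e : ℝ, HasDerivWithinAt
      (fun r => (1 / 2) * (a * (γ r 5 * γ r 5) + 2 * b * (γ r 5 * γ r 6) + e * (γ r 6 * γ r 6)))
      (a * (γ t 5 * γ' 5) + b * (γ t 5 * γ' 6 + γ' 5 * γ t 6) + e * (γ t 6 * γ' 6)) s t :=
    fun a b e => ((((((c 5).mul (c 5)).const_mul a).add (((c 5).mul (c 6)).const_mul (2 * b))).add
      (((c 6).mul (c 6)).const_mul e)).const_mul (1 / 2)).congr_deriv (by ring)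
  fin_cases i
  · exact ((((((l d.p₁ d.p₂).add (l d.q₂ d.q₃)).neg.mul (c 0)).add
      (((((c 5).mul (c 5)).const_mul (1 / 2)).const_mul (√2)).mul (c 3))).add
      ((((c 6).mul (c 6)).const_mul (1 / 2)).const_mul d.κ))).congr_deriv
      (by simp [shiftDeriv]; ring)
  · exact ((((l d.p₁ d.p₂).neg.mul (c 1)).sub ((l d.q₁ d.q₂).mul (c 2))).add
      ((((c 5).mul (c 5)).mul (c 6)).const_mul (1 / 2))).congr_deriv
      (by simp [shiftDeriv]; ring)
  · exact ((((l d.p₂ d.p₃).neg.mul (c 1)).sub ((l d.q₂ d.q₃).mul (c 2))).sub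
      ((((c 5).mul (c 5)).mul (c 5)).const_mul (1 / 6))).congr_deriv
      (by simp [shiftDeriv]; ring)
  · exact hasDerivWithinAt_const _ _ _
  · exact hasDerivWithinAt_const _ _ _
  · exact hq d.p₁ d.p₂ d.p₃
  · exact hq d.q₁ d.q₂ d.q₃

theorem hasDerivWithinAt_vecMulVec {γ : ℝ → Fin 7 → ℝ} {γ' : Fin 7 → ℝ} {s : Set ℝ} {t : ℝ}
    (h : HasDerivWithinAt γ γ' s t) :
    HasDerivWithinAt (fun r => Matrix.vecMulVec (d.shift (γ r)) (Pi.single 4 1) : ℝ → M7)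
      (d.frameDeriv (γ t) γ') s t := by
  refine hasDerivWithinAt_matrix_iff.2 fun i j => ?_
  simp only [frameDeriv, Matrix.vecMulVec_apply]
  exact (d.hasDerivWithinAt_shift h i).mul_const _

theorem hasDerivWithinAt_frame {γ : ℝ → Fin 7 → ℝ} {γ' : Fin 7 → ℝ} {s : Set ℝ} {t : ℝ}
    (h : HasDerivWithinAt γ γ' s t) :
    HasDerivWithinAt (fun r => d.frame (γ r)) (d.frameDeriv (γ t) γ') s t :=
  (d.hasDerivWithinAt_vecMulVec h).const_add 1

theorem hasDerivWithinAt_frameInv {γ : ℝ → Fin 7 → ℝ} {γ' : Fin 7 → ℝ} {s : Set ℝ} {t : ℝ}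
    (h : HasDerivWithinAt γ γ' s t) :
    HasDerivWithinAt (fun r => d.frameInv (γ r))
      (-(d.frameInv (γ t) * d.frameDeriv (γ t) γ' * d.frameInv (γ t))) s t := by
  refine ((d.hasDerivWithinAt_vecMulVec h).const_sub 1).congr_deriv ?_
  have h1 : d.frameInv (γ t) * d.frameDeriv (γ t) γ' = d.frameDeriv (γ t) γ' := by
    rw [frameInv, frameDeriv, sub_mul, vecMulVec_mul_vecMulVec_single _ _ rfl]; simp
  have h2 : d.frameDeriv (γ t) γ' * d.frameInv (γ t) = d.frameDeriv (γ t) γ' := by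
    rw [frameInv, frameDeriv, mul_sub, vecMulVec_mul_vecMulVec_single _ _ rfl]; simp
  rw [h1, h2]

theorem analyticAt_shift (x : Fin 7 → ℝ) (i : Fin 7) :
    AnalyticAt ℝ (fun y => d.shift y i) x := by
  have h : ContDiff ℝ ω (fun y => d.shift y i) := by
    fin_cases i <;> simp [shift] <;> fun_prop
  exact h.contDiffAt.analyticAt

theorem analyticAt_metric (x : Fin 7 → ℝ) (i j : Fin 7) :
    AnalyticAt ℝ (fun y => d.metric y i j) x := by
  have h : ∀ i j, AnalyticAt ℝ (fun y => d.frame y i j) x := by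
    intro i j
    simp only [frame, Matrix.add_apply, Matrix.vecMulVec_apply]
    exact analyticAt_const.add ((d.analyticAt_shift x i).mul analyticAt_const)
  simp only [metric, Matrix.mul_apply, Matrix.transpose_apply]
  refine Finset.analyticAt_fun_sum _ fun k _ => AnalyticAt.mul ?_ (h k j)
  exact Finset.analyticAt_fun_sum _ fun l _ => (h l i).mul analyticAt_const

theorem metric_isSymm (x : Fin 7 → ℝ) : (d.metric x).IsSymm := by
  rw [Matrix.IsSymm, metric, Matrix.transpose_mul, Matrix.transpose_mul, Matrix.transpose_transpose,
    eta_transpose, mul_assoc]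

theorem isMetric43 : IsMetric43 Set.univ d.metric where
  analytic i j x _ := d.analyticAt_metric x i j
  symm x _ := d.metric_isSymm x
  signature x _ := by
    refine ⟨d.frameInv x, ⟨⟨_, _, d.frameInv_mul_frame x, d.frame_mul_frameInv x⟩, rfl⟩, ?_⟩
    have h1 : (d.frameInv x)ᵀ * (d.frame x)ᵀ = 1 := by
      rw [← Matrix.transpose_mul, frame_mul_frameInv, Matrix.transpose_one]
    have h2 : (d.frameInv x)ᵀ * d.metric x * d.frameInv x
        = ((d.frameInv x)ᵀ * (d.frame x)ᵀ) * eta * (d.frame x * d.frameInv x) := by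
      rw [metric]; noncomm_ring
    rw [h2, h1, frame_mul_frameInv, one_mul, mul_one]

theorem isUnit_det_metric (x : Fin 7 → ℝ) : IsUnit (d.metric x).det := by
  have h1 : IsUnit (d.frame x).det := by
    rw [← Matrix.isUnit_iff_isUnit_det]
    exact ⟨⟨_, _, d.frame_mul_frameInv x, d.frameInv_mul_frame x⟩, rfl⟩
  have h2 : IsUnit eta.det := by
    rw [← Matrix.isUnit_iff_isUnit_det]
    exact ⟨⟨_, _, eta_mul_eta, eta_mul_eta⟩, rfl⟩
  rw [metric, Matrix.det_mul, Matrix.det_mul, Matrix.det_transpose]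
  exact (h1.mul h2).mul h1

theorem pderiv_metric (x : Fin 7 → ℝ) (i a b : Fin 7) :
    pderiv i (fun y => d.metric y a b) x = ((d.frameDeriv x (Pi.single i 1))ᵀ * eta * d.frame x
      + (d.frame x)ᵀ * eta * d.frameDeriv x (Pi.single i 1)) a b := by
  set e : Fin 7 → ℝ := Pi.single i 1
  have hd : HasDerivWithinAt (fun t : ℝ => x + t • e) e Set.univ 0 := by
    rw [hasDerivWithinAt_univ]
    simpa using ((hasDerivAt_id (0 : ℝ)).smul_const e).const_add x
  have h1 := d.hasDerivWithinAt_frame hd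
  have h2 : HasDerivWithinAt (fun t : ℝ => (d.frame (x + t • e))ᵀ)
      (d.frameDeriv (x + (0 : ℝ) • e) e)ᵀ Set.univ 0 :=
    hasDerivWithinAt_matrix_iff.2 fun i j => hasDerivWithinAt_matrix_iff.1 h1 j i
  have h3 := (h2.mul_const eta).mul h1
  simp only [zero_smul, add_zero] at h3
  have h4 := hasDerivWithinAt_univ.1 (hasDerivWithinAt_matrix_iff.1 h3 a b)
  have h5 : HasDerivAt (fun t : ℝ => d.metric (x + t • e) a b)
      (fderiv ℝ (fun y => d.metric y a b) x e) 0 := by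
    have h6 := (d.analyticAt_metric (x + (0 : ℝ) • e) a b).differentiableAt.hasFDerivAt
    have h7 := h6.comp_hasDerivAt (0 : ℝ) (hasDerivWithinAt_univ.1 hd)
    rw [zero_smul, add_zero] at h7
    exact h7
  exact h5.unique h4

/-- The connection matrices as a linear map. -/
def conn (x : Fin 7 → ℝ) : (Fin 7 → ℝ) →ₗ[ℝ] M7 where
  toFun u := d.frameInv x * (d.connForm x u * d.frame x + d.frameDeriv x u)
  map_add' u v := by
    have h1 : d.connForm x (u + v) = d.connForm x u + d.connForm x v := by
      rw [connForm, connForm, connForm, hMat_add]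
      congr 1
      · simp [add_smul]
      · simp; ring
      · ext i
        fin_cases i <;> simp <;> ring
    have h2 : d.frameDeriv x (u + v) = d.frameDeriv x u + d.frameDeriv x v := by
      rw [frameDeriv, frameDeriv, frameDeriv, ← Matrix.add_vecMulVec]
      congr 1
      ext i
      fin_cases i <;> simp [shiftDeriv] <;> ring
    rw [h1, h2]
    noncomm_ring
  map_smul' c u := by
    have h1 : d.connForm x (c • u) = c • d.connForm x u := by
      rw [connForm, connForm, hMat_smul]
      congr 1
      · simp [mul_smul]
      · simp; ring
      · ext i
        fin_cases i <;> simp <;> ring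
    have h2 : d.frameDeriv x (c • u) = c • d.frameDeriv x u := by
      rw [frameDeriv, frameDeriv, ← Matrix.smul_vecMulVec]
      congr 1
      ext i
      fin_cases i <;> simp [shiftDeriv] <;> ring
    rw [h1, h2]
    simp [mul_add]

/-- The first structure equation dθ + Ω ∧ θ = 0. The polynomials in `shift` and `connForm` are
matched to each other so that it holds; the relation between their coefficients is the algebraic
Bianchi identity in integrated form. -/
theorem torsion_free (x u v : Fin 7 → ℝ) :
    (d.connForm x u * d.frame x + d.frameDeriv x u) *ᵥ v
      = (d.connForm x v * d.frame x + d.frameDeriv x v) *ᵥ u := by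
  simp only [Matrix.add_mulVec, ← Matrix.mulVec_mulVec, frame_mulVec, frameDeriv_mulVec, connForm,
    hMat_mulVec]
  ext i
  fin_cases i <;>
    simp [shift, shiftDeriv, hess, Matrix.trace_fin_two, Matrix.vecHead, Matrix.vecTail] <;> ring

/-- The connection defined by Ω is torsion-free by the structure equation and metric because Ω is
skew for `eta`, while `eta` is the constant Gram matrix in the coframe. Uniqueness identifies it
with the Levi-Civita connection. -/
theorem connMatrix_metric (x u : Fin 7 → ℝ) : connMatrix d.metric x u
    = d.frameInv x * (d.connForm x u * d.frame x + d.frameDeriv x u) := by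
  refine connMatrix_eq (C := d.conn x) (d.metric_isSymm x) (d.isUnit_det_metric x) ?_ ?_ u
  · intro u v
    change (d.frameInv x * _) *ᵥ v = (d.frameInv x * _) *ᵥ u
    rw [← Matrix.mulVec_mulVec, ← Matrix.mulVec_mulVec, torsion_free]
  · intro i a b
    rw [pderiv_metric]
    refine congrFun (congrFun ?_ a) b
    change _ = (d.frameInv x * (d.connForm x _ * d.frame x + d.frameDeriv x _))ᵀ * d.metric x
      + d.metric x * (d.frameInv x * (d.connForm x _ * d.frame x + d.frameDeriv x _))
    generalize (Pi.single i 1 : Fin 7 → ℝ) = e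
    have hs : (d.connForm x e)ᵀ * eta + eta * d.connForm x e = 0 := hMat_skew _ _ _
    have h1 : (d.frameInv x)ᵀ * (d.frame x)ᵀ = 1 := by
      rw [← Matrix.transpose_mul, frame_mul_frameInv, Matrix.transpose_one]
    have h2 := d.frame_mul_frameInv x
    rw [metric, Matrix.transpose_mul, Matrix.transpose_add, Matrix.transpose_mul]
    generalize d.connForm x e = O at *
    generalize d.frameDeriv x e = D at *
    generalize d.frame x = E at *
    generalize d.frameInv x = F at *
    have e1 : (Eᵀ * Oᵀ + Dᵀ) * Fᵀ * (Eᵀ * eta * E) + Eᵀ * eta * E * (F * (O * E + D))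
        = (Eᵀ * Oᵀ + Dᵀ) * (Fᵀ * Eᵀ) * eta * E + Eᵀ * eta * (E * F) * (O * E + D) := by
      noncomm_ring
    rw [e1, h1, h2]
    have e2 : (Eᵀ * Oᵀ + Dᵀ) * 1 * eta * E + Eᵀ * eta * 1 * (O * E + D)
        = Eᵀ * (Oᵀ * eta + eta * O) * E + (Dᵀ * eta * E + Eᵀ * eta * D) := by
      noncomm_ring
    rw [e2, hs, mul_zero, zero_mul, zero_add]

theorem continuous_hMat {X : Type*} [TopologicalSpace X] {A : X → M2} {v : X → ℝ}
    {y : X → Fin 2 → ℝ} (hA : ∀ i j, Continuous fun x => A x i j) (hv : Continuous v)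
    (hy : ∀ i, Continuous fun x => y x i) : Continuous fun x => hMat (A x) (v x) (y x) := by
  refine continuous_matrix fun i j => ?_
  fin_cases i <;> fin_cases j <;> simp [hMat, Matrix.trace_fin_two] <;> fun_prop

theorem continuous_connForm :
    Continuous fun z : (Fin 7 → ℝ) × (Fin 7 → ℝ) => d.connForm z.1 z.2 := by
  refine continuous_hMat (fun i j => ?_) ?_ (fun i => ?_)
  · fin_cases i <;> fin_cases j <;> simp <;> fun_prop
  · fun_prop
  · fin_cases i <;> simp [hess, shift, Matrix.vecHead, Matrix.vecTail] <;> fun_prop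

theorem isGauge : IsGauge d.metric d.frame d.frameInv d.frameDeriv d.connForm where
  mul_inv := d.frame_mul_frameInv
  inv_mul := d.frameInv_mul_frame
  deriv := d.hasDerivWithinAt_frame
  deriv_inv := d.hasDerivWithinAt_frameInv
  conn := d.connMatrix_metric
  continuous := d.continuous_connForm

end WaveData

end G2Hol

end

noncomputable section

namespace G2Hol

/-! ### The Lie algebra `𝔤₂*` in coordinates -/

/-- The equations defining `𝔤₂*`, for basis vectors. -/
theorem g2Star_basis_equation {X : M7} (hX : X ∈ g2Star) (i j k : Fin 7) :
    omega (fun l => X l i) (Pi.single j 1) (Pi.single k 1)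
      + omega (Pi.single i 1) (fun l => X l j) (Pi.single k 1)
      + omega (Pi.single i 1) (Pi.single j 1) (fun l => X l k) = 0 := by
  have h := hX (Pi.single i 1) (Pi.single j 1) (Pi.single k 1)
  simp only [Matrix.mulVec_single_one] at h
  exact h

/-- The 3-form determines the inner product; infinitesimally this is linear algebra. Evaluating the
invariance of `omega` on all 35 triples of basis vectors gives linear equations over ℚ(√2) from
which the 28 independent skewness relations are combined. -/
theorem skew_of_mem_g2Star {X : M7} (hX : X ∈ g2Star) : Xᵀ * eta + eta * X = 0 := by
  have hs : √2 * √2 - 2 = 0 := by rw [Real.mul_self_sqrt zero_le_two, sub_self]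
  have H := g2Star_basis_equation hX
  have e012 : √2 * X 4 0 = 0 := by
    have h := H 0 1 2
    simp [omega, wedge3] at h
    linear_combination √2 * h
  have e013 : - X 4 1 - X 5 0 = 0 := by
    have h := H 0 1 3
    simp [omega, wedge3] at h
    linear_combination h
  have e014 : - √2 * X 2 0 + X 3 1 = 0 := by
    have h := H 0 1 4
    simp [omega, wedge3] at h
    linear_combination h
  have e015 : X 3 0 - √2 * X 6 1 = 0 := by
    have h := H 0 1 5
    simp [omega, wedge3] at h
    linear_combination h
  have e016 : √2 * X 5 1 = 0 := by
    have h := H 0 1 6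
    simp [omega, wedge3] at h
    linear_combination √2 * h
  have e023 : - X 4 2 - X 6 0 = 0 := by
    have h := H 0 2 3
    simp [omega, wedge3] at h
    linear_combination h
  have e024 : √2 * X 1 0 + X 3 2 = 0 := by
    have h := H 0 2 4
    simp [omega, wedge3] at h
    linear_combination h
  have e025 : - √2 * X 6 2 = 0 := by
    have h := H 0 2 5
    simp [omega, wedge3] at h
    linear_combination -√2 * h
  have e026 : X 3 0 + √2 * X 5 2 = 0 := by
    have h := H 0 2 6
    simp [omega, wedge3] at h
    linear_combination h
  have e034 : X 0 0 + X 3 3 + X 4 4 = 0 := by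
    have h := H 0 3 4
    simp [omega, wedge3] at h
    linear_combination h
  have e035 : - X 1 0 + X 4 5 - √2 * X 6 3 = 0 := by
    have h := H 0 3 5
    simp [omega, wedge3] at h
    linear_combination h
  have e036 : - X 2 0 + X 4 6 + √2 * X 5 3 = 0 := by
    have h := H 0 3 6
    simp [omega, wedge3] at h
    linear_combination h
  have e045 : - X 3 5 - √2 * X 6 4 = 0 := by
    have h := H 0 4 5
    simp [omega, wedge3] at h
    linear_combination h
  have e046 : - X 3 6 + √2 * X 5 4 = 0 := by
    have h := H 0 4 6
    simp [omega, wedge3] at h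
    linear_combination h
  have e056 : √2 * X 0 0 + √2 * X 5 5 + √2 * X 6 6 = 0 := by
    have h := H 0 5 6
    simp [omega, wedge3] at h
    linear_combination h
  have e123 : √2 * X 4 3 + X 5 2 - X 6 1 = 0 := by
    have h := H 1 2 3
    simp [omega, wedge3] at h
    linear_combination h
  have e124 : √2 * X 1 1 + √2 * X 2 2 + √2 * X 4 4 = 0 := by
    have h := H 1 2 4
    simp [omega, wedge3] at h
    linear_combination h
  have e125 : - X 3 2 + √2 * X 4 5 = 0 := by
    have h := H 1 2 5
    simp [omega, wedge3] at h
    linear_combination h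
  have e126 : X 3 1 + √2 * X 4 6 = 0 := by
    have h := H 1 2 6
    simp [omega, wedge3] at h
    linear_combination h
  have e134 : X 0 1 + √2 * X 2 3 - X 5 4 = 0 := by
    have h := H 1 3 4
    simp [omega, wedge3] at h
    linear_combination h
  have e135 : - X 1 1 - X 3 3 - X 5 5 = 0 := by
    have h := H 1 3 5
    simp [omega, wedge3] at h
    linear_combination h
  have e136 : - X 2 1 - X 5 6 = 0 := by
    have h := H 1 3 6
    simp [omega, wedge3] at h
    linear_combination h
  have e145 : - √2 * X 2 5 - X 3 4 = 0 := by
    have h := H 1 4 5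
    simp [omega, wedge3] at h
    linear_combination h
  have e146 : - √2 * X 2 6 = 0 := by
    have h := H 1 4 6
    simp [omega, wedge3] at h
    linear_combination -√2 * h
  have e156 : √2 * X 0 1 + X 3 6 = 0 := by
    have h := H 1 5 6
    simp [omega, wedge3] at h
    linear_combination h
  have e234 : X 0 2 - √2 * X 1 3 - X 6 4 = 0 := by
    have h := H 2 3 4
    simp [omega, wedge3] at h
    linear_combination h
  have e235 : - X 1 2 - X 6 5 = 0 := by
    have h := H 2 3 5
    simp [omega, wedge3] at h
    linear_combination h
  have e236 : - X 2 2 - X 3 3 - X 6 6 = 0 := by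
    have h := H 2 3 6
    simp [omega, wedge3] at h
    linear_combination h
  have e245 : √2 * X 1 5 = 0 := by
    have h := H 2 4 5
    simp [omega, wedge3] at h
    linear_combination √2 * h
  have e246 : √2 * X 1 6 - X 3 4 = 0 := by
    have h := H 2 4 6
    simp [omega, wedge3] at h
    linear_combination h
  have e256 : √2 * X 0 2 - X 3 5 = 0 := by
    have h := H 2 5 6
    simp [omega, wedge3] at h
    linear_combination h
  have e345 : X 0 5 + X 1 4 = 0 := by
    have h := H 3 4 5
    simp [omega, wedge3] at h
    linear_combination h
  have e346 : X 0 6 + X 2 4 = 0 := by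
    have h := H 3 4 6
    simp [omega, wedge3] at h
    linear_combination h
  have e356 : √2 * X 0 3 - X 1 6 + X 2 5 = 0 := by
    have h := H 3 5 6
    simp [omega, wedge3] at h
    linear_combination h
  have e456 : √2 * X 0 4 = 0 := by
    have h := H 4 5 6
    simp [omega, wedge3] at h
    linear_combination √2 * h
  -- The matrix is symmetric, so the upper triangle suffices. The coefficients below solve the
  -- linear system entry by entry; the terms with `hs` reduce the squares of √2.
  have key : ∀ i j, i ≤ j → (Xᵀ * eta + eta * X) i j = 0 := by
    intro i j hij
    fin_cases i <;> fin_cases j <;> first | (exfalso; revert hij; decide) | skip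
    all_goals simp only [Matrix.add_apply, Matrix.mul_apply, Fin.sum_univ_seven,
      Matrix.transpose_apply]
    all_goals simp [eta]
    · linear_combination (1/2) * (((1)*√2)*e012 + ((-1)*X 4 0)*hs)
    · linear_combination ((-1))*e013
    · linear_combination ((-1))*e023
    · linear_combination ((-1/2))*e015 + ((-1/2))*e026 + ((1/2)*√2)*e123 + ((-1/2)*X 4 3)*hs
    · linear_combination ((2/3))*e034 + ((1/6)*√2)*e056 + ((1/6)*√2)*e124 + ((1/3))*e135 +
        ((1/3))*e236 + ((-1/6)*X 0 0 + (-1/6)*X 4 4 + (-1/6)*X 5 5 + (-1/6)*X 6 6 + (-1/6)*X 1 1 +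
        (-1/6)*X 2 2)*hs
    · linear_combination ((1/2)*√2)*e024 + ((1/2)*√2)*e125 + ((-1/2)*X 1 0 + (-1/2)*X 4 5)*hs
    · linear_combination ((-1/2)*√2)*e014 + ((1/2)*√2)*e126 + ((-1/2)*X 2 0 + (-1/2)*X 4 6)*hs
    · linear_combination (1/2) * (((1)*√2)*e016 + ((-1)*X 5 1)*hs)
    · linear_combination ((-1/2)*√2)*e015 + ((1/2)*√2)*e026 + ((-1/2)*X 6 1 + (-1/2)*X 5 2)*hs
    · linear_combination ((-1/2))*e014 + ((1/2)*√2)*e036 + ((-1/2))*e126 + ((-1/2)*X 5 3)*hs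
    · linear_combination ((1/2)*√2)*e046 + ((1/2)*√2)*e156 + ((-1/2)*X 5 4 + (-1/2)*X 0 1)*hs
    · linear_combination ((-1/3))*e034 + ((1/6)*√2)*e056 + ((1/6)*√2)*e124 + ((-2/3))*e135 +
        ((1/3))*e236 + ((-1/6)*X 0 0 + (-1/6)*X 4 4 + (-1/6)*X 5 5 + (-1/6)*X 6 6 + (-1/6)*X 1 1 +
        (-1/6)*X 2 2)*hs
    · linear_combination ((-1))*e136
    · linear_combination (1/2) * (((-1)*√2)*e025 + ((-1)*X 6 2)*hs)
    · linear_combination ((-1/2))*e024 + ((-1/2)*√2)*e035 + ((1/2))*e125 + ((-1/2)*X 6 3)*hs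
    · linear_combination ((-1/2)*√2)*e045 + ((1/2)*√2)*e256 + ((-1/2)*X 6 4 + (-1/2)*X 0 2)*hs
    · linear_combination ((-1))*e235
    · linear_combination ((-1/3))*e034 + ((1/6)*√2)*e056 + ((1/6)*√2)*e124 + ((1/3))*e135 +
        ((-2/3))*e236 + ((-1/6)*X 0 0 + (-1/6)*X 4 4 + (-1/6)*X 5 5 + (-1/6)*X 6 6 + (-1/6)*X 1 1 +
        (-1/6)*X 2 2)*hs
    · linear_combination (-1/2) * (((-2/3))*e034 + ((1/3)*√2)*e056 + ((1/3)*√2)*e124 + ((2/3))*e135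
        + ((2/3))*e236 + ((-1/3)*X 0 0 + (-1/3)*X 4 4 + (-1/3)*X 5 5 + (-1/3)*X 6 6 + (-1/3)*X 1 1
        + (-1/3)*X 2 2)*hs)
    · linear_combination ((1/2))*e145 + ((1/2))*e246 + ((1/2)*√2)*e356 + ((-1/2)*X 0 3)*hs
    · linear_combination ((1/2))*e045 + ((-1/2)*√2)*e234 + ((1/2))*e256 + ((-1/2)*X 1 3)*hs
    · linear_combination ((1/2))*e046 + ((1/2)*√2)*e134 + ((-1/2))*e156 + ((-1/2)*X 2 3)*hs
    · linear_combination (1/2) * (((1)*√2)*e456 + ((-1)*X 0 4)*hs)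
    · linear_combination ((1))*e345
    · linear_combination ((1))*e346
    · linear_combination (1/2) * (((1)*√2)*e245 + ((-1)*X 1 5)*hs)
    · linear_combination ((-1/2)*√2)*e145 + ((1/2)*√2)*e246 + ((-1/2)*X 2 5 + (-1/2)*X 1 6)*hs
    · linear_combination (1/2) * (((-1)*√2)*e146 + ((-1)*X 2 6)*hs)
  ext i j
  rcases le_total i j with h | h
  · exact key i j h
  · have h1 := key j i h
    have h2 : (Xᵀ * eta + eta * X)ᵀ = Xᵀ * eta + eta * X := by
      rw [Matrix.transpose_add, Matrix.transpose_mul, Matrix.transpose_mul, eta_transpose,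
        Matrix.transpose_transpose, add_comm]
    rw [← h2]
    exact h1

theorem hMat_mem_g2Star (A : M2) (v : ℝ) (y : Fin 2 → ℝ) : hMat A v y ∈ g2Star := by
  have hs : √2 * √2 - 2 = 0 := by rw [Real.mul_self_sqrt zero_le_two, sub_self]
  intro a b c
  simp only [hMat_mulVec, omega, wedge3, Matrix.trace_fin_two]
  simp
  linear_combination v * (a 3 * (b 5 * c 6 - b 6 * c 5) - a 5 * (b 3 * c 6 - b 6 * c 3)
    + a 6 * (b 3 * c 5 - b 5 * c 3)) * hs

/-- An element of `𝔤₂*` which leaves the line of `b₁` and the plane of `b₂, b₃` invariant. -/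
theorem eq_hMat_of_mem_g2Star {X : M7} (hX : X ∈ g2Star) (h0 : ∀ i, i ≠ 0 → X i 0 = 0)
    (h1 : ∀ i, i ≠ 1 → i ≠ 2 → X i 1 = 0) (h2 : ∀ i, i ≠ 1 → i ≠ 2 → X i 2 = 0) :
    X = hMat !![X 1 1, X 1 2; X 2 1, X 2 2] (X 1 6) ![X 1 4, X 2 4] := by
  have hs : √2 * √2 - 2 = 0 := by rw [Real.mul_self_sqrt zero_le_two, sub_self]
  have H := g2Star_basis_equation hX
  have S : ∀ i j, (Xᵀ * eta + eta * X) i j = 0 := fun i j => by rw [skew_of_mem_g2Star hX]; rfl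
  simp only [Matrix.add_apply, Matrix.mul_apply, Fin.sum_univ_seven, Matrix.transpose_apply] at S
  have e124 := H 1 2 4
  have e134 := H 1 3 4
  have e234 := H 2 3 4
  have e246 := H 2 4 6
  simp [omega, wedge3] at e124 e134 e234 e246
  have z : ∀ i, i ≠ 1 → i ≠ 2 → X i 1 = 0 ∧ X i 2 = 0 := fun i a b => ⟨h1 i a b, h2 i a b⟩
  have z0 := z 0 (by decide) (by decide)
  have z3 := z 3 (by decide) (by decide)
  have z4 := z 4 (by decide) (by decide)
  have z5 := z 5 (by decide) (by decide)
  have z6 := z 6 (by decide) (by decide)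
  have y1 := h0 1 (by decide)
  have y2 := h0 2 (by decide)
  have y3 := h0 3 (by decide)
  have y4 := h0 4 (by decide)
  have y5 := h0 5 (by decide)
  have y6 := h0 6 (by decide)
  have s03 := S 0 3
  have s04 := S 0 4
  have s05 := S 0 5
  have s06 := S 0 6
  have s13 := S 1 3
  have s14 := S 1 4
  have s15 := S 1 5
  have s16 := S 1 6
  have s23 := S 2 3
  have s24 := S 2 4
  have s25 := S 2 5
  have s26 := S 2 6
  have s33 := S 3 3
  have s34 := S 3 4
  have s35 := S 3 5
  have s36 := S 3 6
  have s44 := S 4 4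
  have s45 := S 4 5
  have s46 := S 4 6
  have s55 := S 5 5
  have s56 := S 5 6
  have s66 := S 6 6
  simp [eta] at s03 s04 s05 s06 s13 s14 s15 s16 s23 s24 s25
  simp [eta] at s26 s33 s34 s35 s36 s44 s45 s46 s55 s56 s66
  have hs0 : √2 ≠ 0 := by positivity
  have t13 : √2 * X 1 3 = 0 := by linarith [z0.1, z0.2]
  have t23 : √2 * X 2 3 = 0 := by linarith [z0.1, z0.2]
  have t124 : √2 * (X 1 1 + X 2 2 + X 4 4) = 0 := by linear_combination e124
  have u13 := (mul_eq_zero.1 t13).resolve_left hs0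
  have u23 := (mul_eq_zero.1 t23).resolve_left hs0
  have u124 := (mul_eq_zero.1 t124).resolve_left hs0
  ext i j
  fin_cases i <;> fin_cases j <;> simp [hMat, Matrix.trace_fin_two, *] <;>
    first | linarith [z0.1, z0.2] | skip

/-! ### The holonomy of the polynomial metrics -/

theorem lieAlgebraOf_mono {H K : Set M7} (h : H ⊆ K) : lieAlgebraOf H ⊆ lieAlgebraOf K :=
  fun _ ⟨c, hc, hcH, h0, hd⟩ => ⟨c, hc, fun t => h (hcH t), h0, hd⟩

namespace WaveData

variable (d : WaveData)

/-- The first coefficient matrix of the linear part of the connection form. -/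
def A₁ : M2 := !![d.p₁, d.q₁; d.p₂, d.q₂]

/-- The second coefficient matrix of the linear part of the connection form. -/
def A₂ : M2 := !![d.p₂, d.q₂; d.p₃, d.q₃]

theorem shift_zero : d.shift 0 = 0 := by
  ext i
  fin_cases i <;> simp [shift]

theorem frame_zero : d.frame 0 = 1 := by
  simp [frame, shift_zero]

theorem frameInv_zero : d.frameInv 0 = 1 := by
  simp [frameInv, shift_zero]

theorem metric_zero : d.metric 0 = eta := by
  simp [metric, frame_zero]

/-- At the origin the coframe is the identity, so the bound obtained in the frame is a bound in
coordinates. -/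
theorem holonomyAlgebra_subset {L : Subalgebra ℝ M7} (hL : ∀ x u, d.connForm x u ∈ L) {X : M7}
    (hX : X ∈ holonomyAlgebra Set.univ d.metric 0) : X ∈ L ∧ X ∈ g2Star := by
  refine mem_of_mem_lieAlgebraOf_omegaStabilizer (lieAlgebraOf_mono (fun T hT => ?_) hX)
  have h := d.isGauge.transport_mem hL (fun x u => hMat_mem_g2Star _ _ _) hT
  rwa [frame_zero, frameInv_zero, one_mul, mul_one] at h

theorem one_mem_holonomyGroup : 1 ∈ holonomyGroup Set.univ d.metric 0 := by
  have h := d.isGauge.transport_flat_segment (U := Set.univ) 0 0 (fun _ _ => trivial)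
    (fun t => by
      rw [sub_self, connForm]
      ext i j
      fin_cases i <;> fin_cases j <;> simp [hMat])
  rwa [frame_zero, frameInv_zero, one_mul] at h

theorem mul_mem_holonomyGroup {U : Set (Fin 7 → ℝ)} {g : (Fin 7 → ℝ) → M7} {p : Fin 7 → ℝ} :
    ∀ S ∈ holonomyGroup U g p, ∀ T ∈ holonomyGroup U g p, S * T ∈ holonomyGroup U g p :=
  fun _ hS _ hT => IsParallelTransport.comp hT hS

theorem hMat_zero : hMat 0 0 0 = 0 := by
  ext i j
  fin_cases i <;> fin_cases j <;> simp [hMat]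

/-- Parallel transport in the frame is trivial along a path from `a` to `b`, in both directions
and in all slices. -/
def FlatlyJoined (a b : Fin 7 → ℝ) : Prop :=
  ∀ u : ℝ, IsParallelTransport Set.univ d.metric (a + Pi.single 4 u) (b + Pi.single 4 u)
      (d.frameInv (b + Pi.single 4 u) * 1 * d.frame (a + Pi.single 4 u)) ∧
    IsParallelTransport Set.univ d.metric (b + Pi.single 4 u) (a + Pi.single 4 u)
      (d.frameInv (a + Pi.single 4 u) * 1 * d.frame (b + Pi.single 4 u))

theorem FlatlyJoined.trans {d : WaveData} {a b c : Fin 7 → ℝ} (h : d.FlatlyJoined a b)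
    (h' : d.FlatlyJoined b c) : d.FlatlyJoined a c := by
  intro u
  have h1 := d.isGauge.transport_comp (h u).1 (h' u).1
  have h2 := d.isGauge.transport_comp (h' u).2 (h u).2
  rw [mul_one] at h1 h2
  exact ⟨h1, h2⟩

/-- For a direction without component of index 4 only the `hess` term of the connection form
survives. Neither this term nor the direction depends on the coordinate of index 4, so one condition
serves all slices and, after reversing the segment, both orientations. -/
theorem flatlyJoined_of_hess {a b : Fin 7 → ℝ} (h4 : a 4 = b 4)
    (h : ∀ t : ℝ, d.hess (a + t • (b - a)) *ᵥ ![b 5 - a 5, b 6 - a 6] = 0) :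
    d.FlatlyJoined a b := by
  have key : ∀ (a b : Fin 7 → ℝ) (u : ℝ), a 4 = b 4 →
      (∀ t : ℝ, d.hess (a + t • (b - a)) *ᵥ ![b 5 - a 5, b 6 - a 6] = 0) →
      IsParallelTransport Set.univ d.metric (a + Pi.single 4 u) (b + Pi.single 4 u)
      (d.frameInv (b + Pi.single 4 u) * 1 * d.frame (a + Pi.single 4 u)) := by
    intro a b u h4 h
    rw [mul_one]
    refine d.isGauge.transport_flat_segment _ _ (fun _ _ => trivial) fun t => ?_
    have e : b + Pi.single 4 u - (a + Pi.single 4 u) = b - a := by abel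
    rw [e, connForm]
    have e1 : (b - a) 4 = 0 := by simp [h4]
    have e2 : d.hess (a + Pi.single 4 u + t • (b - a)) = d.hess (a + t • (b - a)) := by
      simp [hess]
    rw [e1, e2, zero_smul, zero_mul, zero_smul, add_zero, Pi.sub_apply, Pi.sub_apply, h, hMat_zero]
  refine fun u => ⟨key a b u h4 h, key b a u h4.symm fun t => ?_⟩
  have e : b + t • (a - b) = a + (1 - t) • (b - a) := by
    ext i; simp; ring
  have e2 : ![a 5 - b 5, a 6 - b 6] = -![b 5 - a 5, b 6 - a 6] := by
    ext i; fin_cases i <;> simp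
  rw [e, e2, Matrix.mulVec_neg, h, neg_zero]

/-- Transport around a rectangle: along the flat path from 0 to `a`, by `-t` in the coordinate of
index 4, back along the flat path in the shifted slice, and by `t` over the origin. The connection
form vanishes in that direction at the origin and is constant along the second side, which alone
contributes. -/
theorem exp_mem_holonomyGroup {a : Fin 7 → ℝ} (ha : d.FlatlyJoined 0 a) (t : ℝ) :
    NormedSpace.exp (t • d.connForm a (Pi.single 4 1)) ∈ holonomyGroup Set.univ d.metric 0 := by
  have hlin : ∀ x (c : ℝ), d.connForm x (Pi.single 4 c) = c • d.connForm x (Pi.single 4 1) := by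
    intro x c
    rw [connForm, connForm, hMat_smul]
    congr 1
    · simp
    · simp
    · ext i
      fin_cases i <;> simp
  have hind : ∀ x (s : ℝ) v, d.connForm (x + Pi.single 4 s) v = d.connForm x v := by
    intro x s v
    simp [connForm, hess, shift]
  have h0 : d.connForm 0 (Pi.single 4 1) = 0 := by
    rw [connForm, shift_zero, ← hMat_zero]
    congr 1
    · ext i j
      fin_cases i <;> fin_cases j <;> simp
    · simp
    · ext i
      fin_cases i <;> simp
  have hstep : ∀ x (s c : ℝ), IsParallelTransport Set.univ d.metric (x + Pi.single 4 s)
      (x + Pi.single 4 s + Pi.single 4 c) (d.frameInv (x + Pi.single 4 s + Pi.single 4 c)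
        * NormedSpace.exp (-(c • d.connForm x (Pi.single 4 1))) * d.frame (x + Pi.single 4 s)) := by
    intro x s c
    refine d.isGauge.transport_segment _ _ _ (fun _ _ => trivial) fun r => ?_
    have e : x + Pi.single 4 s + r • (Pi.single 4 c : Fin 7 → ℝ) = x + Pi.single 4 (s + r * c) := by
      rw [← Pi.single_smul, add_assoc, ← Pi.single_add, smul_eq_mul]
    rw [e, hind, hlin]
  have s1 := (ha 0).1
  have s2 := hstep a 0 (-t)
  have s3 := (ha (-t)).2
  have s4 := hstep 0 (-t) t
  have e1 : a + Pi.single 4 (0 : ℝ) + Pi.single 4 (-t) = a + Pi.single 4 (-t) := by simp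
  have e2 : (0 : Fin 7 → ℝ) + Pi.single 4 (-t) + Pi.single 4 t = 0 := by
    rw [zero_add, ← Pi.single_add, neg_add_cancel, Pi.single_zero]
  rw [e1] at s2
  rw [e2] at s4
  have h := d.isGauge.transport_comp (d.isGauge.transport_comp (d.isGauge.transport_comp s1 s2) s3)
    s4
  simp only [Pi.single_zero, add_zero, frame_zero, frameInv_zero, h0, smul_zero, neg_zero,
    NormedSpace.exp_zero, one_mul, mul_one, neg_smul, neg_neg] at h
  exact h

/-- The holonomy algebra as a linear subspace. -/
def holSubmodule : Submodule ℝ M7 :=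
  lieSubmodule (holonomyGroup Set.univ d.metric 0) d.one_mem_holonomyGroup mul_mem_holonomyGroup

/-- The elements of the holonomy algebra which normalise it. -/
def holNormalizer : LieSubalgebra ℝ M7 where
  carrier := {X | X ∈ d.holSubmodule ∧ ∀ Y ∈ d.holSubmodule, ⁅X, Y⁆ ∈ d.holSubmodule}
  zero_mem' := ⟨zero_mem _, fun Y _ => by rw [zero_lie]; exact zero_mem _⟩
  add_mem' := fun ⟨h1, h2⟩ ⟨h3, h4⟩ =>
    ⟨add_mem h1 h3, fun Y hY => by rw [add_lie]; exact add_mem (h2 Y hY) (h4 Y hY)⟩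
  smul_mem' := fun c _ ⟨h1, h2⟩ =>
    ⟨Submodule.smul_mem _ c h1, fun Y hY => by
      rw [smul_lie]; exact Submodule.smul_mem _ c (h2 Y hY)⟩
  lie_mem' := fun ⟨_, h2⟩ ⟨h3, h4⟩ => ⟨h2 _ h3, fun Y hY => by
    rw [lie_lie]; exact sub_mem (h2 _ (h4 _ hY)) (h4 _ (h2 _ hY))⟩

theorem mem_holonomyAlgebra_of_mem_holNormalizer {X : M7} (hX : X ∈ d.holNormalizer) :
    X ∈ holonomyAlgebra Set.univ d.metric 0 := hX.1

/-- The set of velocities is known to be a linear subspace but not to be closed under brackets.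
Brackets of these generators are therefore formed in the normaliser, which is a Lie algebra by
construction. -/
theorem connForm_mem_holNormalizer {a : Fin 7 → ℝ} (ha : d.FlatlyJoined 0 a) :
    d.connForm a (Pi.single 4 1) ∈ d.holNormalizer :=
  ⟨mem_lieAlgebraOf_of_exp (d.exp_mem_holonomyGroup ha),
    fun _ hY => lie_mem_lieSubmodule _ _ (d.exp_mem_holonomyGroup ha) hY⟩

theorem flatlyJoined_five (s : ℝ) : d.FlatlyJoined 0 (Pi.single 5 s) := by
  refine d.flatlyJoined_of_hess (by simp) fun t => ?_
  ext i
  fin_cases i <;> simp [hess]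

/-- On the axis of index 5 the linear part is odd in `s` and `v` is even, so the values at 1 and -1
separate h(A₁, 0, 0) from h(0, 1, 0). -/
theorem hMat_quadratic_mem (s : ℝ) : hMat (-(s • d.A₁)) (1 / 2 * (s * s)) 0 ∈ d.holNormalizer := by
  have h := d.connForm_mem_holNormalizer (d.flatlyJoined_five s)
  have e : d.connForm (Pi.single 5 s) (Pi.single 4 1) = hMat (-(s • d.A₁)) (1 / 2 * (s * s)) 0 := by
    rw [connForm]
    congr 1
    · ext i j
      fin_cases i <;> fin_cases j <;> simp [A₁, mul_comm]
    · simp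
    · ext i
      fin_cases i <;> simp [hess, Matrix.vecHead, Matrix.vecTail]
  rwa [e] at h

theorem hMat_v_mem : hMat 0 1 0 ∈ d.holNormalizer := by
  have h := add_mem (d.hMat_quadratic_mem 1) (d.hMat_quadratic_mem (-1))
  rw [hMat_add] at h
  convert h using 2
  · simp
  · norm_num
  · simp

theorem hMat_A₁_mem : hMat d.A₁ 0 0 ∈ d.holNormalizer := by
  have h := add_mem (d.hMat_quadratic_mem (-1)) (LieSubalgebra.smul_mem _ (-1 / 2) d.hMat_v_mem)
  rw [hMat_smul, hMat_add] at h
  convert h using 2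
  · simp
  · norm_num
  · simp

/-- A flat displacement in the coordinate of index 3, starting at the point 1 of the axis of index
5, changes only the first component of y, through the term -√2 `x 5 * x 3`. -/
theorem hMat_e₁_mem : hMat 0 0 ![1, 0] ∈ d.holNormalizer := by
  have hj : d.FlatlyJoined (Pi.single 5 1) (Pi.single 5 1 + Pi.single 3 1) := by
    refine d.flatlyJoined_of_hess (by simp) fun t => ?_
    ext i
    fin_cases i <;> simp
  have h := d.connForm_mem_holNormalizer ((d.flatlyJoined_five 1).trans hj)
  have e : d.connForm (Pi.single 5 1 + Pi.single 3 1) (Pi.single 4 1)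
      = hMat (-((1 : ℝ) • d.A₁)) (1 / 2 * (1 * 1)) ![-√2, 0] := by
    rw [connForm]
    congr 1
    · ext i j
      fin_cases i <;> fin_cases j <;> simp [A₁]
    · simp
    · ext i
      fin_cases i <;> simp [hess, Matrix.vecHead, Matrix.vecTail]
  rw [e] at h
  have h2 := LieSubalgebra.smul_mem _ (-(√2)⁻¹) (sub_mem h (d.hMat_quadratic_mem 1))
  convert h2 using 1
  have hs : √2 ≠ 0 := by positivity
  ext i j
  fin_cases i <;> fin_cases j <;> simp [hMat, hs]

/-- The axis of index 6 supplies the second coefficient matrix. The parameter `κ` adds a translation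
in the second direction; it is needed when diagonal linear parts cannot move the first translation
there. -/
theorem hMat_A₂_mem : hMat d.A₂ 0 ![0, d.κ] ∈ d.holNormalizer := by
  have hj : d.FlatlyJoined 0 (Pi.single 6 1) := by
    refine d.flatlyJoined_of_hess (by simp) fun t => ?_
    ext i
    fin_cases i <;> simp [hess]
  have h := d.connForm_mem_holNormalizer hj
  have e : d.connForm (Pi.single 6 1) (Pi.single 4 1) = hMat (-d.A₂) 0 ![0, -d.κ] := by
    rw [connForm]
    congr 1
    · ext i j
      fin_cases i <;> fin_cases j <;> simp [A₂]
    · simp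
    · ext i
      fin_cases i <;> simp [hess, Matrix.vecHead, Matrix.vecTail]
  rw [e] at h
  have h2 := LieSubalgebra.smul_mem _ (-1) h
  rw [hMat_smul] at h2
  convert h2 using 2
  · simp
  · simp
  · ext i
    fin_cases i <;> simp

/-- The holonomy algebra is squeezed between `h` and the intersection of `L` with 𝔤₂*. The base
point is the origin and the isometry is the identity, because the metric equals `eta` there. -/
theorem isRealised_of_bounds {h : LieSubalgebra ℝ M7} {L : Subalgebra ℝ M7}
    (hL : ∀ x u, d.connForm x u ∈ L) (hLh : ∀ X ∈ L, X ∈ g2Star → X ∈ h)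
    (hle : h ≤ d.holNormalizer) : IsRealised h := by
  refine ⟨Set.univ, d.metric, isOpen_univ, ?_, d.isMetric43, 0, trivial, 1, isUnit_one, ?_, ?_⟩
  · have : ContractibleSpace (Set.univ : Set (Fin 7 → ℝ)) :=
      (Homeomorph.Set.univ (Fin 7 → ℝ)).contractibleSpace
    infer_instance
  · rw [metric_zero]; simp
  · ext X
    constructor
    · intro hX
      have hb := d.holonomyAlgebra_subset hL hX
      exact ⟨X, hLh X hb.1 hb.2, by simp⟩
    · rintro ⟨Y, hY, rfl⟩
      simpa using d.mem_holonomyAlgebra_of_mem_holNormalizer (hle hY)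

end WaveData

/-! ### Realisation of the eight algebras -/

/-- The matrices whose non-zero entries lie in the positions of a preorder `r`, and whose diagonal
entries in positions related by `e` agree. -/
def incidenceAlgebra (r e : Fin 7 → Fin 7 → Bool) (hr : ∀ i, r i i)
    (ht : ∀ i j k, r i j → r j k → r i k)
    (he : ∀ i j, e i j → ∀ k, (r i k → r k i → k = i) ∧ (r j k → r k j → k = j)) :
    Subalgebra ℝ M7 where
  carrier := {T | (∀ i j, ¬ r i j → T i j = 0) ∧ ∀ i j, e i j → T i i = T j j}
  mul_mem' := by
    rintro S T ⟨hS, hS'⟩ ⟨hT, hT'⟩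
    -- An index which is alone in its class of the preorder contributes a multiplicative diagonal
    -- entry, so equality of two such entries survives products.
    have hdiag : ∀ i, (∀ k, r i k → r k i → k = i) → (S * T) i i = S i i * T i i := by
      intro i hi
      rw [Matrix.mul_apply]
      refine Finset.sum_eq_single i (fun k _ hk => ?_) (by simp)
      by_cases h1 : r i k
      · rw [hT k i fun h2 => hk (hi k h1 h2), mul_zero]
      · rw [hS i k h1, zero_mul]
    refine ⟨fun i j hij => ?_, fun i j hij => ?_⟩
    · rw [Matrix.mul_apply]
      refine Finset.sum_eq_zero fun k _ => ?_
      by_cases h1 : r i k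
      · rw [hT k j fun h2 => hij (ht i k j h1 h2), mul_zero]
      · rw [hS i k h1, zero_mul]
    · rw [hdiag i fun k => (he i j hij k).1, hdiag j fun k => (he i j hij k).2, hS' i j hij,
        hT' i j hij]
  add_mem' := by
    rintro S T ⟨hS, hS'⟩ ⟨hT, hT'⟩
    exact ⟨fun i j hij => by simp [hS i j hij, hT i j hij],
      fun i j hij => by simp [hS' i j hij, hT' i j hij]⟩
  algebraMap_mem' := by
    intro c
    refine ⟨fun i j hij => ?_, fun i j _ => by simp [Matrix.algebraMap_matrix_apply]⟩
    have : i ≠ j := by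
      rintro rfl
      exact hij (hr i)
    simp [Matrix.algebraMap_matrix_apply, this]

/-- The positions of the non-zero entries in the matrix algebra generated by all `h(A, v, y)`. -/
def blockPos (i j : Fin 7) : Bool :=
  i ∈ (![{0}, {1, 2}, {1, 2}, {0, 3}, {0, 1, 2, 3, 4}, {0, 1, 2, 5, 6}, {0, 1, 2, 5, 6}] :
    Fin 7 → Finset (Fin 7)) j

/-- The positions of the non-zero entries for diagonal `A`. -/
def diagPos (i j : Fin 7) : Bool :=
  i ∈ (![{0}, {1}, {2}, {0, 3}, {0, 1, 2, 3, 4}, {0, 1, 2, 5}, {0, 1, 2, 6}] :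
    Fin 7 → Finset (Fin 7)) j

/-- The positions of the non-zero entries for diagonal `A` and `y₂ = 0`. -/
def diagPos' (i j : Fin 7) : Bool :=
  i ∈ (![{0}, {1}, {2}, {0, 3}, {0, 1, 3, 4}, {0, 1, 2, 5}, {0, 1, 2, 6}] :
    Fin 7 → Finset (Fin 7)) j

theorem eq_hMat_of_blockPos {X : M7} (hX : X ∈ g2Star) (h : ∀ i j, ¬ blockPos i j → X i j = 0) :
    X = hMat !![X 1 1, X 1 2; X 2 1, X 2 2] (X 1 6) ![X 1 4, X 2 4] := by
  refine eq_hMat_of_mem_g2Star hX (fun i hi => h i 0 ?_) (fun i h1 h2 => h i 1 ?_)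
    (fun i h1 h2 => h i 2 ?_)
  · revert i; decide
  · revert i; decide
  · revert i; decide

/-- A unital matrix algebra cannot demand that a diagonal entry vanish, only that two of them agree.
On 𝔤₂* the entry of index 3 vanishes, so agreement with it expresses tr A = 0 or the vanishing of
entries of A. -/
theorem trace_eq_of_mem_g2Star {X : M7} (hX : X ∈ g2Star)
    (h : ∀ i j, ¬ blockPos i j → X i j = 0) : X 0 0 = X 1 1 + X 2 2 ∧ X 3 3 = 0 := by
  have e := eq_hMat_of_blockPos hX h
  constructor
  · have := congrFun (congrFun e 0) 0
    simpa [hMat, Matrix.trace_fin_two] using this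
  · have := congrFun (congrFun e 3) 3
    simpa [hMat] using this

theorem hMat_blockPos (A : M2) (v : ℝ) (y : Fin 2 → ℝ) (i j : Fin 7) (h : ¬ blockPos i j) :
    hMat A v y i j = 0 := by
  fin_cases i <;> fin_cases j <;> first | rfl | exact absurd (by decide) h

theorem blockPos_of_diagPos : ∀ i j, diagPos i j → blockPos i j := by decide

theorem diagPos_of_diagPos' : ∀ i j, diagPos' i j → diagPos i j := by decide

theorem hMat_diagPos {A : M2} (h1 : A 0 1 = 0) (h2 : A 1 0 = 0) (v : ℝ) (y : Fin 2 → ℝ)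
    (i j : Fin 7) (h : ¬ diagPos i j) : hMat A v y i j = 0 := by
  fin_cases i <;> fin_cases j <;> first | exact absurd (by decide) h | simp [hMat, h1, h2]

theorem hMat_diagPos' {A : M2} (h1 : A 0 1 = 0) (h2 : A 1 0 = 0) (v : ℝ) {y : Fin 2 → ℝ}
    (hy : y 1 = 0) (i j : Fin 7) (h : ¬ diagPos' i j) : hMat A v y i j = 0 := by
  fin_cases i <;> fin_cases j <;> first | exact absurd (by decide) h | simp [hMat, h1, h2, hy]

/-- The matrix algebra for `𝔤𝔩(2)`. -/
def glAlgebra : Subalgebra ℝ M7 :=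
  incidenceAlgebra blockPos (fun _ _ => false) (by decide) (by decide) (by decide)

/-- The matrix algebra for `𝔰𝔩(2)`. -/
def slAlgebra : Subalgebra ℝ M7 :=
  incidenceAlgebra blockPos (fun i j => i = 0 ∧ j = 3) (by decide) (by decide) (by decide)

/-- The matrix algebra for `𝔠𝔬(2)`. -/
def coAlgebra : Subalgebra ℝ M7 where
  carrier := {T | T ∈ glAlgebra ∧ T 1 1 = T 2 2 ∧ T 1 2 = -T 2 1}
  mul_mem' := by
    rintro S T ⟨hS, h1, h2⟩ ⟨hT, h3, h4⟩
    refine ⟨mul_mem hS hT, ?_⟩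
    have z : ∀ i, i ≠ 1 → i ≠ 2 → T i 1 = 0 ∧ T i 2 = 0 := by
      intro i hi hi'
      constructor
      · refine hT.1 i 1 ?_
        revert i; decide
      · refine hT.1 i 2 ?_
        revert i; decide
    simp only [Matrix.mul_apply, Fin.sum_univ_seven, z 0 (by decide) (by decide),
      z 3 (by decide) (by decide), z 4 (by decide) (by decide), z 5 (by decide) (by decide),
      z 6 (by decide) (by decide), h1, h2, h3, h4]
    constructor <;> ring
  add_mem' := by
    rintro S T ⟨hS, h1, h2⟩ ⟨hT, h3, h4⟩
    exact ⟨add_mem hS hT, by simp [h1, h3], by simp [h2, h4]; ring⟩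
  algebraMap_mem' := by
    intro c
    exact ⟨glAlgebra.algebraMap_mem c, by simp [Matrix.algebraMap_matrix_apply],
      by simp [Matrix.algebraMap_matrix_apply]⟩

/-- The matrix algebra for diagonal matrices. -/
def diagAlgebra : Subalgebra ℝ M7 :=
  incidenceAlgebra diagPos (fun _ _ => false) (by decide) (by decide) (by decide)

/-- The matrix algebra for `ℝ · diag(1, 0)`. -/
def lineAlgebra : Subalgebra ℝ M7 :=
  incidenceAlgebra diagPos (fun i j => i = 2 ∧ j = 3) (by decide) (by decide) (by decide)

/-- The matrix algebra for `0`. -/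
def zeroAlgebra : Subalgebra ℝ M7 :=
  incidenceAlgebra diagPos (fun i j => (i = 1 ∨ i = 2) ∧ j = 3) (by decide) (by decide) (by decide)

/-- The matrix algebra for `ℝ · diag(1, 0)` and `y₂ = 0`. -/
def lineAlgebra' : Subalgebra ℝ M7 :=
  incidenceAlgebra diagPos' (fun i j => i = 2 ∧ j = 3) (by decide) (by decide) (by decide)

/-- The matrix algebra for `0` and `y₂ = 0`. -/
def zeroAlgebra' : Subalgebra ℝ M7 :=
  incidenceAlgebra diagPos' (fun i j => (i = 1 ∨ i = 2) ∧ j = 3) (by decide) (by decide) (by decide)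

theorem semi12_le {a : LieSubalgebra ℝ M2} {N : LieSubalgebra ℝ M7} (hv : hMat 0 1 0 ∈ N)
    (h1 : hMat 0 0 ![1, 0] ∈ N) (h2 : hMat 0 0 ![0, 1] ∈ N) (ha : ∀ A ∈ a, hMat A 0 0 ∈ N) :
    semi12 a ≤ N := by
  rintro _ ⟨A, hA, v, y, -, rfl⟩
  have h := add_mem (add_mem (ha A hA) (N.smul_mem v hv))
    (add_mem (N.smul_mem (y 0) h1) (N.smul_mem (y 1) h2))
  simp only [hMat_smul, hMat_add] at h
  convert h using 2
  · simp
  · simp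
  · ext i; fin_cases i <;> simp

theorem mem_semi12 {a : LieSubalgebra ℝ M2} {A : M2} (hA : A ∈ a) (v : ℝ) (y : Fin 2 → ℝ) :
    hMat A v y ∈ semi12 a := ⟨A, hA, v, y, trivial, rfl⟩

/-- The bracket yields A y + (tr A) y, whose second term is already available. -/
theorem hMat_mulVec_mem {N : LieSubalgebra ℝ M7} {A : M2} (hA : hMat A 0 0 ∈ N) {y : Fin 2 → ℝ}
    (hy : hMat 0 0 y ∈ N) : hMat 0 0 (A *ᵥ y) ∈ N := by
  have h := N.lie_mem hA hy
  rw [hMat_lie] at h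
  have h2 := sub_mem h (N.smul_mem A.trace hy)
  convert h2 using 1
  rw [sub_eq_add_neg, ← neg_one_smul ℝ, smul_smul, hMat_smul, hMat_add]
  congr 1
  · simp
  · simp
  · ext i
    fin_cases i <;> simp [Matrix.vecHead, Matrix.vecTail]

theorem hMat_lie_mem {N : LieSubalgebra ℝ M7} {A B : M2} (hA : hMat A 0 0 ∈ N)
    (hB : hMat B 0 0 ∈ N) : hMat ⁅A, B⁆ 0 0 ∈ N := by
  have h := N.lie_mem hA hB
  rw [hMat_lie] at h
  convert h using 2 <;> simp

theorem hMat_comb_mem {N : LieSubalgebra ℝ M7} {A B : M2} (hA : hMat A 0 0 ∈ N)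
    (hB : hMat B 0 0 ∈ N) (c e : ℝ) : hMat (c • A + e • B) 0 0 ∈ N := by
  have h := add_mem (N.smul_mem c hA) (N.smul_mem e hB)
  rw [hMat_smul, hMat_smul, hMat_add] at h
  convert h using 2 <;> simp

theorem isRealised_gl : IsRealised (semi12 ⊤) := by
  -- Here A₁ = E₁₁ + E₁₂ and A₂ = E₂₁. Then [A₁, A₂] + A₂ = E₁₁ - E₂₂, whose bracket with A₁
  -- isolates E₁₂, and so on until all matrix units are reached.
  let d : WaveData := ⟨1, 0, 1, 1, 0, 0, 0⟩
  refine d.isRealised_of_bounds (L := glAlgebra)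
    (fun x u => ⟨fun i j => hMat_blockPos _ _ _ i j, by simp⟩) (fun X hX hg => ?_) ?_
  · rw [eq_hMat_of_blockPos hg hX.1]
    exact mem_semi12 (a := ⊤) (LieSubalgebra.mem_top _) _ _
  · have hA1 := d.hMat_A₁_mem
    have hA2 : hMat d.A₂ 0 0 ∈ d.holNormalizer := by
      convert d.hMat_A₂_mem using 2; ext i; fin_cases i <;> simp [d]
    have hX := hMat_comb_mem (hMat_lie_mem hA1 hA2) hA2 1 1
    have hE12 := hMat_comb_mem (hMat_lie_mem hA1 hX) hA1 (-1 / 2) 0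
    refine semi12_le d.hMat_v_mem d.hMat_e₁_mem ?_ fun A _ => ?_
    · convert hMat_mulVec_mem hA2 d.hMat_e₁_mem using 2
      ext i; fin_cases i <;> simp [d, WaveData.A₂]
    · have hE11 := hMat_comb_mem hA1 hE12 1 (-1)
      have hE22 := hMat_comb_mem hE11 hX 1 (-1)
      convert hMat_comb_mem (hMat_comb_mem hE11 hE12 (A 0 0) (A 0 1))
        (hMat_comb_mem hA2 hE22 (A 1 0) (A 1 1)) 1 1 using 2
      ext i j
      fin_cases i <;> fin_cases j <;>
        simp [d, WaveData.A₁, WaveData.A₂, Ring.lie_def] <;> ring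

theorem isRealised_sl : IsRealised (semi12 (LieAlgebra.SpecialLinear.sl (Fin 2) ℝ)) := by
  -- A₁ = E₁₂ and A₂ = E₂₁ generate 𝔰𝔩(2).
  let d : WaveData := ⟨0, 0, 1, 1, 0, 0, 0⟩
  refine d.isRealised_of_bounds (L := slAlgebra)
    (fun x u => ⟨fun i j => hMat_blockPos _ _ _ i j, ?_⟩) (fun X hX hg => ?_) ?_
  · intro i j hij
    simp only [decide_eq_true_eq] at hij
    obtain ⟨rfl, rfl⟩ := hij
    simp [WaveData.connForm, hMat, Matrix.trace_fin_two, d]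
  · have ht := trace_eq_of_mem_g2Star hg hX.1
    have h03 := hX.2 0 3 (by decide)
    rw [eq_hMat_of_blockPos hg hX.1]
    refine mem_semi12 ?_ _ _
    change Matrix.trace (_ : M2) = 0
    simp only [Matrix.trace_fin_two, Matrix.of_apply, Matrix.cons_val', Matrix.cons_val_zero,
      Matrix.cons_val_one, Matrix.cons_val_fin_one]
    linarith [ht.1, ht.2]
  · have hA1 := d.hMat_A₁_mem
    have hA2 : hMat d.A₂ 0 0 ∈ d.holNormalizer := by
      convert d.hMat_A₂_mem using 2; ext i; fin_cases i <;> simp [d]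
    have hX := hMat_lie_mem hA1 hA2
    refine semi12_le d.hMat_v_mem d.hMat_e₁_mem ?_ fun A hA => ?_
    · convert hMat_mulVec_mem hA2 d.hMat_e₁_mem using 2
      ext i; fin_cases i <;> simp [d, WaveData.A₂]
    · have ht : A 0 0 + A 1 1 = 0 := by
        rw [← Matrix.trace_fin_two]; exact hA
      convert hMat_comb_mem (hMat_comb_mem hA1 hA2 (A 0 1) (A 1 0)) hX 1 (A 0 0) using 2
      ext i j
      fin_cases i <;> fin_cases j <;>
        simp [d, WaveData.A₁, WaveData.A₂, Ring.lie_def] <;> linarith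

theorem isRealised_co : IsRealised (semi12 co2) := by
  -- A₁ is the identity and A₂ a rotation by a right angle, a basis of 𝔠𝔬(2).
  let d : WaveData := ⟨1, 0, -1, 0, 1, 0, 0⟩
  refine d.isRealised_of_bounds (L := coAlgebra)
    (fun x u => ⟨⟨fun i j => hMat_blockPos _ _ _ i j, by simp⟩, ?_⟩) (fun X hX hg => ?_) ?_
  · constructor <;> simp [WaveData.connForm, hMat, d]
  · rw [eq_hMat_of_blockPos hg hX.1.1]
    exact mem_semi12 (a := co2) (show _ ∧ _ from ⟨by simpa using hX.2.1, by simpa using hX.2.2⟩) _ _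
  · have hA1 := d.hMat_A₁_mem
    have hA2 : hMat d.A₂ 0 0 ∈ d.holNormalizer := by
      convert d.hMat_A₂_mem using 2; ext i; fin_cases i <;> simp [d]
    refine semi12_le d.hMat_v_mem d.hMat_e₁_mem ?_ fun A hA => ?_
    · have h := d.holNormalizer.smul_mem (-1) (hMat_mulVec_mem hA2 d.hMat_e₁_mem)
      rw [hMat_smul] at h
      convert h using 2
      · simp
      · simp
      · ext i; fin_cases i <;> simp [d, WaveData.A₂]
    · obtain ⟨h1, h2⟩ := hA
      convert hMat_comb_mem hA1 hA2 (A 0 0) (A 0 1) using 2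
      ext i j
      fin_cases i <;> fin_cases j <;> simp [d, WaveData.A₁, WaveData.A₂, h1, h2]

theorem isRealised_diag : IsRealised (semi12 diag2) := by
  -- A₁ = E₁₁ and A₂ = E₂₂. The second translation is the bracket of h(A₁, 0, 0) with h(A₂, 0, (0,
  -- 1)), where only tr A₁ acts on (0, 1).
  let d : WaveData := ⟨1, 0, 0, 0, 0, 1, 1⟩
  refine d.isRealised_of_bounds (L := diagAlgebra)
    (fun x u => ⟨hMat_diagPos (by simp [d]) (by simp [d]) _ _, by simp⟩) (fun X hX hg => ?_) ?_
  · rw [eq_hMat_of_blockPos hg fun i j h => hX.1 i j (mt (blockPos_of_diagPos i j) h)]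
    exact mem_semi12 (a := diag2) (show _ ∧ _ from
      ⟨by simpa using hX.1 1 2 (by decide), by simpa using hX.1 2 1 (by decide)⟩) _ _
  · have hA1 := d.hMat_A₁_mem
    have hA2 := d.hMat_A₂_mem
    have he2 : hMat 0 0 ![0, 1] ∈ d.holNormalizer := by
      have h := d.holNormalizer.lie_mem hA1 hA2
      rw [hMat_lie] at h
      convert h using 2
      · ext i j
        fin_cases i <;> fin_cases j <;> simp [d, WaveData.A₁, WaveData.A₂, Ring.lie_def]
      · simp
      · ext i
        fin_cases i <;> simp [d, WaveData.A₁, Matrix.trace_fin_two, Matrix.vecHead, Matrix.vecTail]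
    refine semi12_le d.hMat_v_mem d.hMat_e₁_mem he2 fun A hA => ?_
    have hA2' := sub_mem hA2 he2
    have hA2'' : hMat d.A₂ 0 0 ∈ d.holNormalizer := by
      convert hA2' using 1
      ext i j
      fin_cases i <;> fin_cases j <;> simp [hMat, d]
    obtain ⟨h1, h2⟩ := hA
    convert hMat_comb_mem hA1 hA2'' (A 0 0) (A 1 1) using 2
    ext i j
    fin_cases i <;> fin_cases j <;> simp [d, WaveData.A₁, WaveData.A₂, h1, h2]

theorem isRealised_line12 : IsRealised (semi12 line10) := by
  -- A₁ = E₁₁ and A₂ = 0, so the axis of index 6 yields the pure translation produced by `κ`.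
  let d : WaveData := ⟨1, 0, 0, 0, 0, 0, 1⟩
  refine d.isRealised_of_bounds (L := lineAlgebra)
    (fun x u => ⟨hMat_diagPos (by simp [d]) (by simp [d]) _ _, ?_⟩) (fun X hX hg => ?_) ?_
  · intro i j hij
    simp only [decide_eq_true_eq] at hij
    obtain ⟨rfl, rfl⟩ := hij
    simp [WaveData.connForm, hMat, d]
  · have hb : ∀ i j, ¬ blockPos i j → X i j = 0 :=
      fun i j h => hX.1 i j (mt (blockPos_of_diagPos i j) h)
    rw [eq_hMat_of_blockPos hg hb]
    refine mem_semi12 (a := line10) (show ∃ c : ℝ, _ from ⟨X 1 1, ?_⟩) _ _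
    rw [hX.1 1 2 (by decide), hX.1 2 1 (by decide), hX.2 2 3 (by decide),
      (trace_eq_of_mem_g2Star hg hb).2]
  · refine semi12_le d.hMat_v_mem d.hMat_e₁_mem ?_ ?_
    · convert d.hMat_A₂_mem using 2
      ext i j
      fin_cases i <;> fin_cases j <;> simp [d, WaveData.A₂]
    · rintro _ ⟨c, rfl⟩
      convert hMat_comb_mem d.hMat_A₁_mem d.hMat_A₁_mem c 0 using 2
      ext i j
      fin_cases i <;> fin_cases j <;> simp [d, WaveData.A₁]

theorem isRealised_zero12 : IsRealised (semi12 ⊥) := by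
  let d : WaveData := ⟨0, 0, 0, 0, 0, 0, 1⟩
  refine d.isRealised_of_bounds (L := zeroAlgebra)
    (fun x u => ⟨hMat_diagPos (by simp [d]) (by simp [d]) _ _, ?_⟩) (fun X hX hg => ?_) ?_
  · intro i j hij
    simp only [decide_eq_true_eq] at hij
    obtain ⟨rfl | rfl, rfl⟩ := hij <;> simp [WaveData.connForm, hMat, d]
  · have hb : ∀ i j, ¬ blockPos i j → X i j = 0 :=
      fun i j h => hX.1 i j (mt (blockPos_of_diagPos i j) h)
    rw [eq_hMat_of_blockPos hg hb]
    refine mem_semi12 ?_ _ _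
    rw [LieSubalgebra.mem_bot, hX.1 1 2 (by decide), hX.1 2 1 (by decide), hX.2 2 3 (by decide),
      hX.2 1 3 (by decide), (trace_eq_of_mem_g2Star hg hb).2]
    ext i j
    fin_cases i <;> fin_cases j <;> rfl
  · refine semi12_le d.hMat_v_mem d.hMat_e₁_mem ?_ ?_
    · convert d.hMat_A₂_mem using 2
      ext i j
      fin_cases i <;> fin_cases j <;> simp [d, WaveData.A₂]
    · intro A hA
      rw [LieSubalgebra.mem_bot] at hA
      rw [hA, WaveData.hMat_zero]
      exact zero_mem _

theorem connForm_apply_two_four (c : ℝ) (x u : Fin 7 → ℝ) :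
    (⟨c, 0, 0, 0, 0, 0, 0⟩ : WaveData).connForm x u ∈ {X : M7 | ∀ i j, ¬ diagPos' i j → X i j = 0}
      := by
  refine hMat_diagPos' (by simp) (by simp) _ ?_
  simp [WaveData.hess, Matrix.mulVec, dotProduct, Matrix.vecHead, Matrix.vecTail]

theorem isRealised_line11 : IsRealised line10Semi11 := by
  let d : WaveData := ⟨1, 0, 0, 0, 0, 0, 0⟩
  refine d.isRealised_of_bounds (L := lineAlgebra')
    (fun x u => ⟨connForm_apply_two_four 1 x u, ?_⟩) (fun X hX hg => ?_) ?_
  · intro i j hij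
    simp only [decide_eq_true_eq] at hij
    obtain ⟨rfl, rfl⟩ := hij
    simp [WaveData.connForm, hMat, d]
  · have hb : ∀ i j, ¬ blockPos i j → X i j = 0 :=
      fun i j h => hX.1 i j (mt (fun h => blockPos_of_diagPos i j (diagPos_of_diagPos' i j h)) h)
    rw [eq_hMat_of_blockPos hg hb]
    refine ⟨_, ⟨X 1 1, ?_⟩, _, _, ?_, rfl⟩
    · rw [hX.1 1 2 (by decide), hX.1 2 1 (by decide), hX.2 2 3 (by decide),
        (trace_eq_of_mem_g2Star hg hb).2]
    · exact hX.1 2 4 (by decide)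
  · rintro _ ⟨_, ⟨c, rfl⟩, v, y, hy, rfl⟩
    have h := add_mem (add_mem (d.holNormalizer.smul_mem c d.hMat_A₁_mem)
      (d.holNormalizer.smul_mem v d.hMat_v_mem)) (d.holNormalizer.smul_mem (y 0) d.hMat_e₁_mem)
    simp only [hMat_smul, hMat_add] at h
    convert h using 2
    · ext i j
      fin_cases i <;> fin_cases j <;> simp [d, WaveData.A₁]
    · simp
    · have hy' : y 1 = 0 := hy
      ext i; fin_cases i <;> simp [hy']

theorem isRealised_zero11 : IsRealised zeroSemi11 := by
  let d : WaveData := ⟨0, 0, 0, 0, 0, 0, 0⟩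
  refine d.isRealised_of_bounds (L := zeroAlgebra')
    (fun x u => ⟨connForm_apply_two_four 0 x u, ?_⟩) (fun X hX hg => ?_) ?_
  · intro i j hij
    simp only [decide_eq_true_eq] at hij
    obtain ⟨rfl | rfl, rfl⟩ := hij <;> simp [WaveData.connForm, hMat, d]
  · have hb : ∀ i j, ¬ blockPos i j → X i j = 0 :=
      fun i j h => hX.1 i j (mt (fun h => blockPos_of_diagPos i j (diagPos_of_diagPos' i j h)) h)
    rw [eq_hMat_of_blockPos hg hb]
    refine ⟨_, ?_, _, _, ?_, rfl⟩
    · rw [LieSubalgebra.mem_bot, hX.1 1 2 (by decide), hX.1 2 1 (by decide), hX.2 2 3 (by decide),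
        hX.2 1 3 (by decide), (trace_eq_of_mem_g2Star hg hb).2]
      ext i j
      fin_cases i <;> fin_cases j <;> rfl
    · exact hX.1 2 4 (by decide)
  · rintro _ ⟨A, hA, v, y, hy, rfl⟩
    rw [LieSubalgebra.mem_bot] at hA
    have h := add_mem (d.holNormalizer.smul_mem v d.hMat_v_mem)
      (d.holNormalizer.smul_mem (y 0) d.hMat_e₁_mem)
    simp only [hMat_smul, hMat_add] at h
    convert h using 2
    · simp [hA]
    · simp
    · have hy' : y 1 = 0 := hy
      ext i; fin_cases i <;> simp [hy']

theorem isRealised_of_mem_typeIIIList {h : LieSubalgebra ℝ M7} (hh : h ∈ typeIIIList) :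
    IsRealised h := by
  rcases hh with rfl | rfl | rfl | rfl | rfl | rfl | rfl | rfl
  · exact isRealised_gl
  · exact isRealised_sl
  · exact isRealised_co
  · exact isRealised_diag
  · exact isRealised_line11
  · exact isRealised_line12
  · exact isRealised_zero11
  · exact isRealised_zero12

/-- Metric and base point are kept; conjugation is absorbed into the isometry between the model
space and the tangent space. -/
theorem IsRealised.of_isConjugate {h h₀ : LieSubalgebra ℝ M7} (hr : IsRealised h₀)
    (hc : IsConjugate h h₀) : IsRealised h := by
  obtain ⟨U, g, hU, hS, hg, p, hp, P, hP, hPg, hol⟩ := hr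
  obtain ⟨Q, ⟨hQ, hQd⟩, hQh⟩ := hc
  have hQu : IsUnit Q.det := by rw [hQd]; exact isUnit_one
  have hPu : IsUnit P.det := (Matrix.isUnit_iff_isUnit_det P).1 hP
  have h1 : Q * Q⁻¹ = 1 := Matrix.mul_nonsing_inv Q hQu
  have h2 : Q⁻¹ * Q = 1 := Matrix.nonsing_inv_mul Q hQu
  refine ⟨U, g, hU, hS, hg, p, hp, P * Q⁻¹, ?_, ?_, ?_⟩
  · exact hP.mul ⟨⟨_, _, h2, h1⟩, rfl⟩
  · have h3 : (Q⁻¹)ᵀ * Qᵀ = 1 := by rw [← Matrix.transpose_mul, h1, Matrix.transpose_one]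
    calc (P * Q⁻¹)ᵀ * g p * (P * Q⁻¹) = (Q⁻¹)ᵀ * (Pᵀ * g p * P) * Q⁻¹ := by
          rw [Matrix.transpose_mul]; noncomm_ring
      _ = (Q⁻¹)ᵀ * (Qᵀ * eta * Q) * Q⁻¹ := by rw [hPg, hQ]
      _ = ((Q⁻¹)ᵀ * Qᵀ) * eta * (Q * Q⁻¹) := by simp only [mul_assoc]
      _ = eta := by rw [h3, h1, one_mul, mul_one]
  · have hinv : (P * Q⁻¹)⁻¹ = Q * P⁻¹ := by
      rw [Matrix.mul_inv_rev, Matrix.nonsing_inv_nonsing_inv Q hQu]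
    rw [hol, hinv]
    ext Z
    constructor
    · rintro ⟨X, hX, rfl⟩
      refine ⟨Q * X * Q⁻¹, ?_, ?_⟩
      · have : Q * X * Q⁻¹ ∈ (h : Set M7) := by rw [hQh]; exact ⟨X, hX, rfl⟩
        exact this
      · calc P * X * P⁻¹ = P * (Q⁻¹ * Q) * X * (Q⁻¹ * Q) * P⁻¹ := by rw [h2]; simp
          _ = _ := by noncomm_ring
    · rintro ⟨X, hX, rfl⟩
      have : X ∈ (h : Set M7) := hX
      rw [hQh] at this
      obtain ⟨Y, hY, rfl⟩ := this
      refine ⟨Y, hY, ?_⟩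
      calc P * Q⁻¹ * (Q * Y * Q⁻¹) * (Q * P⁻¹) = P * (Q⁻¹ * Q) * Y * (Q⁻¹ * Q) * P⁻¹ := by
            noncomm_ring
        _ = _ := by rw [h2]; simp

/-! ### Orthogonal complements -/

theorem dotProduct_eta_mulVec (x y : Fin 7 → ℝ) :
    x ⬝ᵥ (eta *ᵥ y) =
      x 0 * y 4 + x 1 * y 5 + x 2 * y 6 - x 3 * y 3 + x 4 * y 0 + x 5 * y 1 + x 6 * y 2 := by
  simp [eta, Matrix.mulVec, dotProduct, Fin.sum_univ_seven]
  ring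

theorem dotProduct_eta_comm (x y : Fin 7 → ℝ) : x ⬝ᵥ (eta *ᵥ y) = y ⬝ᵥ (eta *ᵥ x) := by
  simp only [dotProduct_eta_mulVec]; ring

/-- The inner product of `ℝ^{4,3}` as a bilinear form. -/
def etaForm : LinearMap.BilinForm ℝ (Fin 7 → ℝ) := Matrix.toBilin' eta

theorem etaForm_apply (x y : Fin 7 → ℝ) : etaForm x y = x ⬝ᵥ (eta *ᵥ y) :=
  Matrix.toBilin'_apply' eta x y

/-- The orthogonal complement in `ℝ^{4,3}`. -/
def perp (W : Submodule ℝ (Fin 7 → ℝ)) : Submodule ℝ (Fin 7 → ℝ) := etaForm.orthogonal W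

theorem mem_perp {W : Submodule ℝ (Fin 7 → ℝ)} {x : Fin 7 → ℝ} :
    x ∈ perp W ↔ ∀ w ∈ W, x ⬝ᵥ (eta *ᵥ w) = 0 := by
  refine forall₂_congr fun w _ => ?_
  rw [etaForm_apply, dotProduct_eta_comm]

theorem etaForm_isRefl : etaForm.IsRefl := by
  intro x y h
  rw [etaForm_apply] at h ⊢
  rw [dotProduct_eta_comm, h]

theorem etaForm_nondegenerate : etaForm.Nondegenerate :=
  LinearMap.BilinForm.nondegenerate_toBilin'_of_det_ne_zero' eta (by
    have h : eta.det * eta.det = 1 := by rw [← Matrix.det_mul, eta_mul_eta, Matrix.det_one]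
    intro h0
    simp [h0] at h)

theorem eq_zero_of_forall_dotProduct_eta {x : Fin 7 → ℝ} (h : ∀ y, x ⬝ᵥ (eta *ᵥ y) = 0) :
    x = 0 := by
  have key := fun i => h (Pi.single i 1)
  simp only [dotProduct_eta_mulVec] at key
  ext i
  fin_cases i
  · simpa using key 4
  · simpa using key 5
  · simpa using key 6
  · simpa using key 3
  · simpa using key 0
  · simpa using key 1
  · simpa using key 2

theorem perp_perp (W : Submodule ℝ (Fin 7 → ℝ)) : perp (perp W) = W :=
  LinearMap.BilinForm.orthogonal_orthogonal etaForm_nondegenerate etaForm_isRefl W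

theorem isCompl_perp {W : Submodule ℝ (Fin 7 → ℝ)} (hW : IsNondegenerate W) :
    IsCompl W (perp W) := by
  refine LinearMap.BilinForm.isCompl_orthogonal_of_restrict_nondegenerate etaForm_isRefl
    (LinearMap.BilinForm.nondegenerate_restrict_of_disjoint_orthogonal _ etaForm_isRefl ?_)
  rw [Submodule.disjoint_def]
  exact fun x hx hx' => hW x hx (mem_perp.1 hx')

theorem IsNondegenerate.perp {W : Submodule ℝ (Fin 7 → ℝ)} (hW : IsNondegenerate W) :
    IsNondegenerate (perp W) := by
  intro x hx h
  have : x ∈ W := by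
    rw [← perp_perp W]
    exact mem_perp.2 h
  exact hW x this (mem_perp.1 hx)

theorem dotProduct_eta_skew {X : M7} (hX : Xᵀ * eta + eta * X = 0) (x y : Fin 7 → ℝ) :
    (X *ᵥ x) ⬝ᵥ (eta *ᵥ y) = -(x ⬝ᵥ (eta *ᵥ (X *ᵥ y))) := by
  have h : x ⬝ᵥ ((Xᵀ * eta + eta * X) *ᵥ y) = 0 := by rw [hX]; simp
  rw [Matrix.add_mulVec, dotProduct_add, ← Matrix.mulVec_mulVec, ← Matrix.mulVec_mulVec,
    Matrix.dotProduct_mulVec x Xᵀ, Matrix.vecMul_transpose] at h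
  linarith

theorem IsInvariant.perp {h : LieSubalgebra ℝ M7} (hg : h ≤ g2Star)
    {W : Submodule ℝ (Fin 7 → ℝ)} (hW : IsInvariant h W) : IsInvariant h (perp W) := by
  intro X hX x hx
  rw [mem_perp] at hx ⊢
  intro w hw
  rw [dotProduct_eta_skew (skew_of_mem_g2Star (hg hX)), hx _ (hW X hX w hw), neg_zero]

/-! ### Each of the eight algebras is a possible holonomy algebra -/

theorem IsIndecomposable.mono {h h' : LieSubalgebra ℝ M7} (hle : h ≤ h')
    (hh : IsIndecomposable h) : IsIndecomposable h' :=
  fun W hW hn => hh W (fun X hX => hW X (hle hX)) hn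

theorem zeroSemi11_le_g2Star : zeroSemi11 ≤ g2Star := by
  rintro _ ⟨A, -, v, y, -, rfl⟩
  exact hMat_mem_g2Star A v y

theorem hMat_mem_zeroSemi11 (v a : ℝ) : hMat 0 v ![a, 0] ∈ zeroSemi11 :=
  ⟨0, zero_mem _, v, _, rfl, rfl⟩

/-- Applying h(0, 1, 0) twice to `w` puts b₁ into `W`, and h(0, 0, (1, 0)) then puts b₂ there. Hence
u ∈ W^⊥ has vanishing entries 4 and 5, so h(0, 1, 0) maps u into W ∩ W^⊥ = 0, which kills the
entries 3 and 6. Thus W^⊥ lies in the isotropic span of b₁, b₂, b₃ while being non-degenerate. -/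
theorem perp_eq_bot_of_apply_four_ne_zero {W : Submodule ℝ (Fin 7 → ℝ)}
    (hW : IsInvariant zeroSemi11 W) (hn : IsNondegenerate W) {w : Fin 7 → ℝ} (hw : w ∈ W)
    (h4 : w 4 ≠ 0) : perp W = ⊥ := by
  have s2 : √2 * √2 = 2 := Real.mul_self_sqrt (by norm_num)
  have hX := hW _ (hMat_mem_zeroSemi11 1 0)
  have hY := hW _ (hMat_mem_zeroSemi11 0 1)
  have e0 : (Pi.single 0 1 : Fin 7 → ℝ) ∈ W := by
    have := W.smul_mem (1 / (2 * w 4)) (hX _ (hX w hw))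
    convert this using 1
    ext i
    fin_cases i <;> simp [hMat_mulVec]
    field_simp
    linear_combination -s2
  have e1 : (Pi.single 1 1 : Fin 7 → ℝ) ∈ W := by
    have := W.add_mem (W.smul_mem (1 / w 4) (hY _ hw)) (W.smul_mem (w 5 / w 4) e0)
    convert this using 1
    ext i
    fin_cases i <;> simp [hMat_mulVec]
    · field_simp; simp
    · field_simp
  have hc := isCompl_perp hn
  have hWp := hW.perp zeroSemi11_le_g2Star
  have vanish : ∀ u ∈ perp W, u 3 = 0 ∧ u 4 = 0 ∧ u 5 = 0 ∧ u 6 = 0 := by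
    intro u hu
    have h4 : u 4 = 0 := by
      have := mem_perp.1 hu _ e0
      rw [dotProduct_eta_mulVec] at this
      simpa using this
    have h5 : u 5 = 0 := by
      have := mem_perp.1 hu _ e1
      rw [dotProduct_eta_mulVec] at this
      simpa using this
    have hXu := hWp _ (hMat_mem_zeroSemi11 1 0) u hu
    have hXu' : hMat 0 1 ![0, 0] *ᵥ u ∈ W := by
      have := W.add_mem (W.smul_mem (√2 * u 3) e0) (W.smul_mem (u 6) e1)
      convert this using 1
      ext i
      fin_cases i <;> simp [hMat_mulVec, h4, h5]
    have hz := Submodule.disjoint_def.1 hc.disjoint _ hXu' hXu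
    have z0 := congrFun hz 0
    have z1 := congrFun hz 1
    simp [hMat_mulVec] at z0 z1
    exact ⟨z0, h4, h5, z1⟩
  rw [eq_bot_iff]
  intro u hu
  rw [Submodule.mem_bot]
  refine eq_zero_of_forall_dotProduct_eta fun y => ?_
  obtain ⟨a, ha, b, hb, rfl⟩ := Submodule.mem_sup.1
    (show y ∈ W ⊔ perp W by rw [hc.sup_eq_top]; trivial)
  rw [Matrix.mulVec_add, dotProduct_add, mem_perp.1 hu a ha, zero_add, dotProduct_eta_mulVec]
  obtain ⟨b3, b4, b5, b6⟩ := vanish b hb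
  obtain ⟨u3, u4, u5, u6⟩ := vanish u hu
  simp [b3, b4, b5, b6, u3, u4, u5, u6]

/-- Decomposing b₅ along W ⊕ W^⊥, one of the two components has a non-zero entry 4, and the other
summand vanishes. The remaining seven algebras contain this one and inherit indecomposability. -/
theorem isIndecomposable_zeroSemi11 : IsIndecomposable zeroSemi11 := by
  intro W hW hn
  have hc := isCompl_perp hn
  obtain ⟨a, ha, b, hb, hab⟩ := Submodule.mem_sup.1
    (show (Pi.single 4 1 : Fin 7 → ℝ) ∈ W ⊔ perp W by rw [hc.sup_eq_top]; trivial)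
  have h4 := congrFun hab 4
  simp only [Pi.add_apply, Pi.single_eq_same] at h4
  by_cases ha4 : a 4 = 0
  · left
    have := perp_eq_bot_of_apply_four_ne_zero (hW.perp zeroSemi11_le_g2Star) hn.perp hb
      (by rw [ha4, zero_add] at h4; simp [h4])
    rwa [perp_perp] at this
  · right
    have := perp_eq_bot_of_apply_four_ne_zero hW hn ha ha4
    have h := hc.sup_eq_top
    rwa [this, sup_bot_eq] at h

/-! ### The socle of the eight algebras -/

/-- The span of `b₁, b₂, b₃`. -/
def nullSpace : Submodule ℝ (Fin 7 → ℝ) :=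
  Submodule.span ℝ (Set.range fun i : Fin 3 => (Pi.single (i.castLE (by norm_num)) 1 : Fin 7 → ℝ))

theorem finrank_nullSpace : Module.finrank ℝ nullSpace = 3 := by
  have h : LinearIndependent ℝ
      (fun i : Fin 3 => (Pi.single (i.castLE (by norm_num)) 1 : Fin 7 → ℝ)) := by
    have := (Pi.basisFun ℝ (Fin 7)).linearIndependent.comp
      (fun i : Fin 3 => i.castLE (by norm_num : 3 ≤ 7)) (Fin.castLE_injective (by norm_num))
    simpa [Function.comp_def] using this
  rw [nullSpace, finrank_span_eq_card h, Fintype.card_fin]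

theorem mem_nullSpace {x : Fin 7 → ℝ} (h3 : x 3 = 0) (h4 : x 4 = 0) (h5 : x 5 = 0)
    (h6 : x 6 = 0) : x ∈ nullSpace := by
  have hb : ∀ i : Fin 3, (Pi.single (i.castLE (by norm_num)) 1 : Fin 7 → ℝ) ∈ nullSpace :=
    fun i => Submodule.subset_span ⟨i, rfl⟩
  have := add_mem (add_mem (nullSpace.smul_mem (x 0) (hb 0)) (nullSpace.smul_mem (x 1) (hb 1)))
    (nullSpace.smul_mem (x 2) (hb 2))
  convert this using 1
  ext i
  fin_cases i <;> simp [h3, h4, h5, h6, Pi.single_apply]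

theorem nullSpace_le {W : Submodule ℝ (Fin 7 → ℝ)} (h0 : (Pi.single 0 1 : Fin 7 → ℝ) ∈ W)
    (h1 : (Pi.single 1 1 : Fin 7 → ℝ) ∈ W) (h2 : (Pi.single 2 1 : Fin 7 → ℝ) ∈ W) :
    nullSpace ≤ W := by
  refine Submodule.span_le.2 ?_
  rintro _ ⟨i, rfl⟩
  fin_cases i
  · exact h0
  · exact h1
  · exact h2

theorem isIrreducibleSub_span_singleton {h : LieSubalgebra ℝ M7} {x : Fin 7 → ℝ} (hx : x ≠ 0)
    (hh : ∀ X ∈ h, ∃ c : ℝ, X *ᵥ x = c • x) : IsIrreducibleSub h (Submodule.span ℝ {x}) := by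
  have ha := nonzero_span_atom (K := ℝ) x hx
  refine ⟨?_, ha.1, fun W' hW' _ => (ha.le_iff.1 hW')⟩
  intro X hX w hw
  obtain ⟨a, rfl⟩ := Submodule.mem_span_singleton.1 hw
  obtain ⟨c, hc⟩ := hh X hX
  rw [Matrix.mulVec_smul, hc]
  exact Submodule.smul_mem _ _ (Submodule.smul_mem _ _ (Submodule.mem_span_singleton_self x))

/-- The bracket of h(A, v, y) with h(0, 1, 0) is (tr A) h(0, 1, 0), so the kernel of h(0, 1, 0) is
invariant. An irreducible subspace meets it in zero or lies in it; the former is impossible, since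
h(0, 1, 0) is nilpotent. The kernel lies in the span of b₁, b₂, b₃. -/
theorem socle_le_nullSpace {h : LieSubalgebra ℝ M7} (hr : ∀ X ∈ h, ∃ A v y, X = hMat A v y)
    (hv : hMat 0 1 0 ∈ h) : socle h ≤ nullSpace := by
  refine sSup_le fun W hW => ?_
  obtain ⟨hi, hb, hm⟩ := hW
  let W' : Submodule ℝ (Fin 7 → ℝ) := W ⊓ (LinearMap.ker (hMat 0 1 0).mulVecLin)
  have hmem : ∀ w, w ∈ W' ↔ w ∈ W ∧ hMat 0 1 0 *ᵥ w = 0 := fun w => Iff.rfl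
  have hi' : IsInvariant h W' := by
    intro X hX w hw
    obtain ⟨A, v, y, rfl⟩ := hr X hX
    rw [hmem] at hw ⊢
    refine ⟨hi _ hX w hw.1, ?_⟩
    have h1 := hMat_lie A 0 v 1 y 0
    have h2 : hMat ⁅A, (0 : M2)⁆ (A.trace * 1 - v * (0 : M2).trace)
        ((A *ᵥ 0 + A.trace • 0) - ((0 : M2) *ᵥ y + (0 : M2).trace • y)) =
        A.trace • hMat 0 1 0 := by
      rw [hMat_smul]; congr 1 <;> simp
    rw [h2] at h1
    have h3 := congrArg (· *ᵥ w) h1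
    simpa only [Ring.lie_def, Matrix.sub_mulVec, ← Matrix.mulVec_mulVec, hw.2,
      Matrix.smul_mulVec, Matrix.mulVec_zero, smul_zero, zero_sub, neg_eq_zero] using h3
  have hker : ∀ w ∈ W', w ∈ nullSpace := by
    intro w hw
    have hw := ((hmem w).1 hw).2
    have z0 := congrFun hw 0
    have z1 := congrFun hw 1
    have z2 := congrFun hw 2
    have z3 := congrFun hw 3
    simp [hMat_mulVec] at z0 z1 z2 z3
    exact mem_nullSpace z0 z3 z2 z1
  rcases hm W' inf_le_left hi' with h0 | h0
  · exfalso
    have hinj : ∀ w ∈ W, hMat 0 1 0 *ᵥ w = 0 → w = 0 := by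
      intro w hw hw'
      have : w ∈ W' := ⟨hw, hw'⟩
      rw [h0] at this
      exact this
    refine hb (eq_bot_iff.2 fun w hw => ?_)
    have hw1 := hi _ hv w hw
    have hw2 := hi _ hv _ hw1
    refine hinj w hw (hinj _ hw1 (hinj _ hw2 ?_))
    ext i
    fin_cases i <;> simp [hMat_mulVec]
  · rw [← h0]
    exact hker

theorem nullSpace_le_socle_of_diagonal {h : LieSubalgebra ℝ M7}
    (hr : ∀ X ∈ h, ∃ A v y, A 0 1 = 0 ∧ A 1 0 = 0 ∧ X = hMat A v y) : nullSpace ≤ socle h := by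
  have key : ∀ i : Fin 7, (∀ A : M2, A 0 1 = 0 → A 1 0 = 0 → ∀ v y, ∃ c : ℝ,
      hMat A v y *ᵥ (Pi.single i 1 : Fin 7 → ℝ) = c • (Pi.single i 1 : Fin 7 → ℝ)) →
      (Pi.single i 1 : Fin 7 → ℝ) ∈ socle h := by
    intro i hi
    refine (le_sSup (a := Submodule.span ℝ {(Pi.single i 1 : Fin 7 → ℝ)})
      (isIrreducibleSub_span_singleton ?_ ?_)) (Submodule.mem_span_singleton_self _)
    · simp
    · intro X hX
      obtain ⟨A, v, y, h1, h2, rfl⟩ := hr X hX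
      exact hi A h1 h2 v y
  refine nullSpace_le (key 0 ?_) (key 1 ?_) (key 2 ?_)
  · intro A h1 h2 v y
    refine ⟨A.trace, ?_⟩
    rw [hMat_mulVec]
    ext i
    fin_cases i <;> simp [hMat_mulVec]
  · intro A h1 h2 v y
    refine ⟨A 0 0, ?_⟩
    rw [hMat_mulVec]
    ext i
    fin_cases i <;> simp [hMat_mulVec, h2]
  · intro A h1 h2 v y
    refine ⟨A 1 1, ?_⟩
    rw [hMat_mulVec]
    ext i
    fin_cases i <;> simp [hMat_mulVec, h1]

theorem nullSpace_le_socle_of_rotation {h : LieSubalgebra ℝ M7}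
    (hr : ∀ X ∈ h, ∃ A v y, X = hMat A v y) (hJ : hMat !![0, -1; 1, 0] 0 0 ∈ h) :
    nullSpace ≤ socle h := by
  have h0 : (Pi.single 0 1 : Fin 7 → ℝ) ∈ socle h := by
    refine (le_sSup (a := Submodule.span ℝ {(Pi.single 0 1 : Fin 7 → ℝ)})
      (isIrreducibleSub_span_singleton ?_ ?_)) (Submodule.mem_span_singleton_self _)
    · simp
    · intro X hX
      obtain ⟨A, v, y, rfl⟩ := hr X hX
      refine ⟨A.trace, ?_⟩
      rw [hMat_mulVec]
      ext i
      fin_cases i <;> simp [hMat_mulVec]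
  let P : Submodule ℝ (Fin 7 → ℝ) :=
    Submodule.span ℝ {(Pi.single 1 1 : Fin 7 → ℝ), (Pi.single 2 1 : Fin 7 → ℝ)}
  have hP1 : (Pi.single 1 1 : Fin 7 → ℝ) ∈ P := Submodule.subset_span (by simp)
  have hP2 : (Pi.single 2 1 : Fin 7 → ℝ) ∈ P := Submodule.subset_span (by simp)
  have hP : P ≤ socle h := by
    refine le_sSup ⟨?_, ?_, ?_⟩
    · intro X hX w hw
      obtain ⟨A, v, y, rfl⟩ := hr X hX
      obtain ⟨a, b, rfl⟩ := Submodule.mem_span_pair.1 hw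
      have := P.add_mem (P.smul_mem (A 0 0 * a + A 0 1 * b) hP1)
        (P.smul_mem (A 1 0 * a + A 1 1 * b) hP2)
      convert this using 1
      ext i
      fin_cases i <;> simp [hMat_mulVec]
    · intro hb
      rw [hb, Submodule.mem_bot] at hP1
      simp at hP1
    · intro W' hle hi
      refine or_iff_not_imp_left.2 fun hb => le_antisymm hle ?_
      obtain ⟨w, hw, hw0⟩ := W'.ne_bot_iff.1 hb
      obtain ⟨a, b, rfl⟩ := Submodule.mem_span_pair.1 (hle hw)
      have hab : a ^ 2 + b ^ 2 ≠ 0 := by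
        intro h
        have ha : a = 0 := by nlinarith
        have hb : b = 0 := by nlinarith
        exact hw0 (by simp [ha, hb])
      have hJw := hi _ hJ _ hw
      -- For w = a b₂ + b b₃ and the rotation J, the vectors a w - b J w and b w + a J w are (a² +
      -- b²) b₂ and (a² + b²) b₃.
      have e1 := W'.smul_mem (1 / (a ^ 2 + b ^ 2))
        (W'.sub_mem (W'.smul_mem a hw) (W'.smul_mem b hJw))
      have e2 := W'.smul_mem (1 / (a ^ 2 + b ^ 2))
        (W'.add_mem (W'.smul_mem b hw) (W'.smul_mem a hJw))
      refine Submodule.span_le.2 ?_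
      rintro _ (rfl | rfl)
      · convert (show _ ∈ (W' : Set _) from e1) using 1
        rw [hMat_mulVec]
        ext i
        fin_cases i <;> simp [Matrix.trace_fin_two, Matrix.vecHead, Matrix.vecTail]
        all_goals first | (right; ring) | (field_simp; ring) | field_simp
      · convert (show _ ∈ (W' : Set _) from e2) using 1
        rw [hMat_mulVec]
        ext i
        fin_cases i <;> simp [Matrix.trace_fin_two, Matrix.vecHead, Matrix.vecTail]
        all_goals first | (right; ring) | (field_simp; ring) | field_simp
  exact nullSpace_le h0 (hP hP1) (hP hP2)

/-! ### Berger's criterion for the eight algebras -/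

/-- The second row of `A₁` is the first row of `A₂`. -/
def IsCurvaturePair (A₁ A₂ : M2) : Prop := A₁ 1 0 = A₂ 0 0 ∧ A₁ 1 1 = A₂ 0 1

/-- A family of algebraic curvature endomorphisms with values in the matrices `h(A, v, y)`. -/
def curvatureMap (A₁ A₂ : M2) (v₁ v₂ y₁₁ y₁₂ y₂₂ : ℝ) :
    (Fin 7 → ℝ) →ₗ[ℝ] (Fin 7 → ℝ) →ₗ[ℝ] M7 :=
  LinearMap.mk₂ ℝ (fun x y =>
    hMat ((x 4 * y 5 - x 5 * y 4) • A₁ + (x 4 * y 6 - x 6 * y 4) • A₂)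
      ((x 4 * y 5 - x 5 * y 4) * v₁ + (x 4 * y 6 - x 6 * y 4) * v₂)
      (fun i =>
        -((x 4 * y 0 - x 0 * y 4) * (![A₁, A₂] i).trace + (x 5 * y 1 - x 1 * y 5) * ![A₁, A₂] i 0 0
          + (x 5 * y 2 - x 2 * y 5) * ![A₁, A₂] i 0 1 + (x 6 * y 1 - x 1 * y 6) * ![A₁, A₂] i 1 0
          + (x 6 * y 2 - x 2 * y 6) * ![A₁, A₂] i 1 1)
        - (√2 * (x 4 * y 3 - x 3 * y 4) + (x 5 * y 6 - x 6 * y 5)) * ![v₁, v₂] i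
        + (x 4 * y 5 - x 5 * y 4) * ![y₁₁, y₁₂] i + (x 4 * y 6 - x 6 * y 4) * ![y₁₂, y₂₂] i))
    (by
      intro x x' y
      rw [hMat_add]
      congr 1
      · ext i j; simp; ring
      · simp; ring
      · ext i; simp; ring)
    (by
      intro c x y
      rw [hMat_smul]
      congr 1
      · ext i j; simp; ring
      · simp; ring
      · ext i; simp; ring)
    (by
      intro x y y'
      rw [hMat_add]
      congr 1
      · ext i j; simp; ring
      · simp; ring
      · ext i; simp; ring)
    (by
      intro c x y
      rw [hMat_smul]
      congr 1
      · ext i j; simp; ring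
      · simp; ring
      · ext i; simp; ring)

theorem curvatureMap_apply (A₁ A₂ : M2) (v₁ v₂ y₁₁ y₁₂ y₂₂ : ℝ) (x y : Fin 7 → ℝ) :
    ∃ v z, curvatureMap A₁ A₂ v₁ v₂ y₁₁ y₁₂ y₂₂ x y =
      hMat ((x 4 * y 5 - x 5 * y 4) • A₁ + (x 4 * y 6 - x 6 * y 4) • A₂) v z ∧
      (A₂ = 0 → v₂ = 0 → y₁₂ = 0 → y₂₂ = 0 → z ∈ lineY) := by
  rw [curvatureMap, LinearMap.mk₂_apply]
  refine ⟨_, _, rfl, ?_⟩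
  rintro rfl rfl rfl rfl
  change _ = (0 : ℝ)
  simp

/-- Given the shape of the family, the Bianchi identity reduces to the compatibility of the rows of
A₁ and A₂. This is the part of the general solution with p = q = r = s = t = 0 (see
`CurvatureData`), which suffices for all eight algebras. -/
theorem curvatureMap_mem {h : LieSubalgebra ℝ M7} {A₁ A₂ : M2} (hA : IsCurvaturePair A₁ A₂)
    (v₁ v₂ y₁₁ y₁₂ y₂₂ : ℝ) (hh : ∀ x y, curvatureMap A₁ A₂ v₁ v₂ y₁₁ y₁₂ y₂₂ x y ∈ h) :
    curvatureMap A₁ A₂ v₁ v₂ y₁₁ y₁₂ y₂₂ ∈ curvatureSpace h := by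
  refine ⟨fun x => ?_, hh, fun x y z => ?_⟩
  · simp only [curvatureMap, LinearMap.mk₂_apply]
    rw [← WaveData.hMat_zero]
    congr 1
    · ext i j; simp [mul_comm]
    · simp [mul_comm]
    · ext i; simp [mul_comm]
  · obtain ⟨h1, h2⟩ := hA
    simp only [curvatureMap, LinearMap.mk₂_apply, hMat_mulVec]
    ext i
    fin_cases i <;>
      simp only [Matrix.trace_fin_two, Pi.add_apply, Matrix.add_apply, Matrix.smul_apply,
        smul_eq_mul, Fin.zero_eta, Fin.mk_one, Fin.reduceFinMk, Matrix.cons_val, Pi.zero_apply, h1,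
        h2] <;>
      ring

theorem curvatureMap_single₁ (A₁ A₂ : M2) (v₁ v₂ y₁₁ y₁₂ y₂₂ : ℝ) :
    curvatureMap A₁ A₂ v₁ v₂ y₁₁ y₁₂ y₂₂ (Pi.single 4 1) (Pi.single 5 1) =
      hMat A₁ v₁ ![y₁₁, y₁₂] := by
  simp only [curvatureMap, LinearMap.mk₂_apply]
  congr 1
  · simp
  · simp
  · ext i; fin_cases i <;> simp

theorem curvatureMap_single₂ (A₁ A₂ : M2) (v₁ v₂ y₁₁ y₁₂ y₂₂ : ℝ) :
    curvatureMap A₁ A₂ v₁ v₂ y₁₁ y₁₂ y₂₂ (Pi.single 4 1) (Pi.single 6 1) =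
      hMat A₂ v₂ ![y₁₂, y₂₂] := by
  simp only [curvatureMap, LinearMap.mk₂_apply]
  congr 1
  · simp
  · simp
  · ext i; fin_cases i <;> simp

/-- The span of the values of all algebraic curvature endomorphisms. -/
def curvatureSpan (h : LieSubalgebra ℝ M7) : Submodule ℝ M7 :=
  Submodule.span ℝ {X | ∃ R ∈ curvatureSpace h, ∃ x y, X = R x y}

theorem isBerger_of_le {h : LieSubalgebra ℝ M7} (hh : ∀ X ∈ h, X ∈ curvatureSpan h) :
    IsBerger h := by
  refine le_antisymm hh (Submodule.span_le.2 ?_)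
  rintro _ ⟨R, hR, x, y, rfl⟩
  exact hR.2.1 x y

theorem isCurvaturePair_zero : IsCurvaturePair 0 0 := ⟨rfl, rfl⟩

theorem curvatureMap_mem_semi12 {a : LieSubalgebra ℝ M2} {A₁ A₂ : M2} (h1 : A₁ ∈ a) (h2 : A₂ ∈ a)
    (hA : IsCurvaturePair A₁ A₂) (v₁ v₂ y₁₁ y₁₂ y₂₂ : ℝ) :
    curvatureMap A₁ A₂ v₁ v₂ y₁₁ y₁₂ y₂₂ ∈ curvatureSpace (semi12 a) :=
  curvatureMap_mem hA _ _ _ _ _ fun x y => by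
    obtain ⟨v, z, e, -⟩ := curvatureMap_apply A₁ A₂ v₁ v₂ y₁₁ y₁₂ y₂₂ x y
    rw [e]
    exact mem_semi12 (add_mem (a.smul_mem _ h1) (a.smul_mem _ h2)) _ _

/-- The elements h(0, v, y) come from curvature endomorphisms with A₁ = A₂ = 0, so only the linear
part imposes a condition. -/
theorem isBerger_semi12 {a : LieSubalgebra ℝ M2}
    (ha : ∀ A ∈ a, A ∈ Submodule.span ℝ
      {A | ∃ A₁ ∈ a, ∃ A₂ ∈ a, IsCurvaturePair A₁ A₂ ∧ (A = A₁ ∨ A = A₂)}) :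
    IsBerger (semi12 a) := by
  have h0 := zero_mem a
  have hv : hMat 0 1 0 ∈ curvatureSpan (semi12 a) :=
    Submodule.subset_span ⟨_, curvatureMap_mem_semi12 h0 h0 isCurvaturePair_zero 1 0 0 0 0, _, _, by
      rw [curvatureMap_single₁]
      congr 1
      ext i; fin_cases i <;> simp⟩
  have he1 : hMat 0 0 ![1, 0] ∈ curvatureSpan (semi12 a) :=
    Submodule.subset_span ⟨_, curvatureMap_mem_semi12 h0 h0 isCurvaturePair_zero 0 0 1 0 0, _, _,
      (curvatureMap_single₁ ..).symm⟩
  have he2 : hMat 0 0 ![0, 1] ∈ curvatureSpan (semi12 a) :=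
    Submodule.subset_span ⟨_, curvatureMap_mem_semi12 h0 h0 isCurvaturePair_zero 0 0 0 0 1, _, _,
      (curvatureMap_single₂ ..).symm⟩
  have hA : ∀ A ∈ a, hMat A 0 0 ∈ curvatureSpan (semi12 a) := by
    intro A hA
    refine Submodule.span_induction (p := fun A _ => hMat A 0 0 ∈ curvatureSpan (semi12 a))
      ?_ ?_ ?_ ?_ (ha A hA)
    · have e : (0 : Fin 2 → ℝ) = ![0, 0] := by ext i; fin_cases i <;> rfl
      rintro A ⟨A₁, h1, A₂, h2, hp, rfl | rfl⟩
      · rw [e]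
        exact Submodule.subset_span ⟨_, curvatureMap_mem_semi12 h1 h2 hp 0 0 0 0 0, _, _,
          (curvatureMap_single₁ ..).symm⟩
      · rw [e]
        exact Submodule.subset_span ⟨_, curvatureMap_mem_semi12 h1 h2 hp 0 0 0 0 0, _, _,
          (curvatureMap_single₂ ..).symm⟩
    · rw [WaveData.hMat_zero]; exact zero_mem _
    · intro A B _ _ hA hB
      have := add_mem hA hB
      rw [hMat_add] at this
      simpa using this
    · intro c A _ hA
      have := Submodule.smul_mem _ c hA
      rw [hMat_smul] at this
      simpa using this
  refine isBerger_of_le ?_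
  rintro _ ⟨A, hAa, v, y, -, rfl⟩
  have h := add_mem (add_mem (hA A hAa) (Submodule.smul_mem _ v hv))
    (add_mem (Submodule.smul_mem _ (y 0) he1) (Submodule.smul_mem _ (y 1) he2))
  simp only [hMat_smul, hMat_add] at h
  convert h using 2
  · simp
  · simp
  · ext i; fin_cases i <;> simp

/-- Each element is itself the value at (b₅, b₆) of a single curvature endomorphism with A₂ = 0; the
vanishing second row of A is the compatibility condition. -/
theorem isBerger_semidirect_lineY {a : LieSubalgebra ℝ M2}
    {hY : ∀ A ∈ a, ∀ y ∈ lineY, A *ᵥ y ∈ lineY} (ha : ∀ A ∈ a, A 1 0 = 0 ∧ A 1 1 = 0) :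
    IsBerger (semidirect a lineY hY) := by
  refine isBerger_of_le ?_
  rintro _ ⟨A, hA, v, y, hy, rfl⟩
  refine Submodule.subset_span ⟨curvatureMap A 0 v 0 (y 0) 0 0, curvatureMap_mem ?_ _ _ _ _ _
    fun x x' => ?_, Pi.single 4 1, Pi.single 5 1, ?_⟩
  · exact ha A hA
  · obtain ⟨v, z, e, hz⟩ := curvatureMap_apply A 0 v 0 (y 0) 0 0 x x'
    rw [e]
    exact ⟨_, add_mem (a.smul_mem _ hA) (a.smul_mem _ (zero_mem a)), _, _, hz rfl rfl rfl rfl, rfl⟩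
  · rw [curvatureMap_single₁]
    congr 1
    have hy' : y 1 = 0 := hy
    ext i; fin_cases i <;> simp [hy']

theorem isPossibleTypeIII_semi12 {a : LieSubalgebra ℝ M2} (hb : IsBerger (semi12 a))
    (hs : nullSpace ≤ socle (semi12 a)) : IsPossibleTypeIII (semi12 a) where
  le_g2Star := by
    rintro _ ⟨A, -, v, y, -, rfl⟩
    exact hMat_mem_g2Star A v y
  indecomposable := isIndecomposable_zeroSemi11.mono (by
    rintro _ ⟨A, hA, v, y, -, rfl⟩
    rw [LieSubalgebra.mem_bot] at hA
    exact ⟨A, hA ▸ zero_mem a, v, y, trivial, rfl⟩)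
  berger := hb
  finrank_socle := by
    rw [le_antisymm (socle_le_nullSpace ?_ (mem_semi12 (zero_mem a) _ _)) hs, finrank_nullSpace]
    rintro _ ⟨A, hA, v, y, -, rfl⟩
    exact ⟨A, v, y, rfl⟩

theorem isPossibleTypeIII_semidirect_lineY {a : LieSubalgebra ℝ M2}
    {hY : ∀ A ∈ a, ∀ y ∈ lineY, A *ᵥ y ∈ lineY}
    (ha : ∀ A ∈ a, A 0 1 = 0 ∧ A 1 0 = 0 ∧ A 1 1 = 0) :
    IsPossibleTypeIII (semidirect a lineY hY) where
  le_g2Star := by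
    rintro _ ⟨A, -, v, y, -, rfl⟩
    exact hMat_mem_g2Star A v y
  indecomposable := isIndecomposable_zeroSemi11.mono (by
    rintro _ ⟨A, hA, v, y, hy, rfl⟩
    rw [LieSubalgebra.mem_bot] at hA
    exact ⟨A, hA ▸ zero_mem a, v, y, hy, rfl⟩)
  berger := isBerger_semidirect_lineY fun A hA => (ha A hA).2
  finrank_socle := by
    have hv : hMat 0 1 0 ∈ semidirect a lineY hY := ⟨0, zero_mem a, 1, 0, zero_mem _, rfl⟩
    rw [le_antisymm (socle_le_nullSpace ?_ hv)
      (nullSpace_le_socle_of_diagonal ?_), finrank_nullSpace]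
    · rintro _ ⟨A, hA, v, y, -, rfl⟩
      exact ⟨A, v, y, rfl⟩
    · rintro _ ⟨A, hA, v, y, -, rfl⟩
      exact ⟨A, v, y, (ha A hA).1, (ha A hA).2.1, rfl⟩

theorem isPossibleTypeIII_semi12_of_diagonal {a : LieSubalgebra ℝ M2} (hb : IsBerger (semi12 a))
    (ha : ∀ A ∈ a, A 0 1 = 0 ∧ A 1 0 = 0) : IsPossibleTypeIII (semi12 a) := by
  refine isPossibleTypeIII_semi12 hb (nullSpace_le_socle_of_diagonal ?_)
  rintro _ ⟨A, hA, v, y, -, rfl⟩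
  exact ⟨A, v, y, (ha A hA).1, (ha A hA).2, rfl⟩

theorem isPossibleTypeIII_semi12_of_rotation {a : LieSubalgebra ℝ M2} (hb : IsBerger (semi12 a))
    (ha : !![0, -1; 1, 0] ∈ a) : IsPossibleTypeIII (semi12 a) := by
  refine isPossibleTypeIII_semi12 hb (nullSpace_le_socle_of_rotation ?_ (mem_semi12 ha _ _))
  rintro _ ⟨A, hA, v, y, -, rfl⟩
  exact ⟨A, v, y, rfl⟩

theorem isPossibleTypeIII_gl : IsPossibleTypeIII (semi12 ⊤) := by
  refine isPossibleTypeIII_semi12_of_rotation (isBerger_semi12 fun A _ => ?_)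
    (LieSubalgebra.mem_top _)
  -- A matrix with zero second row can be A₁ with A₂ = 0, and one with zero first row can be A₂ with
  -- A₁ = 0.
  have e : A = !![A 0 0, A 0 1; 0, 0] + !![0, 0; A 1 0, A 1 1] := by
    ext i j; fin_cases i <;> fin_cases j <;> simp
  rw [e]
  refine add_mem (Submodule.subset_span ⟨_, LieSubalgebra.mem_top _, 0, LieSubalgebra.mem_top _,
    ?_, Or.inl rfl⟩) (Submodule.subset_span ⟨0, LieSubalgebra.mem_top _, _,
    LieSubalgebra.mem_top _, ?_, Or.inr rfl⟩)
  · constructor <;> simp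
  · constructor <;> simp

theorem mem_sl_iff {A : M2} : A ∈ LieAlgebra.SpecialLinear.sl (Fin 2) ℝ ↔ A 0 0 + A 1 1 = 0 := by
  rw [← Matrix.trace_fin_two]
  exact Iff.rfl

theorem isPossibleTypeIII_sl : IsPossibleTypeIII (semi12 (LieAlgebra.SpecialLinear.sl (Fin 2) ℝ))
    := by
  refine isPossibleTypeIII_semi12_of_rotation (isBerger_semi12 fun A hA => ?_)
    (by rw [mem_sl_iff]; simp)
  rw [mem_sl_iff] at hA
  -- Both summands must have trace zero, so the upper triangular one keeps its second row; it is
  -- compatible with A₂ = A 1 1 E₁₂.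
  have e : A = !![A 0 0, A 0 1; 0, A 1 1] + !![0, 0; A 1 0, 0] := by
    ext i j; fin_cases i <;> fin_cases j <;> simp
  rw [e]
  refine add_mem (Submodule.subset_span ⟨_, ?_, !![0, A 1 1; 0, 0], ?_, ?_, Or.inl rfl⟩)
    (Submodule.subset_span ⟨0, zero_mem _, _, ?_, ?_, Or.inr rfl⟩)
  · rw [mem_sl_iff]; simpa using hA
  · rw [mem_sl_iff]; simp
  · constructor <;> simp
  · rw [mem_sl_iff]; simp
  · constructor <;> simp

theorem isPossibleTypeIII_co : IsPossibleTypeIII (semi12 co2) := by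
  refine isPossibleTypeIII_semi12_of_rotation (isBerger_semi12 fun A hA => ?_)
    (show _ ∧ _ by simp)
  obtain ⟨h1, h2⟩ := hA
  -- The second matrix is the unique element of 𝔠𝔬(2) whose first row is the second row of `A`.
  refine Submodule.subset_span ⟨A, ⟨h1, h2⟩, !![A 1 0, A 1 1; -A 1 1, A 1 0], ?_, ?_, Or.inl rfl⟩
  · show _ ∧ _
    simp
  · constructor <;> simp

theorem isPossibleTypeIII_diag : IsPossibleTypeIII (semi12 diag2) := by
  refine isPossibleTypeIII_semi12_of_diagonal (isBerger_semi12 fun A hA => ?_) fun A hA => hA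
  obtain ⟨h1, h2⟩ := hA
  have e : A = !![A 0 0, 0; 0, 0] + !![0, 0; 0, A 1 1] := by
    ext i j; fin_cases i <;> fin_cases j <;> simp [h1, h2]
  rw [e]
  refine add_mem (Submodule.subset_span ⟨_, ?_, 0, zero_mem _, ?_, Or.inl rfl⟩)
    (Submodule.subset_span ⟨0, zero_mem _, _, ?_, ?_, Or.inr rfl⟩)
  · show _ ∧ _
    simp
  · constructor <;> simp
  · show _ ∧ _
    simp
  · constructor <;> simp

theorem isPossibleTypeIII_line12 : IsPossibleTypeIII (semi12 line10) := by
  refine isPossibleTypeIII_semi12_of_diagonal (isBerger_semi12 fun A hA => ?_) ?_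
  · refine Submodule.subset_span ⟨A, hA, 0, zero_mem _, ?_, Or.inl rfl⟩
    obtain ⟨c, rfl⟩ := hA
    constructor <;> simp
  · rintro _ ⟨c, rfl⟩
    simp

theorem isPossibleTypeIII_zero12 : IsPossibleTypeIII (semi12 ⊥) := by
  refine isPossibleTypeIII_semi12_of_diagonal (isBerger_semi12 fun A hA => ?_) fun A hA => ?_
  · rw [LieSubalgebra.mem_bot] at hA
    rw [hA]
    exact zero_mem _
  · rw [LieSubalgebra.mem_bot] at hA
    simp [hA]

theorem isPossibleTypeIII_of_mem_typeIIIList {h : LieSubalgebra ℝ M7} (hh : h ∈ typeIIIList) :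
    IsPossibleTypeIII h := by
  rcases hh with rfl | rfl | rfl | rfl | rfl | rfl | rfl | rfl
  · exact isPossibleTypeIII_gl
  · exact isPossibleTypeIII_sl
  · exact isPossibleTypeIII_co
  · exact isPossibleTypeIII_diag
  · refine isPossibleTypeIII_semidirect_lineY ?_
    rintro _ ⟨c, rfl⟩
    simp
  · exact isPossibleTypeIII_line12
  · refine isPossibleTypeIII_semidirect_lineY ?_
    intro A hA
    rw [LieSubalgebra.mem_bot] at hA
    simp [hA]
  · exact isPossibleTypeIII_zero12

/-! ### The cross product of `ℝ^{4,3}` -/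

theorem etaForm_eq (x y : Fin 7 → ℝ) :
    etaForm x y =
      x 0 * y 4 + x 1 * y 5 + x 2 * y 6 - x 3 * y 3 + x 4 * y 0 + x 5 * y 1 + x 6 * y 2 := by
  rw [etaForm_apply, dotProduct_eta_mulVec]

theorem etaForm_comm (x y : Fin 7 → ℝ) : etaForm x y = etaForm y x := by
  simp only [etaForm_eq]; ring

theorem eq_of_forall_etaForm {x y : Fin 7 → ℝ} (h : ∀ z, etaForm x z = etaForm y z) : x = y := by
  rw [← sub_eq_zero]
  refine eq_zero_of_forall_dotProduct_eta fun z => ?_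
  rw [← etaForm_apply, map_sub, LinearMap.sub_apply, h z, sub_self]

/-- The cross product: `⟨x × y, z⟩ = ω(x, y, z)`. -/
def cross (x y : Fin 7 → ℝ) : Fin 7 → ℝ :=
  ![√2 * (x 1 * y 2 - x 2 * y 1) + (x 0 * y 3 - x 3 * y 0),
    -√2 * (x 0 * y 6 - x 6 * y 0) - (x 1 * y 3 - x 3 * y 1),
    √2 * (x 0 * y 5 - x 5 * y 0) - (x 2 * y 3 - x 3 * y 2),
    (x 0 * y 4 - x 4 * y 0) - (x 1 * y 5 - x 5 * y 1) - (x 2 * y 6 - x 6 * y 2),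
    √2 * (x 5 * y 6 - x 6 * y 5) + (x 3 * y 4 - x 4 * y 3),
    √2 * (x 2 * y 4 - x 4 * y 2) - (x 3 * y 5 - x 5 * y 3),
    -√2 * (x 1 * y 4 - x 4 * y 1) - (x 3 * y 6 - x 6 * y 3)]

theorem etaForm_cross (x y z : Fin 7 → ℝ) : etaForm (cross x y) z = omega x y z := by
  simp only [etaForm_eq, cross, omega, wedge3, Matrix.cons_val]
  ring

theorem cross_add_left (x x' y : Fin 7 → ℝ) : cross (x + x') y = cross x y + cross x' y := by
  ext i; fin_cases i <;> simp [cross] <;> ring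

theorem cross_smul_left (c : ℝ) (x y : Fin 7 → ℝ) : cross (c • x) y = c • cross x y := by
  ext i; fin_cases i <;> simp [cross] <;> ring

theorem cross_swap (x y : Fin 7 → ℝ) : cross x y = -cross y x := by
  ext i; fin_cases i <;> simp [cross] <;> ring

theorem cross_self (x : Fin 7 → ℝ) : cross x x = 0 := by
  ext i; fin_cases i <;> simp [cross] <;> ring

theorem cross_add_right (x y y' : Fin 7 → ℝ) : cross x (y + y') = cross x y + cross x y' := by
  rw [cross_swap, cross_add_left, cross_swap x y, cross_swap x y']; abel

theorem cross_smul_right (c : ℝ) (x y : Fin 7 → ℝ) : cross x (c • y) = c • cross x y := by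
  rw [cross_swap, cross_smul_left, cross_swap x y, smul_neg]

theorem cross_zero_right (x : Fin 7 → ℝ) : cross x 0 = 0 := by
  simpa using cross_smul_right 0 x 0

theorem cross_neg_right (x y : Fin 7 → ℝ) : cross x (-y) = -cross x y := by
  simpa using cross_smul_right (-1) x y

theorem omega_cycle (x y z : Fin 7 → ℝ) : omega x y z = omega y z x := by
  simp only [omega, wedge3]; ring

/-- The polarisation in x of x × (x × z) = ⟨x, z⟩ x - ⟨x, x⟩ z, the identity of imaginary split
octonions on which all later computations with the cross product rest. -/
theorem cross_cross_polarised (x y z : Fin 7 → ℝ) :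
    cross x (cross y z) + cross y (cross x z) =
      etaForm x z • y + etaForm y z • x - (2 * etaForm x y) • z := by
  have s2 : √2 ^ 2 = 2 := Real.sq_sqrt (by norm_num)
  simp only [etaForm_eq]
  ext i
  fin_cases i <;>
    simp only [cross, Pi.add_apply, Pi.sub_apply, Pi.smul_apply, smul_eq_mul, Matrix.cons_val,
      Fin.zero_eta, Fin.mk_one, Fin.reduceFinMk] <;>
    ring_nf <;> simp only [s2] <;> ring

theorem etaForm_cross_cross (x y z : Fin 7 → ℝ) :
    etaForm (cross x z) (cross y z) =
      etaForm x y * etaForm z z - etaForm x z * etaForm y z := by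
  have h := congrArg (etaForm y) (cross_cross_polarised z z x)
  have e : etaForm (cross x z) (cross y z) = -etaForm y (cross z (cross z x)) := by
    rw [etaForm_comm (cross x z), etaForm_cross, omega_cycle, ← etaForm_cross, cross_swap x z,
      cross_neg_right, map_neg, LinearMap.neg_apply, etaForm_comm]
  rw [e]
  simp only [map_add, map_sub, map_smul, smul_eq_mul] at h
  linear_combination (-1 / 2) * h - etaForm y z * etaForm_comm z x + etaForm z z * etaForm_comm y x

/-- The cross product is built from `omega` and `eta`, both infinitesimally invariant, and `eta` is
non-degenerate. -/
theorem mulVec_cross {X : M7} (hX : X ∈ g2Star) (x y : Fin 7 → ℝ) :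
    X *ᵥ cross x y = cross (X *ᵥ x) y + cross x (X *ᵥ y) := by
  refine eq_of_forall_etaForm fun z => ?_
  have h := hX x y z
  have hs : etaForm (X *ᵥ cross x y) z = -etaForm (cross x y) (X *ᵥ z) := by
    simp only [etaForm_apply]
    exact dotProduct_eta_skew (skew_of_mem_g2Star hX) _ _
  rw [hs, map_add, LinearMap.add_apply, etaForm_cross, etaForm_cross, etaForm_cross]
  linarith

/-! ### Invariant complements in the socle -/

theorem isInvariant_iff {h : LieSubalgebra ℝ M7} {W : Submodule ℝ (Fin 7 → ℝ)} :
    IsInvariant h W ↔ ∀ X ∈ h, W ≤ W.comap (Matrix.mulVecLin X) := Iff.rfl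

theorem IsInvariant.inf {h : LieSubalgebra ℝ M7} {W W' : Submodule ℝ (Fin 7 → ℝ)}
    (hW : IsInvariant h W) (hW' : IsInvariant h W') : IsInvariant h (W ⊓ W') :=
  fun X hX w hw => ⟨hW X hX w hw.1, hW' X hX w hw.2⟩

theorem IsInvariant.sup {h : LieSubalgebra ℝ M7} {W W' : Submodule ℝ (Fin 7 → ℝ)}
    (hW : IsInvariant h W) (hW' : IsInvariant h W') : IsInvariant h (W ⊔ W') := by
  rw [isInvariant_iff] at *
  exact fun X hX => sup_le ((hW X hX).trans (Submodule.comap_mono le_sup_left))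
    ((hW' X hX).trans (Submodule.comap_mono le_sup_right))

theorem isInvariant_socle (h : LieSubalgebra ℝ M7) : IsInvariant h (socle h) := by
  rw [isInvariant_iff]
  exact fun X hX => sSup_le fun W hW =>
    (isInvariant_iff.1 hW.1 X hX).trans (Submodule.comap_mono (le_sSup hW))

/-- A sum of irreducibles is completely reducible. Take an invariant `W'` maximal among those
disjoint from `W`; an irreducible subspace not contained in W + W' would meet it trivially and
enlarge `W'`. -/
theorem exists_invariant_compl {h : LieSubalgebra ℝ M7} {W : Submodule ℝ (Fin 7 → ℝ)}
    (hW : IsInvariant h W) (hle : W ≤ socle h) :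
    ∃ W', IsInvariant h W' ∧ Disjoint W W' ∧ W ⊔ W' = socle h := by
  obtain ⟨W', ⟨hle', hi', hd'⟩, hmax⟩ := set_has_maximal_iff_noetherian.2
    (inferInstance : IsNoetherian ℝ (Fin 7 → ℝ))
    {W' | W' ≤ socle h ∧ IsInvariant h W' ∧ Disjoint W W'}
    ⟨⊥, bot_le, fun X _ w hw => by
      rw [Submodule.mem_bot] at hw ⊢
      rw [hw, Matrix.mulVec_zero], disjoint_bot_right⟩
  refine ⟨W', hi', hd', le_antisymm (sup_le hle hle') (sSup_le fun I hI => ?_)⟩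
  by_contra hn
  rcases hI.2.2 (I ⊓ (W ⊔ W')) inf_le_left (hI.1.inf (hW.sup hi')) with h0 | h0
  · refine hmax (W' ⊔ I) ⟨sup_le hle' (le_sSup hI), hi'.sup hI.1,
      hd'.disjoint_sup_right_of_disjoint_sup_left (disjoint_iff.2 (by rwa [inf_comm]))⟩
      (left_lt_sup.2 fun h => hn (h.trans le_sup_right))
  · exact hn (inf_eq_left.1 h0)

theorem exists_invariant_compl_of_le {h : LieSubalgebra ℝ M7} {W S : Submodule ℝ (Fin 7 → ℝ)}
    (hW : IsInvariant h W) (hS : IsInvariant h S) (hle : W ≤ S) (hle' : S ≤ socle h) :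
    ∃ W', IsInvariant h W' ∧ Disjoint W W' ∧ W ⊔ W' = S := by
  obtain ⟨W', hi, hd, hs⟩ := exists_invariant_compl hW (hle.trans hle')
  refine ⟨W' ⊓ S, hi.inf hS, hd.mono_right inf_le_left, ?_⟩
  rw [← sup_inf_assoc_of_le _ hle, hs, inf_eq_right.2 hle']

/-! ### The socle as an isotropic subspace -/

/-- An invariant complement of the radical S ∩ S^⊥ in the socle S is non-degenerate. Being of
dimension at most three it is not the whole space, so by indecomposability it is zero and S is its
own radical. -/
theorem IsPossibleTypeIII.etaForm_socle {h : LieSubalgebra ℝ M7} (hh : IsPossibleTypeIII h)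
    {x y : Fin 7 → ℝ} (hx : x ∈ socle h) (hy : y ∈ socle h) : etaForm x y = 0 := by
  have hS := isInvariant_socle h
  obtain ⟨W', hi, hd, hs⟩ := exists_invariant_compl (hS.inf (hS.perp hh.le_g2Star)) inf_le_left
  have hle : W' ≤ socle h := hs ▸ le_sup_right
  have hn : IsNondegenerate W' := by
    intro v hv hvW
    refine Submodule.disjoint_def.1 hd v ⟨hle hv, mem_perp.2 fun w hw => ?_⟩ hv
    obtain ⟨a, ha, b, hb, rfl⟩ := Submodule.mem_sup.1 (hs ▸ hw : w ∈ _ ⊔ W')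
    rw [Matrix.mulVec_add, dotProduct_add, hvW b hb, add_zero, dotProduct_eta_comm]
    exact mem_perp.1 ha.2 v (hle hv)
  rcases hh.indecomposable W' hi hn with h0 | h0
  · rw [h0, sup_bot_eq] at hs
    rw [← hs] at hx
    rw [etaForm_apply]
    exact mem_perp.1 hx.2 y hy
  · exfalso
    have h1 := hh.finrank_socle
    have : socle h = ⊤ := top_le_iff.1 (h0 ▸ hle)
    rw [this, finrank_top] at h1
    simp at h1

theorem finrank_perp (W : Submodule ℝ (Fin 7 → ℝ)) :
    Module.finrank ℝ (perp W) = 7 - Module.finrank ℝ W := by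
  rw [perp, LinearMap.BilinForm.finrank_orthogonal etaForm_nondegenerate]
  simp

/-- Otherwise adjoining `u` gives an isotropic subspace of dimension at least four, contained in its
orthogonal space of dimension at most three. -/
theorem mem_of_isotropic {S : Submodule ℝ (Fin 7 → ℝ)} (h3 : Module.finrank ℝ S = 3)
    (hS : ∀ x ∈ S, ∀ y ∈ S, etaForm x y = 0) {u : Fin 7 → ℝ} (hu : ∀ x ∈ S, etaForm u x = 0)
    (huu : etaForm u u = 0) : u ∈ S := by
  by_contra hn
  have hlt : S < S ⊔ Submodule.span ℝ {u} :=
    left_lt_sup.2 fun h => hn (h (Submodule.mem_span_singleton_self u))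
  have h4 := Submodule.finrank_lt_finrank_of_lt hlt
  have hle : S ⊔ Submodule.span ℝ {u} ≤ perp (S ⊔ Submodule.span ℝ {u}) := by
    intro a ha
    refine mem_perp.2 fun b hb => ?_
    obtain ⟨s, hs, s', hs', rfl⟩ := Submodule.mem_sup.1 ha
    obtain ⟨t, ht, t', ht', rfl⟩ := Submodule.mem_sup.1 hb
    obtain ⟨c, rfl⟩ := Submodule.mem_span_singleton.1 hs'
    obtain ⟨d, rfl⟩ := Submodule.mem_span_singleton.1 ht'
    rw [← etaForm_apply]
    simp [hS s hs t ht, hu t ht, etaForm_comm s u, hu s hs, huu]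
  have h5 := Submodule.finrank_mono hle
  rw [finrank_perp] at h5
  omega

theorem exists_basis_two {S : Submodule ℝ (Fin 7 → ℝ)} (h2 : Module.finrank ℝ S = 2) :
    ∃ x ∈ S, ∃ y ∈ S, (∀ s ∈ S, ∃ a b : ℝ, s = a • x + b • y) ∧
      ∀ a b : ℝ, a • x + b • y = 0 → a = 0 ∧ b = 0 := by
  let b := Module.finBasisOfFinrankEq ℝ S h2
  refine ⟨b 0, (b 0).2, b 1, (b 1).2, fun s hs => ?_, fun a c h => ?_⟩
  · have := congrArg Subtype.val (b.sum_repr ⟨s, hs⟩)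
    simp only [Fin.sum_univ_two, Submodule.coe_add, Submodule.coe_smul] at this
    exact ⟨_, _, this.symm⟩
  · have hl := Fintype.linearIndependent_iff.1 b.linearIndependent ![a, c] (by
      apply Subtype.ext
      simpa [Fin.sum_univ_two] using h)
    exact ⟨by simpa using hl 0, by simpa using hl 1⟩

theorem exists_basis_three {S : Submodule ℝ (Fin 7 → ℝ)} (h3 : Module.finrank ℝ S = 3) :
    ∃ x ∈ S, ∃ y ∈ S, ∃ z ∈ S, (∀ s ∈ S, ∃ a b c : ℝ, s = a • x + b • y + c • z) ∧
      ∀ a b c : ℝ, a • x + b • y + c • z = 0 → a = 0 ∧ b = 0 ∧ c = 0 := by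
  let b := Module.finBasisOfFinrankEq ℝ S h3
  refine ⟨b 0, (b 0).2, b 1, (b 1).2, b 2, (b 2).2, fun s hs => ?_, fun a c d h => ?_⟩
  · have := congrArg Subtype.val (b.sum_repr ⟨s, hs⟩)
    simp only [Fin.sum_univ_three, Submodule.coe_add, Submodule.coe_smul] at this
    exact ⟨_, _, _, this.symm⟩
  · have hl := Fintype.linearIndependent_iff.1 b.linearIndependent ![a, c, d] (by
      apply Subtype.ext
      simpa [Fin.sum_univ_three] using h)
    exact ⟨by simpa using hl 0, by simpa using hl 1, by simpa using hl 2⟩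

theorem exists_etaForm_eq {n : ℕ} {b : Fin n → Fin 7 → ℝ} (hb : LinearIndependent ℝ b)
    (c : Fin n → ℝ) : ∃ z, ∀ i, etaForm (b i) z = c i := by
  obtain ⟨g, hg⟩ := LinearMap.exists_extend ((Module.Basis.span hb).constr ℝ c)
  refine ⟨eta *ᵥ fun i => g (Pi.single i 1), fun i => ?_⟩
  have h1 : g (b i) = c i := by
    have := LinearMap.congr_fun hg (Module.Basis.span hb i)
    rw [Module.Basis.constr_basis, LinearMap.comp_apply, Submodule.subtype_apply,
      Module.Basis.span_apply] at this
    exact this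
  rw [etaForm_apply, Matrix.mulVec_mulVec, eta_mul_eta, Matrix.one_mulVec, ← h1,
    LinearMap.pi_apply_eq_sum_univ g (b i), dotProduct]
  refine Finset.sum_congr rfl fun j _ => ?_
  rw [smul_eq_mul]
  congr 2
  ext k
  simp [Pi.single_apply, eq_comm]

/-- A null vector with prescribed products with three independent vectors of an isotropic
subspace. -/
theorem exists_null_dual {x y z : Fin 7 → ℝ}
    (hl : ∀ a b c : ℝ, a • x + b • y + c • z = 0 → a = 0 ∧ b = 0 ∧ c = 0)
    (hxx : etaForm x x = 0) (hxy : etaForm x y = 0) (hxz : etaForm x z = 0) :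
    ∃ u, etaForm x u = 1 ∧ etaForm y u = 0 ∧ etaForm z u = 0 ∧ etaForm u u = 0 := by
  have hb : LinearIndependent ℝ ![x, y, z] := by
    rw [Fintype.linearIndependent_iff]
    intro g hg
    rw [Fin.sum_univ_three] at hg
    obtain ⟨h0, h1, h2⟩ := hl _ _ _ hg
    intro i
    fin_cases i
    · exact h0
    · exact h1
    · exact h2
  obtain ⟨u, hu⟩ := exists_etaForm_eq hb ![1, 0, 0]
  have h0 : etaForm x u = 1 := hu 0
  have h1 : etaForm y u = 0 := hu 1
  have h2 : etaForm z u = 0 := hu 2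
  refine ⟨u - (etaForm u u / 2) • x, ?_, ?_, ?_, ?_⟩
  · simp [h0, hxx]
  · simp [h1, etaForm_comm y x, hxy]
  · simp [h2, etaForm_comm z x, hxz]
  · simp [h0, etaForm_comm u x, hxx]
    ring

/-- If ω were non-zero on the socle S, it would pair S perfectly with S × S. Then S + S × S would be
invariant and non-degenerate, non-zero and of dimension at most six. -/
theorem IsPossibleTypeIII.omega_socle {h : LieSubalgebra ℝ M7} (hh : IsPossibleTypeIII h)
    {s t r : Fin 7 → ℝ} (hs : s ∈ socle h) (ht : t ∈ socle h) (hr : r ∈ socle h) :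
    omega s t r = 0 := by
  obtain ⟨x, hx, y, hy, w, hw, hspan, -⟩ := exists_basis_three hh.finrank_socle
  have hiso := @IsPossibleTypeIII.etaForm_socle h hh
  suffices h0 : omega x y w = 0 by
    obtain ⟨a, b, c, rfl⟩ := hspan s hs
    obtain ⟨a', b', c', rfl⟩ := hspan t ht
    obtain ⟨a'', b'', c'', rfl⟩ := hspan r hr
    have : omega (a • x + b • y + c • w) (a' • x + b' • y + c' • w)
        (a'' • x + b'' • y + c'' • w) = (a * (b' * c'' - c' * b'') - b * (a' * c'' - c' * a'')
          + c * (a' * b'' - b' * a'')) * omega x y w := by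
      simp only [omega, wedge3, Pi.add_apply, Pi.smul_apply, smul_eq_mul]; ring
    rw [this, h0, mul_zero]
  by_contra h0
  let C : Submodule ℝ (Fin 7 → ℝ) :=
    Submodule.span ℝ (Set.range ![cross y w, cross w x, cross x y])
  have hC0 : cross y w ∈ C := Submodule.subset_span ⟨0, rfl⟩
  have hC1 : cross w x ∈ C := Submodule.subset_span ⟨1, rfl⟩
  have hC2 : cross x y ∈ C := Submodule.subset_span ⟨2, rfl⟩
  have hC : ∀ u ∈ socle h, ∀ v ∈ socle h, cross u v ∈ C := by
    intro u hu v hv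
    obtain ⟨a, b, c, rfl⟩ := hspan u hu
    obtain ⟨a', b', c', rfl⟩ := hspan v hv
    have := C.add_mem (C.add_mem (C.smul_mem (b * c' - c * b') hC0)
      (C.smul_mem (c * a' - a * c') hC1)) (C.smul_mem (a * b' - b * a') hC2)
    convert this using 1
    simp only [cross_add_left, cross_add_right, cross_smul_left, cross_smul_right, cross_self,
      cross_swap w y, cross_swap x w, cross_swap y x]
    module
  have hCi : IsInvariant h (socle h ⊔ C) := by
    rw [isInvariant_iff]
    refine fun X hX => sup_le (fun u hu => Submodule.mem_sup_left (isInvariant_socle h X hX u hu))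
      (Submodule.span_le.2 ?_)
    have key : ∀ u ∈ socle h, ∀ v ∈ socle h, X *ᵥ cross u v ∈ socle h ⊔ C := by
      intro u hu v hv
      rw [mulVec_cross (hh.le_g2Star hX)]
      exact Submodule.mem_sup_right (C.add_mem (hC _ (isInvariant_socle h X hX u hu) _ hv)
        (hC _ hu _ (isInvariant_socle h X hX v hv)))
    rintro _ ⟨i, rfl⟩
    fin_cases i
    · exact key y hy w hw
    · exact key w hw x hx
    · exact key x hx y hy
  have e1 : omega y w x = omega x y w := (omega_cycle x y w).symm
  have e2 : omega w x y = omega x y w := by exact omega_cycle _ _ _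
  have z1 : ∀ u v, omega u v v = 0 := fun u v => by simp only [omega, wedge3]; ring
  have z2 : ∀ u v, omega u v u = 0 := fun u v => by simp only [omega, wedge3]; ring
  -- The matrix of products of x, y, w with y × w, w × x, x × y is ω(x, y, w) times the identity.
  -- Testing against the isotropic socle removes the component in `C`; testing against `C` then
  -- removes the rest.
  have hn : IsNondegenerate (socle h ⊔ C) := by
    intro v hv hvT
    simp only [← etaForm_apply] at hvT
    obtain ⟨s, hs, t, ht, rfl⟩ := Submodule.mem_sup.1 hv
    obtain ⟨k, hk⟩ := (Submodule.mem_span_range_iff_exists_fun ℝ).1 ht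
    simp only [Fin.sum_univ_three, Matrix.cons_val] at hk
    have hx' := hvT x (Submodule.mem_sup_left hx)
    have hy' := hvT y (Submodule.mem_sup_left hy)
    have hw' := hvT w (Submodule.mem_sup_left hw)
    simp [← hk, hiso hs hx, hiso hs hy, hiso hs hw, etaForm_cross, e1, e2, z1, z2, h0]
      at hx' hy' hw'
    have ht0 : t = 0 := by rw [← hk, hx', hy', hw']; simp
    rw [ht0, add_zero] at hvT ⊢
    obtain ⟨a, b, c, rfl⟩ := hspan s hs
    have ha := hvT _ (Submodule.mem_sup_right hC0)
    have hb := hvT _ (Submodule.mem_sup_right hC1)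
    have hc := hvT _ (Submodule.mem_sup_right hC2)
    simp only [map_add, map_smul, LinearMap.add_apply, LinearMap.smul_apply, smul_eq_mul,
      etaForm_comm _ (cross _ _), etaForm_cross, e1, e2, z1, z2, mul_zero, add_zero, zero_add,
      mul_eq_zero, h0, or_false] at ha hb hc
    simp [ha, hb, hc]
  rcases hh.indecomposable _ hCi hn with hT | hT
  · have : x = 0 := by
      have : x ∈ socle h ⊔ C := Submodule.mem_sup_left hx
      rwa [hT] at this
    exact h0 (by rw [this]; simp [omega, wedge3])
  · have h1 := Submodule.finrank_add_le_finrank_add_finrank (socle h) C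
    have h2 : Module.finrank ℝ C ≤ 3 := by
      exact (finrank_range_le_card (R := ℝ) ![cross y w, cross w x, cross x y]).trans_eq (by simp)
    rw [hT, finrank_top, hh.finrank_socle] at h1
    simp at h1
    omega

/-- The product is orthogonal to the socle because ω vanishes on it, and null by the formula for ⟨x
× z, y × z⟩; maximality of the isotropic socle applies. -/
theorem IsPossibleTypeIII.cross_mem_socle {h : LieSubalgebra ℝ M7} (hh : IsPossibleTypeIII h)
    {s t : Fin 7 → ℝ} (hs : s ∈ socle h) (ht : t ∈ socle h) : cross s t ∈ socle h := by
  refine mem_of_isotropic hh.finrank_socle (fun x hx y hy => hh.etaForm_socle hx hy)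
    (fun x hx => ?_) ?_
  · rw [etaForm_cross, hh.omega_socle hs ht hx]
  · rw [etaForm_cross_cross, hh.etaForm_socle hs ht, hh.etaForm_socle hs hs]; simp

/-- Suppose all products vanish, and let z be null, dual to w and orthogonal to x. The polarised
identity for w, z, u shows that u ∈ S with ⟨z, u⟩ = 0 and z × u = 0 is zero. Now z × x is null and
orthogonal to S, hence in S; it is also orthogonal to z and annihilated by z ×. So z × x = 0, and
then x = 0. -/
theorem IsPossibleTypeIII.exists_cross_ne_zero {h : LieSubalgebra ℝ M7}
    (hh : IsPossibleTypeIII h) : ∃ s ∈ socle h, ∃ t ∈ socle h, cross s t ≠ 0 := by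
  by_contra! hcr
  have hiso := @IsPossibleTypeIII.etaForm_socle h hh
  obtain ⟨w, hw, x, hx, y, hy, -, hl⟩ := exists_basis_three hh.finrank_socle
  obtain ⟨z, hwz, hxz, -, hzz⟩ := exists_null_dual hl (hiso hw hw) (hiso hw hx) (hiso hw hy)
  have key : ∀ u ∈ socle h, cross z u = 0 → etaForm z u = 0 → u = 0 := by
    intro u hu h1 h2
    have := cross_cross_polarised w z u
    rw [h1, hcr w hw u hu, hiso hw hu, h2, hwz] at this
    simpa [cross_zero_right] using this
  have hzx : etaForm z x = 0 := by rw [etaForm_comm, hxz]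
  have hc : cross z x ∈ socle h := by
    refine mem_of_isotropic hh.finrank_socle (fun x hx y hy => hh.etaForm_socle hx hy)
      (fun s hs => ?_) ?_
    · rw [etaForm_cross, omega_cycle, ← etaForm_cross, hcr x hx s hs]; simp
    · rw [etaForm_cross_cross, hzz, hzx, hiso hx hx]; simp
  have hc0 : cross z x = 0 := by
    refine key _ hc ?_ ?_
    · have := cross_cross_polarised z z x
      rw [hzx, hzz, ← two_smul ℝ] at this
      simpa using this
    · rw [etaForm_comm, etaForm_cross]
      simp only [omega, wedge3]; ring
  have hx0 := key x hx hc0 hzx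
  have := (hl 0 1 0 (by simp [hx0])).2.1
  exact one_ne_zero this

/-- The data of an adapted basis: the first three vectors span the socle, the line of `b₁` and
the plane of `b₂, b₃` are invariant, and `b₅` is dual to `b₁`. -/
structure AdaptedFrame (h : LieSubalgebra ℝ M7) (b₁ b₂ b₃ b₅ : Fin 7 → ℝ) : Prop where
  eta₁₁ : etaForm b₁ b₁ = 0
  eta₁₂ : etaForm b₁ b₂ = 0
  eta₁₃ : etaForm b₁ b₃ = 0
  eta₂₂ : etaForm b₂ b₂ = 0
  eta₂₃ : etaForm b₂ b₃ = 0
  eta₃₃ : etaForm b₃ b₃ = 0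
  eta₁₅ : etaForm b₁ b₅ = 1
  eta₂₅ : etaForm b₂ b₅ = 0
  eta₃₅ : etaForm b₃ b₅ = 0
  eta₅₅ : etaForm b₅ b₅ = 0
  cross₁₂ : cross b₁ b₂ = 0
  cross₁₃ : cross b₁ b₃ = 0
  cross₂₃ : cross b₂ b₃ = √2 • b₁
  plane : ∀ X ∈ h, ∃ A : M2, X *ᵥ b₂ = A 0 0 • b₂ + A 1 0 • b₃ ∧ X *ᵥ b₃ = A 0 1 • b₂ + A 1 1 • b₃
  semisimple : ∀ c d : ℝ, c • b₂ + d • b₃ ≠ 0 →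
    (∀ X ∈ h, ∃ k : ℝ, X *ᵥ (c • b₂ + d • b₃) = k • (c • b₂ + d • b₃)) →
    ∃ c' d' : ℝ, c * d' - d * c' ≠ 0 ∧
      ∀ X ∈ h, ∃ k : ℝ, X *ᵥ (c' • b₂ + d' • b₃) = k • (c' • b₂ + d' • b₃)

/-- A non-zero product e = y × w of socle vectors satisfies y × e = w × e = 0, so e, y, w form a
basis of the socle and all products are multiples of e. Derivations therefore preserve ℝe, and
complete reducibility gives the invariant plane. -/
theorem IsPossibleTypeIII.exists_adaptedFrame {h : LieSubalgebra ℝ M7} (hh : IsPossibleTypeIII h) :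
    ∃ b₁ b₂ b₃ b₅, AdaptedFrame h b₁ b₂ b₃ b₅ := by
  have hiso := @IsPossibleTypeIII.etaForm_socle h hh
  have hS := isInvariant_socle h
  obtain ⟨y, hy, w, hw, he0⟩ := hh.exists_cross_ne_zero
  set e := cross y w with he
  have heS : e ∈ socle h := hh.cross_mem_socle hy hw
  have hye : cross y e = 0 := by
    have := cross_cross_polarised y y w
    rw [hiso hy hw, hiso hy hy, ← two_smul ℝ, ← he] at this
    simpa using this
  have hwe : cross w e = 0 := by
    have := cross_cross_polarised w w y
    rw [hiso hw hy, hiso hw hw, ← two_smul ℝ, cross_swap w y, ← he] at this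
    simpa [cross_neg_right] using this
  have hl : ∀ a b c : ℝ, a • e + b • y + c • w = 0 → a = 0 ∧ b = 0 ∧ c = 0 := by
    intro a b c h0
    have h1 := congrArg (cross y) h0
    have h2 := congrArg (cross w) h0
    simp only [cross_add_right, cross_smul_right, hye, hwe, cross_self, cross_zero_right, ← he,
      cross_swap w y] at h1 h2
    have hc : c = 0 := by simpa [he0] using h1
    have hb : b = 0 := by simpa [he0] using h2
    rw [hb, hc] at h0
    have ha : a = 0 := by simpa [he0] using h0
    exact ⟨ha, hb, hc⟩
  have hspan : ∀ s ∈ socle h, ∃ a b c : ℝ, s = a • e + b • y + c • w := by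
    have hli : LinearIndependent ℝ ![e, y, w] := by
      rw [Fintype.linearIndependent_iff]
      intro g hg
      rw [Fin.sum_univ_three] at hg
      obtain ⟨h0, h1, h2⟩ := hl _ _ _ hg
      intro i
      fin_cases i
      · exact h0
      · exact h1
      · exact h2
    have hle : Submodule.span ℝ (Set.range ![e, y, w]) ≤ socle h := by
      refine Submodule.span_le.2 ?_
      rintro _ ⟨i, rfl⟩
      fin_cases i
      · exact heS
      · exact hy
      · exact hw
    have heq := Submodule.eq_of_le_of_finrank_eq hle (by
      rw [finrank_span_eq_card hli, hh.finrank_socle, Fintype.card_fin])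
    intro s hs
    rw [← heq] at hs
    obtain ⟨k, hk⟩ := (Submodule.mem_span_range_iff_exists_fun ℝ).1 hs
    simp only [Fin.sum_univ_three, Matrix.cons_val] at hk
    exact ⟨_, _, _, hk.symm⟩
  have hes : ∀ s ∈ socle h, cross e s = 0 := by
    intro s hs
    obtain ⟨a, b, c, rfl⟩ := hspan s hs
    simp [cross_add_right, cross_smul_right, cross_self, cross_swap e y, cross_swap e w, hye, hwe]
  have hcross : ∀ s ∈ socle h, ∀ t ∈ socle h, ∃ k : ℝ, cross s t = k • e := by
    intro s hs t ht
    obtain ⟨a, b, c, rfl⟩ := hspan s hs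
    obtain ⟨a', b', c', rfl⟩ := hspan t ht
    refine ⟨b * c' - c * b', ?_⟩
    simp only [cross_add_left, cross_add_right, cross_smul_left, cross_smul_right, cross_self,
      hye, hwe, hes y hy, hes w hw, cross_swap w y, ← he]
    module
  have hℓ : IsInvariant h (Submodule.span ℝ {e}) := by
    rw [isInvariant_iff]
    intro X hX
    rw [Submodule.span_le, Set.singleton_subset_iff]
    change X *ᵥ e ∈ Submodule.span ℝ {e}
    rw [he, mulVec_cross (hh.le_g2Star hX), ← he]
    obtain ⟨k, hk⟩ := hcross _ (hS X hX y hy) w hw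
    obtain ⟨k', hk'⟩ := hcross y hy _ (hS X hX w hw)
    rw [hk, hk', ← add_smul]
    exact Submodule.smul_mem _ _ (Submodule.mem_span_singleton_self e)
  obtain ⟨S', hS', hd, hsup⟩ := exists_invariant_compl hℓ
    (Submodule.span_le.2 (Set.singleton_subset_iff.2 heS))
  have hS'le : S' ≤ socle h := hsup ▸ le_sup_right
  have hf : Module.finrank ℝ S' = 2 := by
    have := Submodule.finrank_sup_add_finrank_inf_eq (Submodule.span ℝ {e}) S'
    rw [hsup, hd.eq_bot, finrank_bot, hh.finrank_socle, finrank_span_singleton he0] at this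
    omega
  obtain ⟨b₂, hb₂, b₃, hb₃, hspan', hl'⟩ := exists_basis_two hf
  obtain ⟨κ, hκ⟩ := hcross b₂ (hS'le hb₂) b₃ (hS'le hb₃)
  -- The line ℝe multiplies the socle to zero, so a vanishing product on the complementary plane
  -- would make all products vanish, including e itself.
  have hκ0 : κ ≠ 0 := by
    rintro rfl
    have hdec : ∀ s ∈ socle h, ∃ a b c : ℝ, s = a • e + b • b₂ + c • b₃ := by
      intro s hs
      obtain ⟨p, hp, q, hq, rfl⟩ := Submodule.mem_sup.1 (hsup ▸ hs : s ∈ _ ⊔ S')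
      obtain ⟨a, rfl⟩ := Submodule.mem_span_singleton.1 hp
      obtain ⟨b, c, rfl⟩ := hspan' q hq
      exact ⟨a, b, c, by rw [add_assoc]⟩
    obtain ⟨a, b, c, hy'⟩ := hdec y hy
    obtain ⟨a', b', c', hw'⟩ := hdec w hw
    refine he0 ?_
    rw [he, hy', hw']
    simp only [cross_add_left, cross_add_right, cross_smul_left, cross_smul_right, cross_self,
      hes b₂ (hS'le hb₂), hes b₃ (hS'le hb₃), cross_swap b₂ e, cross_swap b₃ e, cross_swap b₃ b₂,
      hκ]
    simp
  have hs2 : √2 ≠ 0 := by positivity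
  -- The scaling reproduces the relation b₂ × b₃ = √2 b₁ of the standard basis.
  set b₁ := (κ / √2) • e with hb₁
  have hb₁S : b₁ ∈ socle h := (socle h).smul_mem _ heS
  have hl₁ : ∀ a b c : ℝ, a • b₁ + b • b₂ + c • b₃ = 0 → a = 0 ∧ b = 0 ∧ c = 0 := by
    intro a b c h0
    have h1 : a • b₁ = 0 := by
      refine Submodule.disjoint_def.1 hd _ (Submodule.smul_mem _ _ (Submodule.smul_mem _ _
        (Submodule.mem_span_singleton_self e))) ?_
      have : a • b₁ = -(b • b₂ + c • b₃) := by
        rw [eq_neg_iff_add_eq_zero, ← add_assoc, h0]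
      rw [this]
      exact S'.neg_mem (S'.add_mem (S'.smul_mem _ hb₂) (S'.smul_mem _ hb₃))
    rw [h1, zero_add] at h0
    refine ⟨?_, hl' b c h0⟩
    simpa [hb₁, he0, hκ0, hs2] using h1
  obtain ⟨b₅, h15, h25, h35, h55⟩ := exists_null_dual hl₁ (hiso hb₁S hb₁S)
    (hiso hb₁S (hS'le hb₂)) (hiso hb₁S (hS'le hb₃))
  refine ⟨b₁, b₂, b₃, b₅, hiso hb₁S hb₁S, hiso hb₁S (hS'le hb₂), hiso hb₁S (hS'le hb₃),
    hiso (hS'le hb₂) (hS'le hb₂), hiso (hS'le hb₂) (hS'le hb₃), hiso (hS'le hb₃) (hS'le hb₃),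
    h15, h25, h35, h55, ?_, ?_, ?_, ?_, ?_⟩
  · rw [hb₁, cross_smul_left, hes b₂ (hS'le hb₂), smul_zero]
  · rw [hb₁, cross_smul_left, hes b₃ (hS'le hb₃), smul_zero]
  · rw [hκ, hb₁, smul_smul, mul_div_cancel₀ _ hs2]
  · intro X hX
    obtain ⟨a, b, h2⟩ := hspan' _ (hS' X hX b₂ hb₂)
    obtain ⟨c, d, h3⟩ := hspan' _ (hS' X hX b₃ hb₃)
    exact ⟨!![a, c; b, d], by simpa using h2, by simpa using h3⟩
  · intro c d hcd hinv
    set u := c • b₂ + d • b₃ with hu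
    have huS : u ∈ S' := S'.add_mem (S'.smul_mem _ hb₂) (S'.smul_mem _ hb₃)
    have hW : IsInvariant h (Submodule.span ℝ {u}) := by
      rw [isInvariant_iff]
      intro X hX
      rw [Submodule.span_le, Set.singleton_subset_iff]
      change X *ᵥ u ∈ Submodule.span ℝ {u}
      obtain ⟨k, hk⟩ := hinv X hX
      rw [hk]
      exact Submodule.smul_mem _ _ (Submodule.mem_span_singleton_self u)
    obtain ⟨W', hi, hd', hs'⟩ := exists_invariant_compl_of_le hW hS'
      (Submodule.span_le.2 (Set.singleton_subset_iff.2 huS)) hS'le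
    have hW'le : W' ≤ S' := hs' ▸ le_sup_right
    have hf' : Module.finrank ℝ W' = 1 := by
      have := Submodule.finrank_sup_add_finrank_inf_eq (Submodule.span ℝ {u}) W'
      rw [hs', hd'.eq_bot, finrank_bot, hf, finrank_span_singleton hcd] at this
      omega
    obtain ⟨⟨u', hu'⟩, hu'0, hgen⟩ := finrank_eq_one_iff'.1 hf'
    obtain ⟨c', d', rfl⟩ := hspan' u' (hW'le hu')
    refine ⟨c', d', fun h0 => ?_, fun X hX => ?_⟩
    · have hz : ∀ s t : ℝ, s • u = t • (c' • b₂ + d' • b₃) → s • u = 0 := by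
        intro s t hst
        refine Submodule.disjoint_def.1 hd' _
          (Submodule.smul_mem _ _ (Submodule.mem_span_singleton_self u)) ?_
        rw [hst]
        exact W'.smul_mem _ hu'
      have h1 : c' • u = c • (c' • b₂ + d' • b₃) := by
        rw [hu, smul_add, smul_add, smul_smul, smul_smul, smul_smul, smul_smul]
        congr 2
        · ring
        · linarith
      have h2 : d' • u = d • (c' • b₂ + d' • b₃) := by
        rw [hu, smul_add, smul_add, smul_smul, smul_smul, smul_smul, smul_smul]
        congr 2
        · linarith
        · ring
      have hc' : c' = 0 := by simpa [hcd] using hz _ _ h1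
      have hd'' : d' = 0 := by simpa [hcd] using hz _ _ h2
      refine hu'0 (Subtype.ext ?_)
      simp [hc', hd'']
    · obtain ⟨k, hk⟩ := hgen ⟨_, hi X hX _ hu'⟩
      exact ⟨k, (congrArg Subtype.val hk).symm⟩

/-! ### Conjugation -/

/-- The subalgebra `P⁻¹ 𝔥 P`. -/
def conjSubalgebra {n : ℕ} (P : (Matrix (Fin n) (Fin n) ℝ)ˣ)
    (h : LieSubalgebra ℝ (Matrix (Fin n) (Fin n) ℝ)) : LieSubalgebra ℝ (Matrix (Fin n) (Fin n) ℝ)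
    where
  carrier := {X | P.val * X * (P⁻¹).val ∈ h}
  zero_mem' := by simp
  add_mem' := by
    intro X Y hX hY
    have := add_mem (show _ ∈ h from hX) (show _ ∈ h from hY)
    simpa [mul_add, add_mul] using this
  smul_mem' := by
    intro c X hX
    have := h.smul_mem c (show _ ∈ h from hX)
    simpa using this
  lie_mem' := by
    intro X Y hX hY
    have := h.lie_mem (show _ ∈ h from hX) (show _ ∈ h from hY)
    have e : ⁅P.val * X * (P⁻¹).val, P.val * Y * (P⁻¹).val⁆ =
        P.val * ⁅X, Y⁆ * (P⁻¹).val := by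
      have hP : (P⁻¹).val * P = 1 := P.inv_mul
      simp only [Ring.lie_def, mul_sub, sub_mul]
      congr 1
      · calc P.val * X * (P⁻¹).val * (P * Y * (P⁻¹).val) =
            P * X * ((P⁻¹).val * P) * Y * (P⁻¹).val := by simp only [mul_assoc]
          _ = _ := by rw [hP]; simp only [mul_assoc, one_mul]
      · calc P.val * Y * (P⁻¹).val * (P * X * (P⁻¹).val) =
            P * Y * ((P⁻¹).val * P) * X * (P⁻¹).val := by simp only [mul_assoc]
          _ = _ := by rw [hP]; simp only [mul_assoc, one_mul]
    rw [e] at this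
    exact this

theorem mem_conjSubalgebra {n : ℕ} {P : (Matrix (Fin n) (Fin n) ℝ)ˣ}
    {h : LieSubalgebra ℝ (Matrix (Fin n) (Fin n) ℝ)} {X : Matrix (Fin n) (Fin n) ℝ} :
    X ∈ conjSubalgebra P h ↔ P.val * X * (P⁻¹).val ∈ h := Iff.rfl

theorem mem_conjSubalgebra_of_mul_eq {n : ℕ} {P : (Matrix (Fin n) (Fin n) ℝ)ˣ}
    {h : LieSubalgebra ℝ (Matrix (Fin n) (Fin n) ℝ)} {X Y : Matrix (Fin n) (Fin n) ℝ}
    (e : Y * P = P * X) : X ∈ conjSubalgebra P h ↔ Y ∈ h := by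
  rw [mem_conjSubalgebra, ← e, mul_assoc, P.mul_inv, mul_one]

theorem conjSubalgebra_mul {n : ℕ} (P Q : (Matrix (Fin n) (Fin n) ℝ)ˣ)
    (h : LieSubalgebra ℝ (Matrix (Fin n) (Fin n) ℝ)) :
    conjSubalgebra (P * Q) h = conjSubalgebra Q (conjSubalgebra P h) := by
  ext X
  simp only [mem_conjSubalgebra, mul_inv_rev, Units.val_mul, mul_assoc]

theorem inv_mul_mem_conjSubalgebra {n : ℕ} {P : (Matrix (Fin n) (Fin n) ℝ)ˣ}
    {h : LieSubalgebra ℝ (Matrix (Fin n) (Fin n) ℝ)} {X : Matrix (Fin n) (Fin n) ℝ} (hX : X ∈ h) :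
    (P⁻¹).val * X * P ∈ conjSubalgebra P h := by
  refine (mem_conjSubalgebra_of_mul_eq ?_).2 hX
  rw [mul_assoc, ← mul_assoc P.val, P.mul_inv, one_mul]

/-- A matrix preserving `η`, as a unit. -/
def orthUnit (P : M7) (hP : Pᵀ * eta * P = eta) : M7ˣ :=
  have h : eta * Pᵀ * eta * P = 1 := by
    rw [mul_assoc, mul_assoc, ← mul_assoc Pᵀ, hP, eta_mul_eta]
  ⟨P, eta * Pᵀ * eta, mul_eq_one_comm.1 h, h⟩

/-- An isometry has determinant ±1. Since the dimension is odd, `-P` has the opposite determinant,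
and it conjugates in the same way as `P`. -/
theorem isConjugate_of_orthogonal {P : M7ˣ} (hP : (P : M7)ᵀ * eta * P = eta)
    {h : LieSubalgebra ℝ M7} : IsConjugate h (conjSubalgebra P h) := by
  have hset : ∀ Q : M7, Q * Q⁻¹ = 1 → (∀ X, X ∈ conjSubalgebra P h ↔ Q * X * Q⁻¹ ∈ h) →
      (h : Set M7) = {Z | ∃ X ∈ conjSubalgebra P h, Z = Q * X * Q⁻¹} := by
    intro Q hQ hX
    have hQ' : Q⁻¹ * Q = 1 := mul_eq_one_comm.1 hQ
    ext Z
    constructor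
    · intro hZ
      have e : Q * (Q⁻¹ * Z * Q) * Q⁻¹ = Z := by
        calc Q * (Q⁻¹ * Z * Q) * Q⁻¹ = (Q * Q⁻¹) * Z * (Q * Q⁻¹) := by simp only [mul_assoc]
          _ = Z := by rw [hQ]; simp
      exact ⟨Q⁻¹ * Z * Q, (hX _).2 (by rw [e]; exact hZ), e.symm⟩
    · rintro ⟨X, hX', rfl⟩
      exact (hX X).1 hX'
  have hdet : (P : M7).det = 1 ∨ (P : M7).det = -1 := by
    have h1 := congrArg Matrix.det hP
    rw [Matrix.det_mul, Matrix.det_mul, Matrix.det_transpose] at h1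
    have h2 : eta.det * eta.det = 1 := by rw [← Matrix.det_mul, eta_mul_eta, Matrix.det_one]
    have h3 : (P : M7).det * (P : M7).det = 1 := by
      linear_combination eta.det * h1 - ((P : M7).det * (P : M7).det - 1) * h2
    exact mul_self_eq_one_iff.1 h3
  have hinv : (P : M7)⁻¹ = (P⁻¹ : M7ˣ) := (Matrix.coe_units_inv P).symm
  have h1 : (P : M7) * (P : M7)⁻¹ = 1 := by rw [hinv, P.mul_inv]
  rcases hdet with hd | hd
  · exact ⟨P, ⟨hP, hd⟩, hset P h1 fun X => by rw [hinv, mem_conjSubalgebra]⟩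
  · have hneg : (-(P : M7))⁻¹ = -(P : M7)⁻¹ := by
      refine Matrix.inv_eq_right_inv ?_
      rw [neg_mul_neg, h1]
    refine ⟨-P, ⟨?_, ?_⟩, hset _ ?_ fun X => ?_⟩
    · rw [Matrix.transpose_neg, neg_mul, neg_mul_neg, hP]
    · rw [Matrix.det_neg, hd]; norm_num
    · rw [hneg, neg_mul_neg, h1]
    · rw [hneg, mem_conjSubalgebra, hinv, neg_mul, neg_mul_neg]

/-- Curvature endomorphisms are transported by (x, y) ↦ P⁻¹ R(P x, P y) P. -/
theorem IsBerger.conj {h : LieSubalgebra ℝ M7} (hh : IsBerger h) (P : M7ˣ) :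
    IsBerger (conjSubalgebra P h) := by
  have hP : (P : M7) * (P⁻¹ : M7ˣ) = 1 := P.mul_inv
  have hP' : ((P⁻¹ : M7ˣ) : M7) * P = 1 := P.inv_mul
  let φ : M7 →ₗ[ℝ] M7 := LinearMap.mulLeft ℝ ((P⁻¹ : M7ˣ) : M7) ∘ₗ LinearMap.mulRight ℝ (P : M7)
  have hφ : ∀ Z, φ Z = ((P⁻¹ : M7ˣ) : M7) * (Z * P) := fun Z => rfl
  have key : ∀ Z ∈ curvatureSpan h, φ Z ∈ curvatureSpan (conjSubalgebra P h) := by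
    intro Z hZ
    refine Submodule.span_le (p := (curvatureSpan (conjSubalgebra P h)).comap φ) |>.2 ?_ hZ
    rintro _ ⟨R, ⟨hR0, hRh, hRB⟩, x, y, rfl⟩
    let L : (Fin 7 → ℝ) →ₗ[ℝ] (Fin 7 → ℝ) := Matrix.mulVecLin (P : M7)
    have hL : ∀ x, (P : M7) *ᵥ (((P⁻¹ : M7ˣ) : M7) *ᵥ x) = x := by
      intro x
      rw [Matrix.mulVec_mulVec, hP, Matrix.one_mulVec]
    refine Submodule.subset_span ⟨(R.compl₁₂ L L).compr₂ φ, ⟨fun x => ?_, fun x y => ?_,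
      fun x y z => ?_⟩, ((P⁻¹ : M7ˣ) : M7) *ᵥ x, ((P⁻¹ : M7ˣ) : M7) *ᵥ y, ?_⟩
    · simp [hR0]
    · simp only [LinearMap.compr₂_apply, LinearMap.compl₁₂_apply, hφ, ← mul_assoc]
      exact inv_mul_mem_conjSubalgebra (hRh _ _)
    · simp only [LinearMap.compr₂_apply, LinearMap.compl₁₂_apply, hφ, ← Matrix.mulVec_mulVec,
        ← Matrix.mulVec_add]
      have := hRB (L x) (L y) (L z)
      simp only [L, Matrix.mulVecLin_apply] at this ⊢
      rw [this, Matrix.mulVec_zero]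
    · simp [L, hL]
  refine isBerger_of_le fun X hX => ?_
  have hX' : (P : M7) * X * (P⁻¹ : M7ˣ) ∈ h.toSubmodule := hX
  rw [hh] at hX'
  have := key _ hX'
  rw [hφ, mul_assoc, hP', mul_one, ← mul_assoc, hP', one_mul] at this
  exact this

theorem etaForm_mulVec_orthogonal {P : M7} (hP : Pᵀ * eta * P = eta) (x y : Fin 7 → ℝ) :
    etaForm (P *ᵥ x) (P *ᵥ y) = etaForm x y := by
  calc etaForm (P *ᵥ x) (P *ᵥ y) = x ⬝ᵥ ((Pᵀ * eta * P) *ᵥ y) := by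
        rw [etaForm_apply, ← Matrix.vecMul_transpose, ← Matrix.dotProduct_mulVec,
          Matrix.mulVec_mulVec, Matrix.mulVec_mulVec, mul_assoc]
    _ = etaForm x y := by rw [hP, etaForm_apply]

theorem IsIndecomposable.conj {h : LieSubalgebra ℝ M7} (hh : IsIndecomposable h) {P : M7ˣ}
    (hP : (P : M7)ᵀ * eta * P = eta) : IsIndecomposable (conjSubalgebra P h) := by
  intro W hW hn
  let L : (Fin 7 → ℝ) →ₗ[ℝ] (Fin 7 → ℝ) := Matrix.mulVecLin (P : M7)
  have hinj : Function.Injective L := by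
    intro x y hxy
    have := congrArg (((P⁻¹ : M7ˣ) : M7) *ᵥ ·) (show (P : M7) *ᵥ x = (P : M7) *ᵥ y from hxy)
    simpa [Matrix.mulVec_mulVec] using this
  have hsurj : Function.Surjective L := LinearMap.injective_iff_surjective.1 hinj
  have hinv : IsInvariant h (W.map L) := by
    rintro X hX _ ⟨w, hw, rfl⟩
    refine ⟨_, hW _ (inv_mul_mem_conjSubalgebra hX) w hw, ?_⟩
    simp only [L, Matrix.mulVecLin_apply, Matrix.mulVec_mulVec, ← mul_assoc, P.mul_inv, one_mul]
  have hnon : IsNondegenerate (W.map L) := by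
    rintro _ ⟨v, hv, rfl⟩ hvW
    have : v = 0 := by
      refine hn v hv fun w hw => ?_
      have h1 := hvW _ ⟨w, hw, rfl⟩
      rw [← etaForm_apply] at h1 ⊢
      rw [← etaForm_mulVec_orthogonal hP]
      exact h1
    rw [this, map_zero]
  rcases hh (W.map L) hinv hnon with h0 | h0
  · left
    refine eq_bot_iff.2 fun w hw => hinj ?_
    have : L w ∈ W.map L := ⟨w, hw, rfl⟩
    rw [h0, Submodule.mem_bot] at this
    rw [this, map_zero]
  · right
    have := congrArg (Submodule.comap L) h0
    rwa [Submodule.comap_map_eq_of_injective hinj, Submodule.comap_top] at this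

/-- An indecomposable Berger algebra consisting of matrices `h(A, v, y)`. -/
structure IsAdapted (h : LieSubalgebra ℝ M7) : Prop where
  range : ∀ X ∈ h, ∃ A v y, X = hMat A v y
  indecomposable : IsIndecomposable h
  berger : IsBerger h

theorem IsAdapted.conj {h : LieSubalgebra ℝ M7} (hh : IsAdapted h) {P : M7ˣ}
    (hP : (P : M7)ᵀ * eta * P = eta)
    (hr : ∀ A v y, ∃ A' v' y', hMat A v y * P = P * hMat A' v' y') :
    IsAdapted (conjSubalgebra P h) where
  range := by
    intro X hX
    obtain ⟨A, v, y, e⟩ := hh.range _ (mem_conjSubalgebra.1 hX)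
    obtain ⟨A', v', y', e'⟩ := hr A v y
    refine ⟨A', v', y', ?_⟩
    have : (P : M7) * X = P * hMat A' v' y' := by
      rw [← e', ← e, mul_assoc, P.inv_mul, mul_one]
    exact P.mul_right_inj.1 this
  indecomposable := hh.indecomposable.conj hP
  berger := hh.berger.conj P

/-! ### The matrix of an adapted frame -/

/-- The matrix with given columns. -/
def frameMatrix (b₁ b₂ b₃ b₄ b₅ b₆ b₇ : Fin 7 → ℝ) : M7 :=
  (Matrix.of ![b₁, b₂, b₃, b₄, b₅, b₆, b₇])ᵀ

theorem frameMatrix_mulVec (b₁ b₂ b₃ b₄ b₅ b₆ b₇ c : Fin 7 → ℝ) :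
    frameMatrix b₁ b₂ b₃ b₄ b₅ b₆ b₇ *ᵥ c =
      c 0 • b₁ + c 1 • b₂ + c 2 • b₃ + c 3 • b₄ + c 4 • b₅ + c 5 • b₆ + c 6 • b₇ := by
  ext i
  simp only [frameMatrix, Matrix.mulVec, dotProduct, Fin.sum_univ_seven, Matrix.transpose_apply,
    Matrix.of_apply, Matrix.cons_val, Pi.add_apply, Pi.smul_apply, smul_eq_mul]
  ring

theorem transpose_frameMatrix_mulVec (b₁ b₂ b₃ b₄ b₅ b₆ b₇ u : Fin 7 → ℝ) :
    (frameMatrix b₁ b₂ b₃ b₄ b₅ b₆ b₇)ᵀ *ᵥ (eta *ᵥ u) =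
      ![etaForm b₁ u, etaForm b₂ u, etaForm b₃ u, etaForm b₄ u, etaForm b₅ u, etaForm b₆ u,
        etaForm b₇ u] := by
  ext i
  simp only [etaForm_apply]
  fin_cases i <;> rfl

theorem frameMatrix_orthogonal {b₁ b₂ b₃ b₄ b₅ b₆ b₇ : Fin 7 → ℝ}
    (hg : ∀ i j, etaForm (![b₁, b₂, b₃, b₄, b₅, b₆, b₇] i) (![b₁, b₂, b₃, b₄, b₅, b₆, b₇] j) =
      eta i j) :
    (frameMatrix b₁ b₂ b₃ b₄ b₅ b₆ b₇)ᵀ * eta * frameMatrix b₁ b₂ b₃ b₄ b₅ b₆ b₇ = eta := by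
  ext i j
  rw [Matrix.mul_mul_apply, ← hg i j, etaForm_apply]
  rfl

/-- The missing vectors are the cross products with b₅ found in the standard basis: b₁ × b₅ = b₄, b₃
× b₅ = √2 b₆, b₂ × b₅ = -√2 b₇. As X is a derivation, its values on b₁, b₄, b₆, b₇ follow from those
on b₂, b₃, b₅, and they have the form prescribed by h(A, v, y). -/
theorem AdaptedFrame.exists_matrix {h : LieSubalgebra ℝ M7} (hg : h ≤ g2Star)
    {b₁ b₂ b₃ b₅ : Fin 7 → ℝ} (F : AdaptedFrame h b₁ b₂ b₃ b₅) :
    ∃ b₄ b₆ b₇, (frameMatrix b₁ b₂ b₃ b₄ b₅ b₆ b₇)ᵀ * eta * frameMatrix b₁ b₂ b₃ b₄ b₅ b₆ b₇ = eta ∧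
      ∀ X ∈ h, ∃ A v y, X * frameMatrix b₁ b₂ b₃ b₄ b₅ b₆ b₇ =
        frameMatrix b₁ b₂ b₃ b₄ b₅ b₆ b₇ * hMat A v y := by
  have hs2 : √2 ≠ 0 := by positivity
  have s2 : √2 * √2 = 2 := Real.mul_self_sqrt (by norm_num)
  have hi2 : √2 * (√2)⁻¹ = 1 := mul_inv_cancel₀ hs2
  obtain ⟨e11, e12, e13, e22, e23, e33, e15, e25, e35, e55, c12, c13, c23, hplane, -⟩ := F
  set b₄ := cross b₁ b₅ with hb₄
  set b₆ := (√2)⁻¹ • cross b₃ b₅ with hb₆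
  set b₇ := -((√2)⁻¹ • cross b₂ b₅) with hb₇
  have c35 : cross b₃ b₅ = √2 • b₆ := by rw [hb₆, smul_smul, hi2, one_smul]
  have c25 : cross b₂ b₅ = -(√2 • b₇) := by rw [hb₇, smul_neg, neg_neg, smul_smul, hi2, one_smul]
  have e21 : etaForm b₂ b₁ = 0 := by rw [etaForm_comm, e12]
  have e31 : etaForm b₃ b₁ = 0 := by rw [etaForm_comm, e13]
  have e32 : etaForm b₃ b₂ = 0 := by rw [etaForm_comm, e23]
  have e51 : etaForm b₅ b₁ = 1 := by rw [etaForm_comm, e15]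
  have e52 : etaForm b₅ b₂ = 0 := by rw [etaForm_comm, e25]
  have e53 : etaForm b₅ b₃ = 0 := by rw [etaForm_comm, e35]
  have c14 : cross b₁ b₄ = b₁ := by
    have := cross_cross_polarised b₁ b₁ b₅
    rw [e15, e11, ← two_smul ℝ, ← hb₄] at this
    have h2 : (2 : ℝ) • cross b₁ b₄ = (2 : ℝ) • b₁ := by rw [this]; module
    exact smul_right_injective _ two_ne_zero h2
  have cj4 : ∀ b, cross b₁ b = 0 → etaForm b₁ b = 0 → etaForm b b₅ = 0 → cross b b₄ = -b := by
    intro b hb hb1 hb5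
    have h1 := cross_cross_polarised b₅ b₁ b
    have h2 := cross_cross_polarised b b₁ b₅
    rw [hb, cross_zero_right, zero_add, etaForm_comm b₅ b, hb5, hb1, e51, cross_swap b₅ b,
      cross_neg_right] at h1
    rw [hb5, e15, etaForm_comm b b₁, hb1, ← hb₄] at h2
    have h3 : cross b₁ (cross b b₅) = (2 : ℝ) • b := by
      rw [← neg_inj, h1]; module
    rw [h3] at h2
    rw [eq_sub_of_add_eq h2]
    module
  have c24 := cj4 b₂ c12 e12 e25
  have c34 := cj4 b₃ c13 e13 e35
  have oc : ∀ u v, etaForm (cross u v) u = 0 := fun u v => by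
    rw [etaForm_cross]; simp only [omega, wedge3]; ring
  have oc' : ∀ u v, etaForm (cross u v) v = 0 := fun u v => by
    rw [etaForm_cross]; simp only [omega, wedge3]; ring
  have oz : ∀ u v w, etaForm (cross u v) w = -etaForm (cross u w) v := fun u v w => by
    rw [etaForm_cross, etaForm_cross]; simp only [omega, wedge3]; ring
  have e41 : etaForm b₄ b₁ = 0 := oc _ _
  have e45 : etaForm b₄ b₅ = 0 := oc' _ _
  have e42 : etaForm b₄ b₂ = 0 := by rw [hb₄, oz, c12]; simp
  have e43 : etaForm b₄ b₃ = 0 := by rw [hb₄, oz, c13]; simp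
  have e44 : etaForm b₄ b₄ = -1 := by rw [hb₄, etaForm_cross_cross, e11, e15]; norm_num
  have c31 : cross b₃ b₁ = 0 := by rw [cross_swap, c13, neg_zero]
  have c21 : cross b₂ b₁ = 0 := by rw [cross_swap, c12, neg_zero]
  have c32 : cross b₃ b₂ = -(√2 • b₁) := by rw [cross_swap, c23]
  have e61 : etaForm b₆ b₁ = 0 := by simp [hb₆, oz b₃ b₅ b₁, c31]
  have e62 : etaForm b₆ b₂ = 1 := by simp [hb₆, oz b₃ b₅ b₂, c32, e15, hs2]
  have e63 : etaForm b₆ b₃ = 0 := by simp [hb₆, oc]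
  have e64 : etaForm b₆ b₄ = 0 := by
    simp [hb₆, hb₄, etaForm_cross_cross, e31, e35]
  have e65 : etaForm b₆ b₅ = 0 := by simp [hb₆, oc']
  have e66 : etaForm b₆ b₆ = 0 := by simp [hb₆, etaForm_cross_cross, e33, e35]
  have e71 : etaForm b₇ b₁ = 0 := by simp [hb₇, oz b₂ b₅ b₁, c21]
  have e72 : etaForm b₇ b₂ = 0 := by simp [hb₇, oc]
  have e73 : etaForm b₇ b₃ = 1 := by simp [hb₇, oz b₂ b₅ b₃, c23, e15, hs2]
  have e74 : etaForm b₇ b₄ = 0 := by simp [hb₇, hb₄, etaForm_cross_cross, e21, e25]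
  have e75 : etaForm b₇ b₅ = 0 := by simp [hb₇, oc']
  have e76 : etaForm b₇ b₆ = 0 := by simp [hb₇, hb₆, etaForm_cross_cross, e23, e25]
  have e77 : etaForm b₇ b₇ = 0 := by simp [hb₇, etaForm_cross_cross, e22, e25]
  have hP : (frameMatrix b₁ b₂ b₃ b₄ b₅ b₆ b₇)ᵀ * eta * frameMatrix b₁ b₂ b₃ b₄ b₅ b₆ b₇ = eta := by
    clear_value b₄ b₆ b₇
    refine frameMatrix_orthogonal fun i j => ?_
    fin_cases i <;> fin_cases j <;>
      simp [eta, e11, e12, e13, e22, e23, e33, e15, e25, e35, e55, e21, e31, e32, e51, e52, e53,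
        e41,
        e45, e42, e43, e44, e61, e62, e63, e64, e65, e66, e71, e72, e73, e74, e75, e76, e77,
        etaForm_comm b₁ b₄, etaForm_comm b₁ b₆, etaForm_comm b₁ b₇, etaForm_comm b₂ b₄,
        etaForm_comm b₂ b₆, etaForm_comm b₂ b₇, etaForm_comm b₃ b₄, etaForm_comm b₃ b₆,
        etaForm_comm b₃ b₇, etaForm_comm b₄ b₆, etaForm_comm b₄ b₇, etaForm_comm b₅ b₄,
        etaForm_comm b₅ b₆, etaForm_comm b₅ b₇, etaForm_comm b₆ b₇]
  refine ⟨b₄, b₆, b₇, hP, fun X hX => ?_⟩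
  have hXg := hg hX
  have hskew : ∀ x y, etaForm x (X *ᵥ y) = -etaForm (X *ᵥ x) y := by
    intro x y
    rw [etaForm_apply, etaForm_apply, dotProduct_eta_skew (skew_of_mem_g2Star hXg), neg_neg]
  obtain ⟨A, hA2, hA3⟩ := hplane X hX
  have hX1 : X *ᵥ b₁ = A.trace • b₁ := by
    have h1 : X *ᵥ (√2 • b₁) = (√2 * A.trace) • b₁ := by
      rw [← c23, mulVec_cross hXg, hA2, hA3]
      simp only [cross_add_left, cross_add_right, cross_smul_left, cross_smul_right, cross_self,
        c23,
        Matrix.trace_fin_two]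
      module
    rw [Matrix.mulVec_smul, mul_smul] at h1
    exact smul_right_injective _ hs2 h1
  -- Coefficients are products with the dual basis. Skewness and the known values on b₁, b₂, b₃
  -- exclude components along b₁, b₆, b₇ and fix the one along b₅.
  obtain ⟨p, y₁, y₂, hX5⟩ : ∃ p y₁ y₂ : ℝ,
      X *ᵥ b₅ = y₁ • b₂ + y₂ • b₃ + p • b₄ - A.trace • b₅ := by
    have hc := congrArg (· *ᵥ (X *ᵥ b₅)) (orthUnit _ hP).mul_inv
    change (frameMatrix b₁ b₂ b₃ b₄ b₅ b₆ b₇ * (eta * (frameMatrix b₁ b₂ b₃ b₄ b₅ b₆ b₇)ᵀ * eta))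
      *ᵥ (X *ᵥ b₅) = 1 *ᵥ (X *ᵥ b₅) at hc
    rw [← Matrix.mulVec_mulVec, mul_assoc, ← Matrix.mulVec_mulVec, ← Matrix.mulVec_mulVec,
      transpose_frameMatrix_mulVec, Matrix.one_mulVec, frameMatrix_mulVec] at hc
    have h55 : etaForm b₅ (X *ᵥ b₅) = 0 := by
      have := hskew b₅ b₅
      rw [etaForm_comm (X *ᵥ b₅)] at this
      linarith
    refine ⟨-etaForm b₄ (X *ᵥ b₅), etaForm b₆ (X *ᵥ b₅), etaForm b₇ (X *ᵥ b₅), ?_⟩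
    have h1 : etaForm b₁ (X *ᵥ b₅) = -A.trace := by rw [hskew, hX1]; simp [e15]
    have h2 : etaForm b₂ (X *ᵥ b₅) = 0 := by rw [hskew, hA2]; simp [e25, e35]
    have h3 : etaForm b₃ (X *ᵥ b₅) = 0 := by rw [hskew, hA3]; simp [e25, e35]
    rw [h55, h1, h2, h3] at hc
    generalize etaForm b₄ (X *ᵥ b₅) = k₄ at hc ⊢
    generalize etaForm b₆ (X *ᵥ b₅) = k₆ at hc ⊢
    generalize etaForm b₇ (X *ᵥ b₅) = k₇ at hc ⊢
    rw [← hc]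
    simp [eta, Matrix.mulVec, dotProduct, Fin.sum_univ_seven]
    module
  refine ⟨A, p / √2, ![y₁, y₂], ?_⟩
  have hp : √2 * (p / √2) = p := mul_div_cancel₀ _ hs2
  have hX4 : X *ᵥ b₄ = p • b₁ := by
    rw [hb₄, mulVec_cross hXg, hX1, hX5, sub_eq_add_neg, ← neg_smul]
    simp only [cross_add_right, cross_smul_left, cross_smul_right, c12, c13, c14, ← hb₄]
    module
  have hX35 : X *ᵥ cross b₃ b₅ = -(A 0 1 * √2) • b₇ - (A 0 0 * √2) • b₆ - (y₁ * √2) • b₁ - p • b₃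
    := by
    rw [mulVec_cross hXg, hA3, hX5, sub_eq_add_neg, ← neg_smul]
    simp only [cross_add_left, cross_add_right, cross_smul_left, cross_smul_right, cross_self, c32,
      c34, c25, c35, Matrix.trace_fin_two]
    module
  have hX25 : X *ᵥ cross b₂ b₅ = (A 1 0 * √2) • b₆ + (A 1 1 * √2) • b₇ + (y₂ * √2) • b₁ - p • b₂
    := by
    rw [mulVec_cross hXg, hA2, hX5, sub_eq_add_neg, ← neg_smul]
    simp only [cross_add_left, cross_add_right, cross_smul_left, cross_smul_right, cross_self, c23,
      c24, c25, c35, Matrix.trace_fin_two]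
    module
  have hX6 : X *ᵥ b₆ = -A 0 1 • b₇ - A 0 0 • b₆ - y₁ • b₁ - (p / √2) • b₃ := by
    refine smul_right_injective _ hs2 ?_
    change √2 • (X *ᵥ b₆) = √2 • _
    rw [← Matrix.mulVec_smul, ← c35, hX35]
    simp only [smul_sub, smul_smul, hp]
    module
  have hX7 : X *ᵥ b₇ = -A 1 0 • b₆ - A 1 1 • b₇ - y₂ • b₁ + (p / √2) • b₂ := by
    refine smul_right_injective _ hs2 ?_
    change √2 • (X *ᵥ b₇) = √2 • _
    have : √2 • b₇ = -cross b₂ b₅ := by rw [c25, neg_neg]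
    rw [← Matrix.mulVec_smul, this, Matrix.mulVec_neg, hX25]
    simp only [smul_sub, smul_add, smul_smul, hp]
    module
  clear_value b₄ b₆ b₇
  apply Matrix.ext_of_mulVec_single
  intro j
  rw [← Matrix.mulVec_mulVec, ← Matrix.mulVec_mulVec, hMat_mulVec, frameMatrix_mulVec,
    frameMatrix_mulVec]
  fin_cases j <;>
    simp [hX1, hA2, hA3, hX4, hX5, hX6, hX7, hp] <;> module

/-- The last clause carries along the complete reducibility of the linear part on the plane of b₂,
b₃, which `IsAdapted` does not remember. -/
theorem IsPossibleTypeIII.exists_conj_isAdapted {h : LieSubalgebra ℝ M7}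
    (hh : IsPossibleTypeIII h) :
    ∃ P : M7ˣ, (P : M7)ᵀ * eta * P = eta ∧ IsAdapted (conjSubalgebra P h) ∧
      ∀ u : Fin 2 → ℝ, u ≠ 0 →
        (∀ A v y, hMat A v y ∈ conjSubalgebra P h → ∃ k : ℝ, A *ᵥ u = k • u) →
        ∃ u' : Fin 2 → ℝ, u 0 * u' 1 - u 1 * u' 0 ≠ 0 ∧
          ∀ A v y, hMat A v y ∈ conjSubalgebra P h → ∃ k : ℝ, A *ᵥ u' = k • u' := by
  obtain ⟨b₁, b₂, b₃, b₅, F⟩ := hh.exists_adaptedFrame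
  obtain ⟨b₄, b₆, b₇, hP, hX⟩ := F.exists_matrix hh.le_g2Star
  let P := orthUnit _ hP
  have hPv : (P : M7) = frameMatrix b₁ b₂ b₃ b₄ b₅ b₆ b₇ := rfl
  have hcol : ∀ c d : ℝ, (P : M7) *ᵥ ![0, c, d, 0, 0, 0, 0] = c • b₂ + d • b₃ := by
    intro c d
    rw [hPv, frameMatrix_mulVec]
    simp
  have hinj : ∀ x y : Fin 7 → ℝ, (P : M7) *ᵥ x = (P : M7) *ᵥ y → x = y := by
    intro x y hxy
    have := congrArg (((P⁻¹ : M7ˣ) : M7) *ᵥ ·) hxy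
    simpa [Matrix.mulVec_mulVec] using this
  have hact : ∀ (X : M7) A v y, X * P = P * hMat A v y → ∀ c d k : ℝ,
      (X *ᵥ (c • b₂ + d • b₃) = k • (c • b₂ + d • b₃) ↔ A *ᵥ ![c, d] = k • ![c, d]) := by
    intro X A v y e c d k
    rw [← hcol, Matrix.mulVec_mulVec, e, ← Matrix.mulVec_mulVec, ← Matrix.mulVec_smul]
    constructor
    · intro h1
      have h2 := hinj _ _ h1
      rw [hMat_mulVec] at h2
      have i1 := congrFun h2 1
      have i2 := congrFun h2 2
      ext i
      fin_cases i
      · simpa [Matrix.vecHead, Matrix.vecTail] using i1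
      · simpa [Matrix.vecHead, Matrix.vecTail] using i2
    · intro h1
      congr 1
      rw [hMat_mulVec]
      have i1 := congrFun h1 0
      have i2 := congrFun h1 1
      simp [Matrix.vecHead, Matrix.vecTail] at i1 i2
      ext i
      fin_cases i <;> simp [i1, i2]
  have hmem : ∀ A v y, hMat A v y ∈ conjSubalgebra P h →
      ∃ X ∈ h, X * P = P * hMat A v y := by
    intro A v y h1
    exact ⟨_, h1, by rw [mul_assoc, P.inv_mul, mul_one]⟩
  refine ⟨P, hP, ⟨?_, hh.indecomposable.conj hP, hh.berger.conj P⟩, ?_⟩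
  · intro Z hZ
    obtain ⟨A, v, y, e⟩ := hX _ (mem_conjSubalgebra.1 hZ)
    refine ⟨A, v, y, ?_⟩
    rw [← hPv, mul_assoc, P.inv_mul, mul_one] at e
    exact P.mul_right_inj.1 e
  · intro u hu hinv
    have hu' : u = ![u 0, u 1] := by ext i; fin_cases i <;> rfl
    have hne0 : u 0 • b₂ + u 1 • b₃ ≠ 0 := by
      intro h0
      rw [← hcol, ← Matrix.mulVec_zero (P : M7)] at h0
      have h1 := hinj _ _ h0
      have i1 := congrFun h1 1
      have i2 := congrFun h1 2
      refine hu ?_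
      rw [hu']
      simp at i1 i2
      rw [i1, i2]
      ext i
      fin_cases i <;> rfl
    have hinv0 : ∀ X ∈ h, ∃ k : ℝ, X *ᵥ (u 0 • b₂ + u 1 • b₃) = k • (u 0 • b₂ + u 1 • b₃) := by
      intro X hXh
      obtain ⟨A, v, y, e⟩ := hX X hXh
      obtain ⟨k, hk⟩ := hinv A v y ((mem_conjSubalgebra_of_mul_eq e).2 hXh)
      rw [hu'] at hk
      exact ⟨k, (hact X A v y e _ _ k).2 hk⟩
    obtain ⟨c', d', hne, hinv'⟩ := F.semisimple (u 0) (u 1) hne0 hinv0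
    refine ⟨![c', d'], by simpa using hne, fun A v y h1 => ?_⟩
    obtain ⟨X, hXh, e⟩ := hmem A v y h1
    obtain ⟨k, hk⟩ := hinv' X hXh
    exact ⟨k, (hact X A v y e c' d' k).1 hk⟩

/-! ### Algebraic curvature endomorphisms with values in the matrices `h(A, v, y)` -/

theorem etaForm_hMat_mulVec (A : M2) (v : ℝ) (y : Fin 2 → ℝ) (x z : Fin 7 → ℝ) :
    etaForm (hMat A v y *ᵥ x) z = -etaForm x (hMat A v y *ᵥ z) := by
  rw [etaForm_apply, etaForm_apply,
    dotProduct_eta_skew (skew_of_mem_g2Star (hMat_mem_g2Star A v y))]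

theorem curvature_swap {h : LieSubalgebra ℝ M7} {R : (Fin 7 → ℝ) →ₗ[ℝ] (Fin 7 → ℝ) →ₗ[ℝ] M7}
    (hR : R ∈ curvatureSpace h) (x y : Fin 7 → ℝ) : R y x = -R x y := by
  have := hR.1 (x + y)
  simp only [map_add, LinearMap.add_apply, hR.1 x, hR.1 y, zero_add, add_zero] at this
  exact eq_neg_of_add_eq_zero_left this

/-- The classical consequence of skewness in each pair and the Bianchi identity, summed over four
cyclic triples. -/
theorem curvature_pair_symm {h : LieSubalgebra ℝ M7} (hr : ∀ X ∈ h, ∃ A v y, X = hMat A v y)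
    {R : (Fin 7 → ℝ) →ₗ[ℝ] (Fin 7 → ℝ) →ₗ[ℝ] M7} (hR : R ∈ curvatureSpace h)
    (x y z w : Fin 7 → ℝ) : etaForm (R x y *ᵥ z) w = etaForm (R z w *ᵥ x) y := by
  have ha : ∀ x y z w, etaForm (R y x *ᵥ z) w = -etaForm (R x y *ᵥ z) w := by
    intro x y z w
    rw [curvature_swap hR x y, Matrix.neg_mulVec, map_neg, LinearMap.neg_apply]
  have hs : ∀ x y z w, etaForm (R x y *ᵥ w) z = -etaForm (R x y *ᵥ z) w := by
    intro x y z w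
    obtain ⟨A, v, y', e⟩ := hr _ (hR.2.1 x y)
    rw [e, etaForm_hMat_mulVec, etaForm_comm]
  have hB : ∀ x y z w, etaForm (R x y *ᵥ z) w + etaForm (R y z *ᵥ x) w +
      etaForm (R z x *ᵥ y) w = 0 := by
    intro x y z w
    have := congrArg (fun u => etaForm u w) (hR.2.2 x y z)
    simpa using this
  linarith [hB z x y w, hB x y w z, hB y w z x, hB w z x y, hs x y z w, hs y w z x, hs w z x y,
    hs z x y w, ha w z x y, ha z x y w, ha z y x w, ha x w y z, ha w y x z, hs y w x z, hs z y x w,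
    hs x w y z, hs w y x z, ha y w x z, ha y z x w, hs y z x w]

/-- By pair symmetry ⟨R(x, y)z, w⟩ = ⟨R(z, w)x, y⟩, and R(z, w) is some h(A, v, y). The right-hand
side thus depends on x ∧ y only through seven coordinates, dual to the 4 + 1 + 2 parameters of h(A,
v, y). -/
theorem curvature_eq {h : LieSubalgebra ℝ M7} (hr : ∀ X ∈ h, ∃ A v y, X = hMat A v y)
    {R : (Fin 7 → ℝ) →ₗ[ℝ] (Fin 7 → ℝ) →ₗ[ℝ] M7} (hR : R ∈ curvatureSpace h)
    (x y : Fin 7 → ℝ) :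
    R x y = (x 4 * y 5 - x 5 * y 4) • R (Pi.single 4 1) (Pi.single 5 1)
      + (x 4 * y 6 - x 6 * y 4) • R (Pi.single 4 1) (Pi.single 6 1)
      + (√2 * (x 4 * y 3 - x 3 * y 4) + (x 5 * y 6 - x 6 * y 5)) •
        R (Pi.single 5 1) (Pi.single 6 1)
      + ((x 4 * y 0 - x 0 * y 4) + (x 5 * y 1 - x 1 * y 5)) • R (Pi.single 5 1) (Pi.single 1 1)
      + ((x 4 * y 0 - x 0 * y 4) + (x 6 * y 2 - x 2 * y 6)) • R (Pi.single 6 1) (Pi.single 2 1)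
      + (x 5 * y 2 - x 2 * y 5) • R (Pi.single 5 1) (Pi.single 2 1)
      + (x 6 * y 1 - x 1 * y 6) • R (Pi.single 6 1) (Pi.single 1 1) := by
  apply Matrix.ext_of_mulVec_single
  intro k
  refine eq_of_forall_etaForm fun w => ?_
  generalize (Pi.single k 1 : Fin 7 → ℝ) = z
  simp only [Matrix.add_mulVec, Matrix.smul_mulVec, map_add, LinearMap.add_apply, map_smul,
    LinearMap.smul_apply, smul_eq_mul, curvature_pair_symm hr hR _ _ z w]
  obtain ⟨A, v, y', e⟩ := hr _ (hR.2.1 z w)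
  rw [e]
  simp only [hMat_mulVec, etaForm_eq, Matrix.cons_val]
  simp [Matrix.trace_fin_two, Pi.single_apply]
  ring

/-- The values of an algebraic curvature endomorphism on the pairs of basis vectors which matter
lie in `T`, expressed through independent parameters. -/
structure CurvatureData (T : Submodule ℝ M7) (A₁ A₂ : M2) (v₁ v₂ y₁₁ y₁₂ y₂₂ p q r s t : ℝ) :
    Prop where
  pair : IsCurvaturePair A₁ A₂
  mem₄₅ : hMat A₁ v₁ ![y₁₁, y₁₂] ∈ T
  mem₄₆ : hMat A₂ v₂ ![y₁₂, y₂₂] ∈ T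
  mem₅₆ : hMat 0 0 ![-v₁, -v₂] ∈ T
  mem₅₁ : hMat !![p, q; r, -p] 0 ![-A₁ 0 0, -A₁ 1 0] ∈ T
  mem₆₁ : hMat !![r, -p; s, -r] 0 ![-A₂ 0 0, -A₂ 1 0] ∈ T
  mem₅₂ : hMat !![q, t; -p, -q] 0 ![-A₁ 0 1, -A₁ 1 1] ∈ T
  mem₆₂ : hMat !![-p, -q; -r, p] 0 ![-A₂ 0 1, -A₂ 1 1] ∈ T

/-- The seven remaining values are tied together by the Bianchi identity on nine triples of basis
vectors; p, q, r, s, t are the free coefficients of the linear parts of the values at pairs with b₂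
or b₃. The quantifier over `T` lets the same parameters be tested in 𝔥 and in an auxiliary subspace.
-/
theorem exists_curvatureData {h : LieSubalgebra ℝ M7} (hr : ∀ X ∈ h, ∃ A v y, X = hMat A v y)
    {R : (Fin 7 → ℝ) →ₗ[ℝ] (Fin 7 → ℝ) →ₗ[ℝ] M7} (hR : R ∈ curvatureSpace h) :
    ∃ A₁ A₂ v₁ v₂ y₁₁ y₁₂ y₂₂ p q r s t, ∀ T : Submodule ℝ M7,
      (∀ x y, R x y ∈ T) ↔ CurvatureData T A₁ A₂ v₁ v₂ y₁₁ y₁₂ y₂₂ p q r s t := by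
  have hB := hR.2.2
  have hsw := fun i j : Fin 7 => curvature_swap hR (Pi.single i 1) (Pi.single j 1)
  have z14 : R (Pi.single 1 1) (Pi.single 4 1) = 0 := by
    rw [curvature_eq hr hR]; simp
  have z24 : R (Pi.single 2 1) (Pi.single 4 1) = 0 := by
    rw [curvature_eq hr hR]; simp
  have z12 : R (Pi.single 1 1) (Pi.single 2 1) = 0 := by
    rw [curvature_eq hr hR]; simp
  obtain ⟨A₁, v₁, y₁, m45⟩ := hr _ (hR.2.1 (Pi.single 4 1) (Pi.single 5 1))
  obtain ⟨A₂, v₂, y₂, m46⟩ := hr _ (hR.2.1 (Pi.single 4 1) (Pi.single 6 1))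
  obtain ⟨B, v, y, m56⟩ := hr _ (hR.2.1 (Pi.single 5 1) (Pi.single 6 1))
  obtain ⟨B₅₁, v₅₁, y₅₁, m51⟩ := hr _ (hR.2.1 (Pi.single 5 1) (Pi.single 1 1))
  obtain ⟨B₆₁, v₆₁, y₆₁, m61⟩ := hr _ (hR.2.1 (Pi.single 6 1) (Pi.single 1 1))
  obtain ⟨B₅₂, v₅₂, y₅₂, m52⟩ := hr _ (hR.2.1 (Pi.single 5 1) (Pi.single 2 1))
  obtain ⟨B₆₂, v₆₂, y₆₂, m62⟩ := hr _ (hR.2.1 (Pi.single 6 1) (Pi.single 2 1))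
  have hs2 : √2 ≠ 0 := by positivity
  have b451 := hB (Pi.single 4 1) (Pi.single 5 1) (Pi.single 1 1)
  have b461 := hB (Pi.single 4 1) (Pi.single 6 1) (Pi.single 1 1)
  have b452 := hB (Pi.single 4 1) (Pi.single 5 1) (Pi.single 2 1)
  have b462 := hB (Pi.single 4 1) (Pi.single 6 1) (Pi.single 2 1)
  have b561 := hB (Pi.single 5 1) (Pi.single 6 1) (Pi.single 1 1)
  have b562 := hB (Pi.single 5 1) (Pi.single 6 1) (Pi.single 2 1)
  have b456 := hB (Pi.single 4 1) (Pi.single 5 1) (Pi.single 6 1)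
  have b125 := hB (Pi.single 1 1) (Pi.single 2 1) (Pi.single 5 1)
  have b126 := hB (Pi.single 1 1) (Pi.single 2 1) (Pi.single 6 1)
  rw [m45, m51, z14] at b451
  rw [m46, m61, z14] at b461
  rw [m45, m52, z24] at b452
  rw [m46, m62, z24] at b462
  rw [m56, m61, hsw 5 1, m51] at b561
  rw [m56, m62, hsw 5 2, m52] at b562
  rw [m45, m56, hsw 4 6, m46] at b456
  rw [z12, hsw 5 2, m52, m51] at b125
  rw [z12, hsw 6 2, m62, m61] at b126
  simp only [hMat_mulVec, Matrix.neg_mulVec, Matrix.zero_mulVec] at b451 b461 b452 b462 b561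
  simp only [hMat_mulVec, Matrix.neg_mulVec, Matrix.zero_mulVec] at b562 b456 b125 b126
  have i451 := fun i => congrFun b451 i
  have i461 := fun i => congrFun b461 i
  have i452 := fun i => congrFun b452 i
  have i462 := fun i => congrFun b462 i
  have i561 := fun i => congrFun b561 i
  have i562 := fun i => congrFun b562 i
  have i456 := fun i => congrFun b456 i
  have i125 := fun i => congrFun b125 i
  have i126 := fun i => congrFun b126 i
  clear b451 b461 b452 b462 b561 b562 b456 b125 b126
  simp [Fin.forall_fin_succ, Matrix.trace_fin_two, hs2] at i451 i461 i452 i462 i561 i562 i456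
  simp [Fin.forall_fin_succ] at i125 i126
  obtain ⟨i1, i2, i3, i4⟩ := i451
  obtain ⟨j1, j2, j3, j4⟩ := i461
  obtain ⟨k1, k2, k3, k4⟩ := i452
  obtain ⟨l1, l2, l3, l4⟩ := i462
  obtain ⟨-, o2, o3, o4, o5⟩ := i561
  obtain ⟨-, n2, n3, n4, n5⟩ := i562
  obtain ⟨q1, q2, q3, q4, -, q6, q7⟩ := i456
  obtain ⟨w1, w2⟩ := i125
  obtain ⟨x1, x2⟩ := i126
  have ext_hMat : ∀ {A A' : M2} {v v' : ℝ} {y y' : Fin 2 → ℝ}, A 0 0 = A' 0 0 → A 0 1 = A' 0 1 →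
      A 1 0 = A' 1 0 → A 1 1 = A' 1 1 → v = v' → y 0 = y' 0 → y 1 = y' 1 →
      hMat A v y = hMat A' v' y' := by
    intro A A' v v' y y' a1 a2 a3 a4 hv y1 y2
    congr 1
    · ext i j; fin_cases i <;> fin_cases j <;> assumption
    · ext i; fin_cases i <;> assumption
  have e45 : hMat A₁ v₁ y₁ = hMat A₁ v₁ ![y₁ 0, y₁ 1] := by
    apply ext_hMat <;> simp
  have e46 : hMat A₂ v₂ y₂ = hMat A₂ v₂ ![y₁ 1, y₂ 1] := by
    apply ext_hMat <;> first | (simp; done) | (simp; linarith) | linarith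
  have e56 : hMat B v y = hMat 0 0 ![-v₁, -v₂] := by
    apply ext_hMat <;> first | (simp; done) | (simp; linarith) | linarith
  have e51 : hMat B₅₁ v₅₁ y₅₁ =
      hMat !![B₅₁ 0 0, B₅₁ 0 1; B₅₁ 1 0, -B₅₁ 0 0] 0 ![-A₁ 0 0, -A₁ 1 0] := by
    apply ext_hMat <;> first | (simp; done) | (simp; linarith) | linarith
  have e61 : hMat B₆₁ v₆₁ y₆₁ =
      hMat !![B₅₁ 1 0, -B₅₁ 0 0; B₆₁ 1 0, -B₅₁ 1 0] 0 ![-A₂ 0 0, -A₂ 1 0] := by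
    apply ext_hMat <;> first | (simp; done) | (simp; linarith) | linarith
  have e52 : hMat B₅₂ v₅₂ y₅₂ =
      hMat !![B₅₁ 0 1, B₅₂ 0 1; -B₅₁ 0 0, -B₅₁ 0 1] 0 ![-A₁ 0 1, -A₁ 1 1] := by
    apply ext_hMat <;> first | (simp; done) | (simp; linarith) | linarith
  have e62 : hMat B₆₂ v₆₂ y₆₂ =
      hMat !![-B₅₁ 0 0, -B₅₁ 0 1; -B₅₁ 1 0, B₅₁ 0 0] 0 ![-A₂ 0 1, -A₂ 1 1] := by
    apply ext_hMat <;> first | (simp; done) | (simp; linarith) | linarith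
  refine ⟨A₁, A₂, v₁, v₂, y₁ 0, y₁ 1, y₂ 1, B₅₁ 0 0, B₅₁ 0 1, B₅₁ 1 0, B₆₁ 1 0, B₅₂ 0 1,
    fun T => ⟨fun hT => ⟨⟨by linarith, by linarith⟩, ?_, ?_, ?_, ?_, ?_, ?_, ?_⟩,
      fun D x y => ?_⟩⟩
  · rw [← e45, ← m45]; exact hT _ _
  · rw [← e46, ← m46]; exact hT _ _
  · rw [← e56, ← m56]; exact hT _ _
  · rw [← e51, ← m51]; exact hT _ _
  · rw [← e61, ← m61]; exact hT _ _
  · rw [← e52, ← m52]; exact hT _ _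
  · rw [← e62, ← m62]; exact hT _ _
  · rw [curvature_eq hr hR, m45, m46, m56, m51, m61, m52, m62, e45, e46, e56, e51, e61, e52, e62]
    exact add_mem (add_mem (add_mem (add_mem (add_mem (add_mem (T.smul_mem _ D.mem₄₅)
      (T.smul_mem _ D.mem₄₆)) (T.smul_mem _ D.mem₅₆)) (T.smul_mem _ D.mem₅₁))
      (T.smul_mem _ D.mem₆₂)) (T.smul_mem _ D.mem₅₂)) (T.smul_mem _ D.mem₆₁)

/-- Berger's criterion in working form. With `T` the kernel of a matrix entry it shows that a
parameter which vanishes on all curvature values vanishes on 𝔥. -/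
theorem IsAdapted.le_of_curvatureData {h : LieSubalgebra ℝ M7} (hh : IsAdapted h)
    {T : Submodule ℝ M7}
    (hT : ∀ A₁ A₂ v₁ v₂ y₁₁ y₁₂ y₂₂ p q r s t,
      CurvatureData h.toSubmodule A₁ A₂ v₁ v₂ y₁₁ y₁₂ y₂₂ p q r s t →
      CurvatureData T A₁ A₂ v₁ v₂ y₁₁ y₁₂ y₂₂ p q r s t) : h.toSubmodule ≤ T := by
  rw [hh.berger, Submodule.span_le]
  rintro _ ⟨R, hR, x, y, rfl⟩
  obtain ⟨A₁, A₂, v₁, v₂, y₁₁, y₁₂, y₂₂, p, q, r, s, t, hdata⟩ := exists_curvatureData hh.range hR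
  exact (hdata T).2 (hT _ _ _ _ _ _ _ _ _ _ _ _ ((hdata h.toSubmodule).1 hR.2.1)) x y

/-- If v = t tr A throughout 𝔥, then 𝔥 annihilates b₄ - √2 t b₁, a vector of square -1, and the line
it spans contradicts indecomposability. -/
theorem IsAdapted.exists_ne_smul_trace {h : LieSubalgebra ℝ M7} (hh : IsAdapted h) (t : ℝ) :
    ∃ A v y, hMat A v y ∈ h ∧ v ≠ t * A.trace := by
  by_contra! hv
  have s2 : √2 * √2 = 2 := Real.mul_self_sqrt (by norm_num)
  set w : Fin 7 → ℝ := ![-(√2 * t), 0, 0, 1, 0, 0, 0] with hw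
  have hww : etaForm w w = -1 := by rw [etaForm_eq]; simp [hw]
  have hw0 : w ≠ 0 := by
    intro h0
    rw [h0] at hww
    simp at hww
  have hinv : IsInvariant h (Submodule.span ℝ {w}) := by
    intro X hX u hu
    obtain ⟨c, rfl⟩ := Submodule.mem_span_singleton.1 hu
    obtain ⟨A, v, y, rfl⟩ := hh.range X hX
    have hz : hMat A v y *ᵥ w = 0 := by
      rw [hMat_mulVec, hv A v y hX]
      ext i
      fin_cases i <;> simp [hw]
      ring
    rw [Matrix.mulVec_smul, hz, smul_zero]
    exact Submodule.zero_mem _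
  have hnon : IsNondegenerate (Submodule.span ℝ {w}) := by
    intro u hu hu'
    obtain ⟨c, rfl⟩ := Submodule.mem_span_singleton.1 hu
    have := hu' w (Submodule.mem_span_singleton_self w)
    rw [← etaForm_apply] at this
    simp [hww] at this
    simp [this]
  rcases hh.indecomposable (Submodule.span ℝ {w}) hinv hnon with h0 | h0
  · rw [Submodule.span_singleton_eq_bot] at h0
    exact hw0 h0
  · have := finrank_span_singleton (K := ℝ) hw0
    rw [h0, finrank_top] at this
    simp at this

/-! ### The linear part and the translation part -/

/-- The projection of `𝔥` to `𝔤𝔩(2)`. -/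
def linearPart (h : LieSubalgebra ℝ M7) : LieSubalgebra ℝ M2 where
  carrier := {A | ∃ v y, hMat A v y ∈ h}
  zero_mem' := ⟨0, 0, by rw [WaveData.hMat_zero]; exact zero_mem h⟩
  add_mem' := by
    rintro A B ⟨v, y, hA⟩ ⟨w, z, hB⟩
    exact ⟨v + w, y + z, by rw [← hMat_add]; exact add_mem hA hB⟩
  smul_mem' := by
    rintro c A ⟨v, y, hA⟩
    exact ⟨c * v, c • y, by rw [← hMat_smul]; exact h.smul_mem c hA⟩
  lie_mem' := by
    rintro A B ⟨v, y, hA⟩ ⟨w, z, hB⟩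
    exact ⟨_, _, by rw [← hMat_lie]; exact h.lie_mem hA hB⟩

theorem mem_linearPart {h : LieSubalgebra ℝ M7} {A : M2} :
    A ∈ linearPart h ↔ ∃ v y, hMat A v y ∈ h := Iff.rfl

/-- The vectors `y` with `h(0, 0, y) ∈ 𝔥`. -/
def translationPart (h : LieSubalgebra ℝ M7) : Submodule ℝ (Fin 2 → ℝ) where
  carrier := {y | hMat 0 0 y ∈ h}
  zero_mem' := by
    change hMat 0 0 0 ∈ h
    rw [WaveData.hMat_zero]; exact zero_mem h
  add_mem' := by
    intro y z (hy : _ ∈ h) (hz : _ ∈ h)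
    have := add_mem hy hz
    rw [hMat_add] at this
    simpa using this
  smul_mem' := by
    intro c y (hy : _ ∈ h)
    have := h.smul_mem c hy
    rw [hMat_smul] at this
    simpa using this

theorem mem_translationPart {h : LieSubalgebra ℝ M7} {y : Fin 2 → ℝ} :
    y ∈ translationPart h ↔ hMat 0 0 y ∈ h := Iff.rfl

theorem hMat_sub_mem {h : LieSubalgebra ℝ M7} {A B : M2} {v w : ℝ} {y z : Fin 2 → ℝ}
    (h1 : hMat A v y ∈ h) (h2 : hMat B w z ∈ h) (c : ℝ) :
    hMat (A - c • B) (v - c * w) (y - c • z) ∈ h := by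
  have := add_mem h1 (h.smul_mem (-c) h2)
  rw [hMat_smul, hMat_add] at this
  convert this using 2
  · rw [neg_smul, sub_eq_add_neg]
  · ring
  · rw [neg_smul, sub_eq_add_neg]

theorem mulVec_mem_translationPart {h : LieSubalgebra ℝ M7} {A : M2} (hA : A ∈ linearPart h)
    {z : Fin 2 → ℝ} (hz : z ∈ translationPart h) :
    A *ᵥ z + A.trace • z ∈ translationPart h := by
  obtain ⟨v, y, hA⟩ := hA
  have := h.lie_mem hA hz
  rw [hMat_lie] at this
  rw [mem_translationPart]
  convert this using 2 <;> simp

theorem eq_top_of_det_ne_zero {Y : Submodule ℝ (Fin 2 → ℝ)} {u u' : Fin 2 → ℝ} (hu : u ∈ Y)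
    (hu' : u' ∈ Y) (hd : u 0 * u' 1 - u 1 * u' 0 ≠ 0) : Y = ⊤ := by
  refine eq_top_iff.2 fun y _ => ?_
  have := Y.add_mem (Y.smul_mem ((y 0 * u' 1 - y 1 * u' 0) / (u 0 * u' 1 - u 1 * u' 0)) hu)
    (Y.smul_mem ((u 0 * y 1 - u 1 * y 0) / (u 0 * u' 1 - u 1 * u' 0)) hu')
  convert this using 1
  ext i
  fin_cases i
  · simp only [Fin.zero_eta, Fin.mk_one, Pi.add_apply, Pi.smul_apply, smul_eq_mul]
    rw [div_mul_eq_mul_div, div_mul_eq_mul_div, ← add_div, eq_div_iff hd]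
    ring
  · simp only [Fin.zero_eta, Fin.mk_one, Pi.add_apply, Pi.smul_apply, smul_eq_mul]
    rw [div_mul_eq_mul_div, div_mul_eq_mul_div, ← add_div, eq_div_iff hd]
    ring

/-- The value R(b₆, b₇) is h(0, 0, (-v₁, -v₂)). Without translations all curvature values, and with
them all of 𝔥, would have v = 0, contrary to the case t = 0 of `IsAdapted.exists_ne_smul_trace`. -/
theorem IsAdapted.exists_mem_translationPart {h : LieSubalgebra ℝ M7} (hh : IsAdapted h) :
    ∃ z ∈ translationPart h, z ≠ 0 := by
  by_contra! hz
  obtain ⟨A, v, y, hA, hv⟩ := hh.exists_ne_smul_trace 0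
  rw [zero_mul] at hv
  let T : Submodule ℝ M7 := LinearMap.ker (Matrix.entryLinearMap ℝ ℝ (1 : Fin 7) (6 : Fin 7))
  have hT : ∀ A v y, hMat A v y ∈ T ↔ v = 0 := fun A v y => Iff.rfl
  refine hv ((hT A v y).1 (hh.le_of_curvatureData (T := T) ?_ hA))
  intro A₁ A₂ v₁ v₂ y₁₁ y₁₂ y₂₂ p q r s t D
  have h0 := hz _ (mem_translationPart.2 D.mem₅₆)
  have h1 : v₁ = 0 := by simpa using congrFun h0 0
  have h2 : v₂ = 0 := by simpa using congrFun h0 1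
  exact ⟨D.pair, (hT ..).2 h1, (hT ..).2 h2, (hT ..).2 rfl, (hT ..).2 rfl, (hT ..).2 rfl,
    (hT ..).2 rfl, (hT ..).2 rfl⟩

/-- Bracketing with an element over a central `B` removes the linear part and leaves (tr A) w - v tr
B in place of v; the choice t = w / tr B makes this non-zero. -/
theorem IsAdapted.exists_hMat_zero_one {h : LieSubalgebra ℝ M7} (hh : IsAdapted h) {B : M2}
    (hB : B ∈ linearPart h) (ht : B.trace ≠ 0) (hc : ∀ A ∈ linearPart h, ⁅A, B⁆ = 0) :
    ∃ y, hMat 0 1 y ∈ h := by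
  obtain ⟨w, z, hB⟩ := hB
  obtain ⟨A, v, y, hA, hv⟩ := hh.exists_ne_smul_trace (w / B.trace)
  have hne : A.trace * w - v * B.trace ≠ 0 := by
    intro h0
    apply hv
    field_simp
    linarith
  have := h.smul_mem (A.trace * w - v * B.trace)⁻¹ (h.lie_mem hA hB)
  rw [hMat_lie, hMat_smul, hc A ⟨v, y, hA⟩, smul_zero, inv_mul_cancel₀ hne] at this
  exact ⟨_, this⟩

theorem IsAdapted.exists_hMat_zero_one_of_bot {h : LieSubalgebra ℝ M7} (hh : IsAdapted h)
    (h0 : linearPart h = ⊥) : ∃ y, hMat 0 1 y ∈ h := by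
  obtain ⟨A, v, y, hA, hv⟩ := hh.exists_ne_smul_trace 0
  rw [zero_mul] at hv
  have hA0 : A ∈ linearPart h := ⟨v, y, hA⟩
  rw [h0, LieSubalgebra.mem_bot] at hA0
  have := h.smul_mem v⁻¹ hA
  rw [hMat_smul, hA0, smul_zero, inv_mul_cancel₀ hv] at this
  exact ⟨_, this⟩

theorem IsAdapted.eq_semi12 {h : LieSubalgebra ℝ M7} (hh : IsAdapted h)
    (hY : translationPart h = ⊤) (hv : ∃ y, hMat 0 1 y ∈ h) : h = semi12 (linearPart h) := by
  have hy : ∀ y, hMat 0 0 y ∈ h := fun y => by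
    rw [← mem_translationPart, hY]; trivial
  have h1 : hMat 0 1 0 ∈ h := by
    obtain ⟨y, hv⟩ := hv
    simpa using hMat_sub_mem hv (hy y) 1
  refine le_antisymm (fun X hX => ?_) (semi12_le h1 (hy _) (hy _) ?_)
  · obtain ⟨A, v, y, rfl⟩ := hh.range X hX
    exact mem_semi12 (mem_linearPart.2 ⟨v, y, hX⟩) v y
  · rintro A ⟨v, y, hA⟩
    have := hMat_sub_mem (hMat_sub_mem hA h1 v) (hy y) 1
    simpa using this

/-! ### Subalgebras of `𝔤𝔩(2, ℝ)` -/

theorem ext_M2 {A B : M2} (h1 : A 0 0 = B 0 0) (h2 : A 0 1 = B 0 1) (h3 : A 1 0 = B 1 0)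
    (h4 : A 1 1 = B 1 1) : A = B := by
  ext i j
  fin_cases i <;> fin_cases j <;> assumption

theorem lie_fin_two (A B : M2) :
    ⁅A, B⁆ = !![A 0 1 * B 1 0 - B 0 1 * A 1 0,
      (A 0 0 - A 1 1) * B 0 1 - (B 0 0 - B 1 1) * A 0 1;
      (A 1 1 - A 0 0) * B 1 0 - (B 1 1 - B 0 0) * A 1 0, A 1 0 * B 0 1 - B 1 0 * A 0 1] := by
  rw [Ring.lie_def]
  apply ext_M2 <;> simp only [Matrix.sub_apply, Matrix.mul_apply, Fin.sum_univ_two] <;> simp <;>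
    ring

/-- The discriminant of the characteristic polynomial. -/
def disc (A : M2) : ℝ := (A 0 0 - A 1 1) ^ 2 + 4 * A 0 1 * A 1 0

theorem disc_eq (A : M2) : disc A = A.trace ^ 2 - 4 * A.det := by
  rw [disc, Matrix.trace_fin_two, Matrix.det_fin_two]; ring

theorem disc_conj (g : M2ˣ) (A : M2) : disc (g.val * A * (g⁻¹).val) = disc A := by
  rw [disc_eq, disc_eq, Matrix.trace_units_conj, Matrix.det_units_conj]

/-- The invertible matrix with columns `u` and `w`. -/
def columnUnit (u w : Fin 2 → ℝ) (hd : u 0 * w 1 - u 1 * w 0 ≠ 0) : M2ˣ :=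
  Matrix.GeneralLinearGroup.mkOfDetNeZero !![u 0, w 0; u 1, w 1] (by
    rw [Matrix.det_fin_two_of]
    intro h
    exact hd (by linarith))

theorem columnUnit_val (u w : Fin 2 → ℝ) (hd : u 0 * w 1 - u 1 * w 0 ≠ 0) :
    (columnUnit u w hd).val = !![u 0, w 0; u 1, w 1] := rfl

theorem exists_eigenvector {A : M2} {k : ℝ} (hk : (A 0 0 - k) * (A 1 1 - k) - A 0 1 * A 1 0 = 0) :
    ∃ u : Fin 2 → ℝ, u ≠ 0 ∧ A *ᵥ u = k • u := by
  have hdet : (A - k • (1 : M2)).det = 0 := by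
    rw [Matrix.det_fin_two]
    simp
    linarith
  obtain ⟨u, hu, h0⟩ := Matrix.exists_mulVec_eq_zero_iff.2 hdet
  refine ⟨u, hu, ?_⟩
  rw [Matrix.sub_mulVec, Matrix.smul_mulVec, Matrix.one_mulVec] at h0
  exact sub_eq_zero.1 h0

theorem mulVec_fin_two (A : M2) (u : Fin 2 → ℝ) :
    A *ᵥ u = ![A 0 0 * u 0 + A 0 1 * u 1, A 1 0 * u 0 + A 1 1 * u 1] := by
  ext i
  fin_cases i <;> simp [Matrix.mulVec, dotProduct, Fin.sum_univ_two]

theorem eigenvector_iff {A : M2} {u : Fin 2 → ℝ} {k : ℝ} :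
    A *ᵥ u = k • u ↔ A 0 0 * u 0 + A 0 1 * u 1 = k * u 0 ∧ A 1 0 * u 0 + A 1 1 * u 1 = k * u 1 := by
  rw [mulVec_fin_two, funext_iff, Fin.forall_fin_two]
  simp

theorem eigenvector_of_conj {a : LieSubalgebra ℝ M2} {g : M2ˣ} {u : Fin 2 → ℝ}
    (h : ∀ B ∈ conjSubalgebra g a, ∃ k : ℝ, B *ᵥ u = k • u) (A : M2) (hA : A ∈ a) :
    ∃ k : ℝ, A *ᵥ (g.val *ᵥ u) = k • (g.val *ᵥ u) := by
  obtain ⟨k, hk⟩ := h _ (inv_mul_mem_conjSubalgebra hA)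
  refine ⟨k, ?_⟩
  rw [← Matrix.mulVec_smul, ← hk, Matrix.mulVec_mulVec, Matrix.mulVec_mulVec, ← mul_assoc,
    ← mul_assoc, g.mul_inv, one_mul]

theorem unit_mulVec_ne_zero (g : M2ˣ) {u : Fin 2 → ℝ} (hu : u ≠ 0) : g.val *ᵥ u ≠ 0 := by
  intro h0
  refine hu ?_
  rw [← Matrix.one_mulVec u, ← g.inv_mul, ← Matrix.mulVec_mulVec, h0, Matrix.mulVec_zero]

theorem single_ne_zero_two (i : Fin 2) : (Pi.single i 1 : Fin 2 → ℝ) ≠ 0 := by simp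

theorem exists_common_eigenvector_of_upper {a : LieSubalgebra ℝ M2} (g : M2ˣ)
    (h : ∀ B ∈ conjSubalgebra g a, B 1 0 = 0) :
    ∃ u : Fin 2 → ℝ, u ≠ 0 ∧ ∀ A ∈ a, ∃ k : ℝ, A *ᵥ u = k • u :=
  ⟨_, unit_mulVec_ne_zero g (single_ne_zero_two 0), eigenvector_of_conj fun B hB =>
    ⟨B 0 0, eigenvector_iff.2 (by simp [h B hB])⟩⟩

theorem exists_common_eigenvector_of_lower {a : LieSubalgebra ℝ M2} (g : M2ˣ)
    (h : ∀ B ∈ conjSubalgebra g a, B 0 1 = 0) :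
    ∃ u : Fin 2 → ℝ, u ≠ 0 ∧ ∀ A ∈ a, ∃ k : ℝ, A *ᵥ u = k • u :=
  ⟨_, unit_mulVec_ne_zero g (single_ne_zero_two 1), eigenvector_of_conj fun B hB =>
    ⟨B 1 1, eigenvector_iff.2 (by simp [h B hB])⟩⟩

/-- If some element has distinct real eigenvalues, diagonalise it; brackets with it separate the two
off-diagonal matrix units, and both cannot occur, since they would produce a rotation. If every
discriminant vanishes, a non-scalar element is triangular with a non-zero corner, and polarising the
discriminant makes all the others triangular in the same basis. -/
theorem exists_common_eigenvector {a : LieSubalgebra ℝ M2} (hd : ∀ A ∈ a, 0 ≤ disc A) :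
    ∃ u : Fin 2 → ℝ, u ≠ 0 ∧ ∀ A ∈ a, ∃ k : ℝ, A *ᵥ u = k • u := by
  have hconj : ∀ g : M2ˣ, ∀ B ∈ conjSubalgebra g a, 0 ≤ disc B := by
    intro g B hB
    have := hd _ hB
    rwa [disc_conj] at this
  by_cases hpos : ∃ A ∈ a, 0 < disc A
  · obtain ⟨A, hA, hA0⟩ := hpos
    set δ := √(disc A) with hδ
    have hδ0 : 0 < δ := Real.sqrt_pos.2 hA0
    have hδ2 : δ ^ 2 = (A 0 0 - A 1 1) ^ 2 + 4 * A 0 1 * A 1 0 := Real.sq_sqrt hA0.le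
    obtain ⟨u, hu, hu'⟩ := exists_eigenvector (A := A) (k := (A 0 0 + A 1 1 + δ) / 2)
      (by linear_combination hδ2 / 4)
    obtain ⟨w, hw, hw'⟩ := exists_eigenvector (A := A) (k := (A 0 0 + A 1 1 - δ) / 2)
      (by linear_combination hδ2 / 4)
    rw [eigenvector_iff] at hu' hw'
    have hdet : u 0 * w 1 - u 1 * w 0 ≠ 0 := by
      intro h0
      have z00 : δ * (u 0 * w 0) = 0 := by
        linear_combination w 0 * (-hu'.1) + u 0 * hw'.1 + A 0 1 * (-h0)
      have z01 : δ * (u 0 * w 1) = 0 := by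
        linear_combination w 1 * (-hu'.1) + u 1 * hw'.1
          + (A 0 0 - (A 0 0 + A 1 1 - δ) / 2) * h0
      have z10 : δ * (u 1 * w 0) = 0 := by
        linear_combination w 0 * (-hu'.2) + u 0 * hw'.2
          + ((A 0 0 + A 1 1 - δ) / 2 - A 1 1) * h0
      have z11 : δ * (u 1 * w 1) = 0 := by
        linear_combination w 1 * (-hu'.2) + u 1 * hw'.2 + A 1 0 * h0
      simp only [mul_eq_zero, hδ0.ne', false_or] at z00 z01 z10 z11
      refine hw ?_
      have hu01 : u 0 ≠ 0 ∨ u 1 ≠ 0 := by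
        by_contra! h1
        refine hu ?_
        ext i
        fin_cases i
        · exact h1.1
        · exact h1.2
      ext i
      fin_cases i
      · change w 0 = 0
        tauto
      · change w 1 = 0
        tauto
    let g := columnUnit u w hdet
    have hD : !![(A 0 0 + A 1 1 + δ) / 2, 0; 0, (A 0 0 + A 1 1 - δ) / 2] ∈ conjSubalgebra g a := by
      refine (mem_conjSubalgebra_of_mul_eq ?_).2 hA
      rw [columnUnit_val]
      apply ext_M2 <;> simp [Matrix.mul_apply, Fin.sum_univ_two] <;> linarith
        [hu'.1, hu'.2, hw'.1, hw'.2]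
    by_cases hup : ∀ B ∈ conjSubalgebra g a, B 1 0 = 0
    · exact exists_common_eigenvector_of_upper g hup
    by_cases hlow : ∀ B ∈ conjSubalgebra g a, B 0 1 = 0
    · exact exists_common_eigenvector_of_lower g hlow
    exfalso
    push Not at hup hlow
    obtain ⟨B, hB, hB0⟩ := hup
    obtain ⟨C, hC, hC0⟩ := hlow
    set a' := conjSubalgebra g a
    set D : M2 := !![(A 0 0 + A 1 1 + δ) / 2, 0; 0, (A 0 0 + A 1 1 - δ) / 2] with hDdef
    -- The off-diagonal entries are eigenvectors of ad D with eigenvalues δ and -δ, so ad D and its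
    -- square isolate them.
    have hE : ∀ X ∈ a', !![0, 0; X 1 0, 0] ∈ a' ∧ !![0, X 0 1; 0, 0] ∈ a' := by
      intro X hX
      have e1 : ⁅D, X⁆ = !![0, δ * X 0 1; -δ * X 1 0, 0] := by
        rw [lie_fin_two]
        apply ext_M2 <;>
          simp only [hDdef, Matrix.of_apply, Matrix.cons_val', Matrix.cons_val_zero,
            Matrix.cons_val_one, Matrix.cons_val_fin_one] <;>
          ring
      have e2 : ⁅D, ⁅D, X⁆⁆ = !![0, δ ^ 2 * X 0 1; δ ^ 2 * X 1 0, 0] := by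
        rw [e1, lie_fin_two]
        apply ext_M2 <;>
          simp only [hDdef, Matrix.of_apply, Matrix.cons_val', Matrix.cons_val_zero,
            Matrix.cons_val_one, Matrix.cons_val_fin_one] <;>
          ring
      have h1 := a'.lie_mem hD hX
      have h2 := a'.lie_mem hD h1
      rw [e2] at h2
      rw [e1] at h1
      have hδ0' := hδ0.ne'
      constructor
      · convert add_mem (a'.smul_mem (-1 / (2 * δ)) h1) (a'.smul_mem (1 / (2 * δ ^ 2)) h2) using 1
        apply ext_M2 <;> simp
        all_goals field_simp
        all_goals ring
      · convert add_mem (a'.smul_mem (1 / (2 * δ)) h1) (a'.smul_mem (1 / (2 * δ ^ 2)) h2) using 1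
        apply ext_M2 <;> simp
        all_goals field_simp
        all_goals ring
    have hJ := sub_mem (a'.smul_mem (C 0 1)⁻¹ (hE C hC).2) (a'.smul_mem (B 1 0)⁻¹ (hE B hB).1)
    have := hconj g _ hJ
    simp [disc, hB0, hC0] at this
    linarith
  · push Not at hpos
    by_cases hsc : ∀ A ∈ a, A 0 1 = 0 ∧ A 1 0 = 0 ∧ A 0 0 = A 1 1
    · refine ⟨Pi.single 0 1, single_ne_zero_two 0, fun A hA => ⟨A 0 0, eigenvector_iff.2 ?_⟩⟩
      simp [hsc A hA]
    push Not at hsc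
    obtain ⟨A, hA, hns⟩ := hsc
    have hA0 : (A 0 0 - A 1 1) ^ 2 + 4 * A 0 1 * A 1 0 = 0 := le_antisymm (hpos A hA) (hd A hA)
    obtain ⟨u, hu, hu'⟩ := exists_eigenvector (A := A) (k := (A 0 0 + A 1 1) / 2)
      (by linear_combination - hA0 / 4)
    rw [eigenvector_iff] at hu'
    have hdet : u 0 * ![-u 1, u 0] 1 - u 1 * ![-u 1, u 0] 0 ≠ 0 := by
      intro h0
      simp at h0
      refine hu ?_
      ext i
      fin_cases i
      · change u 0 = 0
        nlinarith
      · change u 1 = 0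
        nlinarith
    let g := columnUnit u ![-u 1, u 0] hdet
    have hg : g.val = !![u 0, -u 1; u 1, u 0] := rfl
    set A' := (g⁻¹).val * A * g with hA'
    have hmem : A' ∈ conjSubalgebra g a := inv_mul_mem_conjSubalgebra hA
    have hgA : g.val * A' = A * g := by
      rw [hA', ← mul_assoc, ← mul_assoc, g.mul_inv, one_mul]
    have hA'd : disc A' = 0 := by
      have := disc_conj g⁻¹ A
      rw [inv_inv] at this
      rw [hA', this]
      exact hA0
    have hn : u 0 ^ 2 + u 1 ^ 2 ≠ 0 := by
      intro h0
      apply hdet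
      simp
      linarith
    have e00 := congrFun (congrFun hgA 0) 0
    have e10 := congrFun (congrFun hgA 1) 0
    simp only [hg, Matrix.mul_apply, Fin.sum_univ_two] at e00 e10
    simp at e00 e10
    have h10 : A' 1 0 = 0 := by
      have : (u 0 ^ 2 + u 1 ^ 2) * A' 1 0 = 0 := by
        linear_combination u 0 * e10 - u 1 * e00 + u 0 * hu'.2 - u 1 * hu'.1
      exact (mul_eq_zero.1 this).resolve_left hn
    rw [disc, h10, mul_zero, add_zero] at hA'd
    have h11 : A' 0 0 - A' 1 1 = 0 := by simpa using hA'd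
    have h01 : A' 0 1 ≠ 0 := by
      intro h01
      have hsc : A' = A' 0 0 • (1 : M2) := by
        apply ext_M2 <;> simp [h01, h10]
        linarith
      have : A = A' 0 0 • (1 : M2) := by
        calc A = A * g * (g⁻¹).val := by rw [mul_assoc, g.mul_inv, mul_one]
          _ = A' 0 0 • (1 : M2) := by
            rw [← hgA, hsc]
            simp
      exact hns (by rw [this]; simp) (by rw [this]; simp) (by rw [this]; simp)
    refine exists_common_eigenvector_of_upper g fun B hB => ?_
    have hdB : disc B = 0 := by
      have := hpos _ hB
      rw [disc_conj] at this
      exact le_antisymm this (hconj g B hB)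
    have k1 := hconj g _ (add_mem hmem hB)
    have k2 := hconj g _ (sub_mem hmem hB)
    simp only [disc, Matrix.add_apply, Matrix.sub_apply, h10] at k1 k2 hdB
    have k3 : A' 0 1 * B 1 0 = 0 := by
      have e : A' 0 0 = A' 1 1 := by linarith
      rw [e] at k1 k2
      nlinarith
    exact (mul_eq_zero.1 k3).resolve_left h01

/-- A completely reducible subalgebra of `𝔤𝔩(2, ℝ)` is conjugate to one which is diagonal, or
which contains the matrix of a similarity with non-real eigenvalues. -/
theorem exists_conj_diagonal_or_rotation {a : LieSubalgebra ℝ M2}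
    (hss : ∀ u : Fin 2 → ℝ, u ≠ 0 → (∀ A ∈ a, ∃ k : ℝ, A *ᵥ u = k • u) →
      ∃ u' : Fin 2 → ℝ, u 0 * u' 1 - u 1 * u' 0 ≠ 0 ∧ ∀ A ∈ a, ∃ k : ℝ, A *ᵥ u' = k • u') :
    ∃ g : M2ˣ, (∀ A ∈ conjSubalgebra g a, A 0 1 = 0 ∧ A 1 0 = 0) ∨
      ∃ α β : ℝ, β ≠ 0 ∧ !![α, -β; β, α] ∈ conjSubalgebra g a := by
  by_cases hd : ∀ A ∈ a, 0 ≤ disc A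
  · obtain ⟨u, hu, hk⟩ := exists_common_eigenvector hd
    obtain ⟨u', hdet, hk'⟩ := hss u hu hk
    refine ⟨columnUnit u u' hdet, Or.inl fun A hA => ?_⟩
    obtain ⟨k, hk⟩ := hk _ hA
    obtain ⟨k', hk'⟩ := hk' _ hA
    have e : (columnUnit u u' hdet).val * A * ((columnUnit u u' hdet)⁻¹).val *
        (columnUnit u u' hdet).val = (columnUnit u u' hdet).val * A := by
      rw [mul_assoc, Units.inv_mul, mul_one]
    generalize (columnUnit u u' hdet).val * A * ((columnUnit u u' hdet)⁻¹).val = B at *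
    rw [eigenvector_iff] at hk hk'
    rw [columnUnit_val] at e
    have e00 := congrFun (congrFun e 0) 0
    have e01 := congrFun (congrFun e 0) 1
    have e10 := congrFun (congrFun e 1) 0
    have e11 := congrFun (congrFun e 1) 1
    simp only [Matrix.mul_apply, Fin.sum_univ_two] at e00 e01 e10 e11
    simp at e00 e01 e10 e11
    constructor
    · have : (u 0 * u' 1 - u 1 * u' 0) * A 0 1 = 0 := by
        linear_combination u' 0 * e11 - u' 1 * e01 + u' 1 * hk'.1 - u' 0 * hk'.2
      exact (mul_eq_zero.1 this).resolve_left hdet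
    · have : (u 0 * u' 1 - u 1 * u' 0) * A 1 0 = 0 := by
        linear_combination u 1 * e00 - u 0 * e10 + u 0 * hk.2 - u 1 * hk.1
      exact (mul_eq_zero.1 this).resolve_left hdet
  · push Not at hd
    obtain ⟨A, hA, hA0⟩ := hd
    set α := (A 0 0 + A 1 1) / 2 with hα
    set β := √(-disc A) / 2 with hβ
    have hβ0 : β ≠ 0 := by
      have : 0 < √(-disc A) := Real.sqrt_pos.2 (by linarith)
      rw [hβ]
      positivity
    have hβ2 : β ^ 2 = -((A 0 0 - A 1 1) ^ 2 + 4 * A 0 1 * A 1 0) / 4 := by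
      rw [hβ, div_pow, Real.sq_sqrt (by linarith), disc]; ring
    have h10 : A 1 0 ≠ 0 := by
      intro h0
      rw [disc, h0] at hA0
      nlinarith [sq_nonneg (A 0 0 - A 1 1)]
    -- The second vector is (A - α) e₁, where e₁ = (1, 0), and the first is β e₁; since (A - α)² =
    -- -β², in this basis A is the similarity with entries α, β.
    have hdet : (![β, 0] : Fin 2 → ℝ) 0 * ![A 0 0 - α, A 1 0] 1 -
        ![β, 0] 1 * ![A 0 0 - α, A 1 0] 0 ≠ 0 := by
      simp [hβ0, h10]
    refine ⟨columnUnit _ _ hdet, Or.inr ⟨α, β, hβ0, (mem_conjSubalgebra_of_mul_eq ?_).2 hA⟩⟩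
    rw [columnUnit_val]
    apply ext_M2 <;> simp [Matrix.mul_apply, Fin.sum_univ_two]
    · ring
    · linear_combination hβ2 + ((A 1 1 - A 0 0) / 2) * hα
    · linear_combination A 1 0 * hα

/-! ### Normal forms -/

/-- The block matrix `diag(det g, g, 1, (det g)⁻¹, g⁻ᵀ)`. -/
def blockMatrix (g : M2) : M7 :=
  !![g.det, 0, 0, 0, 0, 0, 0;
     0, g 0 0, g 0 1, 0, 0, 0, 0;
     0, g 1 0, g 1 1, 0, 0, 0, 0;
     0, 0, 0, 1, 0, 0, 0;
     0, 0, 0, 0, g.det⁻¹, 0, 0;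
     0, 0, 0, 0, 0, g 1 1 * g.det⁻¹, -g 1 0 * g.det⁻¹;
     0, 0, 0, 0, 0, -g 0 1 * g.det⁻¹, g 0 0 * g.det⁻¹]

theorem blockMatrix_mulVec (g : M2) (x : Fin 7 → ℝ) :
    blockMatrix g *ᵥ x =
      ![g.det * x 0, g 0 0 * x 1 + g 0 1 * x 2, g 1 0 * x 1 + g 1 1 * x 2, x 3, g.det⁻¹ * x 4,
        (g 1 1 * x 5 - g 1 0 * x 6) * g.det⁻¹, (g 0 0 * x 6 - g 0 1 * x 5) * g.det⁻¹] := by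
  ext i
  fin_cases i <;> simp [blockMatrix, Matrix.mulVec, dotProduct, Fin.sum_univ_seven] <;> ring

theorem orthogonal_of_etaForm {P : M7} (h : ∀ x y, etaForm (P *ᵥ x) (P *ᵥ y) = etaForm x y) :
    Pᵀ * eta * P = eta := by
  ext i j
  have := h (Pi.single i 1) (Pi.single j 1)
  rw [etaForm_apply, etaForm_apply] at this
  simp only [Matrix.mulVec_single_one, single_one_dotProduct] at this
  rw [Matrix.mul_mul_apply]
  exact this

theorem blockMatrix_orthogonal {g : M2} (hg : g.det ≠ 0) :
    (blockMatrix g)ᵀ * eta * blockMatrix g = eta := by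
  refine orthogonal_of_etaForm fun x y => ?_
  simp only [blockMatrix_mulVec, etaForm_eq, Matrix.cons_val]
  have hd := Matrix.det_fin_two g
  field_simp
  rw [hd]
  ring

/-- A change of basis g of the plane acts on A by conjugation, while v and y acquire the factor det
g because b₁ is scaled by det g. -/
theorem hMat_mul_blockMatrix {g A A' : M2} (hg : g.det ≠ 0) (hA : A * g = g * A') (v : ℝ)
    (y : Fin 2 → ℝ) :
    hMat A (g.det * v) (g.det • (g *ᵥ y)) * blockMatrix g = blockMatrix g * hMat A' v y := by
  have hd := Matrix.det_fin_two g
  have e00 := congrFun (congrFun hA 0) 0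
  have e01 := congrFun (congrFun hA 0) 1
  have e10 := congrFun (congrFun hA 1) 0
  have e11 := congrFun (congrFun hA 1) 1
  simp only [Matrix.mul_apply, Fin.sum_univ_two] at e00 e01 e10 e11
  have htr : A 0 0 + A 1 1 = A' 0 0 + A' 1 1 := by
    refine mul_left_cancel₀ hg ?_
    rw [hd]
    linear_combination g 1 1 * e00 - g 1 0 * e01 - g 0 1 * e10 + g 0 0 * e11
  have f00 : g 1 1 * A 0 0 - g 0 1 * A 1 0 = A' 0 0 * g 1 1 - A' 0 1 * g 1 0 := by
    refine mul_left_cancel₀ hg ?_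
    rw [hd]
    linear_combination g 1 1 * g 1 1 * e00 - g 1 1 * g 1 0 * e01 - g 0 1 * g 1 1 * e10
      + g 0 1 * g 1 0 * e11
  have f01 : g 1 1 * A 0 1 - g 0 1 * A 1 1 = -A' 0 0 * g 0 1 + A' 0 1 * g 0 0 := by
    refine mul_left_cancel₀ hg ?_
    rw [hd]
    linear_combination -g 1 1 * g 0 1 * e00 + g 1 1 * g 0 0 * e01 + g 0 1 * g 0 1 * e10
      - g 0 1 * g 0 0 * e11
  have f10 : -g 1 0 * A 0 0 + g 0 0 * A 1 0 = A' 1 0 * g 1 1 - A' 1 1 * g 1 0 := by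
    refine mul_left_cancel₀ hg ?_
    rw [hd]
    linear_combination -g 1 0 * g 1 1 * e00 + g 1 0 * g 1 0 * e01 + g 0 0 * g 1 1 * e10
      - g 0 0 * g 1 0 * e11
  have f11 : -g 1 0 * A 0 1 + g 0 0 * A 1 1 = -A' 1 0 * g 0 1 + A' 1 1 * g 0 0 := by
    refine mul_left_cancel₀ hg ?_
    rw [hd]
    linear_combination g 1 0 * g 0 1 * e00 - g 1 0 * g 0 0 * e01 - g 0 0 * g 0 1 * e10
      + g 0 0 * g 0 0 * e11
  have hi : g.det * g.det⁻¹ = 1 := mul_inv_cancel₀ hg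
  apply Matrix.ext_of_mulVec_single
  intro k
  generalize (Pi.single k 1 : Fin 7 → ℝ) = x
  rw [← Matrix.mulVec_mulVec, ← Matrix.mulVec_mulVec]
  simp only [hMat_mulVec, blockMatrix_mulVec, mulVec_fin_two, Matrix.trace_fin_two, htr]
  generalize g.det = D at hd hi ⊢
  generalize D⁻¹ = D' at hi ⊢
  ext i
  fin_cases i <;>
    simp only [Fin.zero_eta, Fin.mk_one, Fin.reduceFinMk, Matrix.cons_val, Pi.smul_apply,
      smul_eq_mul]
  · linear_combination -((g 0 0 * y 0 + g 0 1 * y 1) * (g 1 1 * x 5 - g 1 0 * x 6)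
      + (g 1 0 * y 0 + g 1 1 * y 1) * (g 0 0 * x 6 - g 0 1 * x 5)) * hi
      + (y 0 * x 5 + y 1 * x 6) * hd
  · linear_combination x 1 * e00 + x 2 * e01 + ((g 0 0 * y 0 + g 0 1 * y 1) * x 4
      + v * (g 0 0 * x 6 - g 0 1 * x 5)) * hi
  · linear_combination x 1 * e10 + x 2 * e11 + ((g 1 0 * y 0 + g 1 1 * y 1) * x 4
      - v * (g 1 1 * x 5 - g 1 0 * x 6)) * hi
  · linear_combination √2 * v * x 4 * hi
  · ring
  · linear_combination -D' * x 5 * f00 - D' * x 6 * f10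
  · linear_combination -D' * x 5 * f01 - D' * x 6 * f11

theorem det_unit_ne_zero (g : M2ˣ) : g.val.det ≠ 0 :=
  ((Matrix.isUnit_iff_isUnit_det g.val).1 g.isUnit).ne_zero

/-- The block matrix as a unit. -/
def blockUnit (g : M2ˣ) : M7ˣ :=
  orthUnit (blockMatrix g.val) (blockMatrix_orthogonal (det_unit_ne_zero g))

theorem blockUnit_orthogonal (g : M2ˣ) : (blockUnit g).valᵀ * eta * (blockUnit g).val = eta :=
  blockMatrix_orthogonal (det_unit_ne_zero g)

theorem hMat_mem_conj_blockUnit {g : M2ˣ} {h : LieSubalgebra ℝ M7} {A : M2} {v : ℝ}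
    {y : Fin 2 → ℝ} :
    hMat A v y ∈ conjSubalgebra (blockUnit g) h ↔
      hMat (g.val * A * (g⁻¹).val) (g.val.det * v) (g.val.det • (g.val *ᵥ y)) ∈ h := by
  refine mem_conjSubalgebra_of_mul_eq (hMat_mul_blockMatrix (det_unit_ne_zero g) ?_ v y)
  rw [mul_assoc, g.inv_mul, mul_one]

theorem det_smul_mulVec_inv (g : M2ˣ) (y : Fin 2 → ℝ) :
    g.val.det • (g.val *ᵥ (g.val.det⁻¹ • ((g⁻¹).val *ᵥ y))) = y := by
  rw [Matrix.mulVec_smul, smul_smul, mul_inv_cancel₀ (det_unit_ne_zero g), one_smul,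
    Matrix.mulVec_mulVec, g.mul_inv, Matrix.one_mulVec]

theorem IsAdapted.conj_blockUnit {h : LieSubalgebra ℝ M7} (hh : IsAdapted h) (g : M2ˣ) :
    IsAdapted (conjSubalgebra (blockUnit g) h) := by
  refine hh.conj (blockUnit_orthogonal g) fun A v y => ⟨(g⁻¹).val * A * g.val, g.val.det⁻¹ * v,
    g.val.det⁻¹ • ((g⁻¹).val *ᵥ y), ?_⟩
  have := hMat_mul_blockMatrix (A := A) (A' := (g⁻¹).val * A * g.val) (det_unit_ne_zero g) (by
    rw [mul_assoc (g⁻¹).val, ← mul_assoc g.val, g.mul_inv, one_mul]) (g.val.det⁻¹ * v)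
    (g.val.det⁻¹ • ((g⁻¹).val *ᵥ y))
  rwa [det_smul_mulVec_inv, ← mul_assoc, mul_inv_cancel₀ (det_unit_ne_zero g), one_mul] at this

theorem linearPart_conj_blockUnit (g : M2ˣ) (h : LieSubalgebra ℝ M7) :
    linearPart (conjSubalgebra (blockUnit g) h) = conjSubalgebra g (linearPart h) := by
  ext A
  rw [mem_conjSubalgebra, mem_linearPart, mem_linearPart]
  constructor
  · rintro ⟨v, y, hA⟩
    exact ⟨_, _, hMat_mem_conj_blockUnit.1 hA⟩
  · rintro ⟨v, y, hA⟩
    refine ⟨g.val.det⁻¹ * v, g.val.det⁻¹ • ((g⁻¹).val *ᵥ y), hMat_mem_conj_blockUnit.2 ?_⟩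
    rwa [det_smul_mulVec_inv, ← mul_assoc, mul_inv_cancel₀ (det_unit_ne_zero g), one_mul]

/-- `𝔥` becomes one of the eight algebras in a suitable orthonormal frame. -/
def IsListed (h : LieSubalgebra ℝ M7) : Prop :=
  ∃ P : M7ˣ, P.valᵀ * eta * P.val = eta ∧ conjSubalgebra P h ∈ typeIIIList

theorem IsListed.of_conj {h : LieSubalgebra ℝ M7} {P : M7ˣ} (hP : P.valᵀ * eta * P.val = eta)
    (hh : IsListed (conjSubalgebra P h)) : IsListed h := by
  obtain ⟨Q, hQ, hl⟩ := hh
  refine ⟨P * Q, ?_, by rwa [conjSubalgebra_mul]⟩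
  calc (P * Q).valᵀ * eta * (P * Q).val = Q.valᵀ * (P.valᵀ * eta * P.val) * Q.val := by
        simp only [Units.val_mul, Matrix.transpose_mul, mul_assoc]
    _ = eta := by rw [hP, hQ]

theorem isListed_of_mem {h : LieSubalgebra ℝ M7} (hh : h ∈ typeIIIList) : IsListed h := by
  refine ⟨1, by simp, ?_⟩
  have : conjSubalgebra 1 h = h := by
    ext X
    simp [mem_conjSubalgebra]
  rwa [this]

/-- A unipotent isometry which moves the second component of `y`. -/
def shearMatrix (c ζ : ℝ) : M7 :=
  !![1, -c, 0, 0, 0, 0, ζ;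
     0, 1, 0, 0, 0, 0, 0;
     0, 0, 1, 0, -ζ, 0, 0;
     0, 0, 0, 1, 0, 0, 0;
     0, 0, 0, 0, 1, 0, 0;
     0, 0, 0, 0, c, 1, 0;
     0, 0, 0, 0, 0, 0, 1]

theorem shearMatrix_mulVec (c ζ : ℝ) (x : Fin 7 → ℝ) :
    shearMatrix c ζ *ᵥ x =
      ![x 0 - c * x 1 + ζ * x 6, x 1, x 2 - ζ * x 4, x 3, x 4, x 5 + c * x 4, x 6] := by
  ext i
  fin_cases i <;> simp [shearMatrix, Matrix.mulVec, dotProduct, Fin.sum_univ_seven] <;> ring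

theorem shearMatrix_orthogonal (c ζ : ℝ) :
    (shearMatrix c ζ)ᵀ * eta * shearMatrix c ζ = eta := by
  refine orthogonal_of_etaForm fun x y => ?_
  simp only [shearMatrix_mulVec, etaForm_eq, Matrix.cons_val]
  ring

/-- The two shear parameters remove a second component of y that depends linearly on v and on p. -/
theorem hMat_mul_shearMatrix (c ζ p v y : ℝ) :
    hMat !![p, 0; 0, 0] v ![y, c * v + ζ * p] * shearMatrix c ζ =
      shearMatrix c ζ * hMat !![p, 0; 0, 0] v ![y, 0] := by
  apply Matrix.ext_of_mulVec_single
  intro k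
  generalize (Pi.single k 1 : Fin 7 → ℝ) = x
  rw [← Matrix.mulVec_mulVec, ← Matrix.mulVec_mulVec]
  simp only [hMat_mulVec, shearMatrix_mulVec, Matrix.trace_fin_two]
  ext i
  fin_cases i <;> simp <;> ring

theorem eq_of_diag {A : M2} (h1 : A 0 1 = 0) (h2 : A 1 0 = 0) (h3 : A 1 1 = 0) :
    A = !![A 0 0, 0; 0, 0] := by
  apply ext_M2 <;> simp [h1, h2, h3]

/-- If the translations fill ℝ², 𝔥 is a semidirect product at once. Otherwise they form the first
coordinate line, y₂ is a linear function c v + ζ p on 𝔥, and the shear brings it to zero. -/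
theorem IsAdapted.isListed_of_line {h : LieSubalgebra ℝ M7} (hh : IsAdapted h)
    (ha : ∀ A ∈ linearPart h, A 0 1 = 0 ∧ A 1 0 = 0 ∧ A 1 1 = 0)
    (he : ![1, 0] ∈ translationPart h) : IsListed h := by
  have hcases : linearPart h = ⊥ ∨ linearPart h = line10 := by
    by_cases hz : ∀ A ∈ linearPart h, A 0 0 = 0
    · left
      rw [LieSubalgebra.eq_bot_iff]
      intro A hA
      obtain ⟨h1, h2, h3⟩ := ha A hA
      apply ext_M2 <;> simp [h1, h2, h3, hz A hA]
    · right
      push Not at hz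
      obtain ⟨A, hA, hA0⟩ := hz
      have hE : ∀ c : ℝ, !![c, 0; 0, 0] ∈ linearPart h := by
        intro c
        have := (linearPart h).smul_mem (c / A 0 0) hA
        obtain ⟨h1, h2, h3⟩ := ha A hA
        convert this using 1
        apply ext_M2 <;> simp [h1, h2, h3, hA0]
      refine le_antisymm (fun B hB => ?_) ?_
      · obtain ⟨h1, h2, h3⟩ := ha B hB
        exact ⟨B 0 0, eq_of_diag h1 h2 h3⟩
      · rintro _ ⟨c, rfl⟩
        exact hE c
  obtain ⟨y₀, hy₀⟩ : ∃ y, hMat 0 1 y ∈ h := by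
    rcases hcases with h0 | h0
    · exact hh.exists_hMat_zero_one_of_bot h0
    · refine hh.exists_hMat_zero_one (B := !![1, 0; 0, 0]) (by rw [h0]; exact ⟨1, rfl⟩)
        (by simp [Matrix.trace_fin_two]) fun A hA => ?_
      obtain ⟨h1, h2, h3⟩ := ha A hA
      rw [lie_fin_two]
      apply ext_M2 <;> simp [h1, h2]
  by_cases hY : translationPart h = ⊤
  · refine isListed_of_mem ?_
    rw [hh.eq_semi12 hY ⟨y₀, hy₀⟩]
    rcases hcases with h0 | h0 <;> rw [h0] <;> simp [typeIIIList]
  have hY1 : ∀ y, hMat 0 0 y ∈ h → y 1 = 0 := by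
    intro y hy
    by_contra h1
    exact hY (eq_top_of_det_ne_zero he (mem_translationPart.2 hy) (by simpa using h1))
  obtain ⟨ζ, hζ⟩ : ∃ ζ, ∀ p, !![p, 0; 0, 0] ∈ linearPart h →
      ∃ y, hMat !![p, 0; 0, 0] 0 ![y, ζ * p] ∈ h := by
    rcases hcases with h0 | h0
    · refine ⟨0, fun p hp => ⟨0, ?_⟩⟩
      rw [h0, LieSubalgebra.mem_bot] at hp
      have e : (![0, 0 * p] : Fin 2 → ℝ) = 0 := by ext i; fin_cases i <;> simp
      rw [hp, e, WaveData.hMat_zero]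
      exact zero_mem h
    · obtain ⟨w, z, hw⟩ : !![(1 : ℝ), 0; 0, 0] ∈ linearPart h := by rw [h0]; exact ⟨1, rfl⟩
      refine ⟨z 1 - w * y₀ 1, fun p _ => ⟨p * (z 0 - w * y₀ 0), ?_⟩⟩
      have := h.smul_mem p (hMat_sub_mem hw hy₀ w)
      rw [hMat_smul] at this
      convert this using 2
      · apply ext_M2 <;> simp
      · simp
      · ext i
        fin_cases i <;> simp [mul_comm]
  set c := y₀ 1 with hc
  have hmem : ∀ p v y, !![p, 0; 0, 0] ∈ linearPart h →
      hMat !![p, 0; 0, 0] v ![y, c * v + ζ * p] ∈ h := by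
    intro p v y hp
    obtain ⟨y', hy'⟩ := hζ p hp
    have := hMat_sub_mem (hMat_sub_mem hy' hy₀ (-v)) (mem_translationPart.1 he)
      (y' + v * y₀ 0 - y)
    convert this using 2
    · simp
    · simp
    · ext i
      fin_cases i
      · simp [Matrix.vecHead]
      · simp [hc, Matrix.vecHead, Matrix.vecTail]
        ring
  have hform : ∀ A v y, hMat A v y ∈ h → y 1 = c * v + ζ * A 0 0 := by
    intro A v y hA
    obtain ⟨h1, h2, h3⟩ := ha A ⟨v, y, hA⟩
    have e := eq_of_diag h1 h2 h3
    have hp : !![A 0 0, 0; 0, 0] ∈ linearPart h := by rw [← e]; exact ⟨v, y, hA⟩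
    have := hMat_sub_mem hA (hmem (A 0 0) v 0 hp) 1
    rw [one_smul, ← e, sub_self, one_mul, sub_self] at this
    have := hY1 _ this
    simp at this
    linarith
  let P := orthUnit _ (shearMatrix_orthogonal c ζ)
  have hconj : ∀ X, X ∈ conjSubalgebra P h ↔
      ∃ A ∈ linearPart h, ∃ v : ℝ, ∃ y ∈ lineY, X = hMat A v y := by
    intro X
    constructor
    · intro hX
      obtain ⟨A, v, y, e⟩ := hh.range _ (mem_conjSubalgebra.1 hX)
      have hX' := mem_conjSubalgebra.1 hX
      rw [e] at hX'
      have hAl : A ∈ linearPart h := ⟨v, y, hX'⟩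
      obtain ⟨h1, h2, h3⟩ := ha A hAl
      have eA := eq_of_diag h1 h2 h3
      refine ⟨A, hAl, v, ![y 0, 0], rfl, ?_⟩
      have ey : y = ![y 0, c * v + ζ * A 0 0] := by
        ext i
        fin_cases i
        · rfl
        · exact hform A v y hX'
      have e1 : P.val * X = P.val * hMat A v ![y 0, 0] := by
        have e2 := hMat_mul_shearMatrix c ζ (A 0 0) v (y 0)
        rw [← ey, ← eA] at e2
        change _ = shearMatrix c ζ * _
        rw [← e2, ← e, mul_assoc]
        change _ = _ * (P⁻¹.val * P.val)
        rw [P.inv_mul, mul_one]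
      exact P.mul_right_inj.1 e1
    · rintro ⟨A, hA, v, y, hy, rfl⟩
      obtain ⟨h1, h2, h3⟩ := ha A hA
      have eA := eq_of_diag h1 h2 h3
      have ey : y = ![y 0, 0] := by
        ext i
        fin_cases i
        · rfl
        · exact hy
      rw [eA] at hA
      rw [eA, ey]
      exact (mem_conjSubalgebra_of_mul_eq (hMat_mul_shearMatrix c ζ (A 0 0) v (y 0))).2
        (hmem _ _ _ hA)
  refine ⟨P, shearMatrix_orthogonal c ζ, ?_⟩
  rcases hcases with h0 | h0
  · have : conjSubalgebra P h = zeroSemi11 := by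
      ext X
      rw [hconj X, h0]
      exact Iff.rfl
    rw [this]
    simp [typeIIIList]
  · have : conjSubalgebra P h = line10Semi11 := by
      ext X
      rw [hconj X, h0]
      exact Iff.rfl
    rw [this]
    simp [typeIIIList]

/-! ### Diagonal linear part -/

/-- The parameters p, …, t occur off the diagonal of some curvature value, and the row compatibility
of A₁ and A₂ then removes one diagonal entry of each. -/
theorem CurvatureData.of_diagonal {h : LieSubalgebra ℝ M7}
    (ha : ∀ A ∈ linearPart h, A 0 1 = 0 ∧ A 1 0 = 0) {A₁ A₂ : M2}
    {v₁ v₂ y₁₁ y₁₂ y₂₂ p q r s t : ℝ}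
    (D : CurvatureData h.toSubmodule A₁ A₂ v₁ v₂ y₁₁ y₁₂ y₂₂ p q r s t) :
    (p = 0 ∧ q = 0 ∧ r = 0 ∧ s = 0 ∧ t = 0) ∧ A₁ = !![A₁ 0 0, 0; 0, 0] ∧
      A₂ = !![0, 0; 0, A₂ 1 1] := by
  have h1 := ha _ ⟨_, _, D.mem₅₁⟩
  have h2 := ha _ ⟨_, _, D.mem₆₁⟩
  have h3 := ha _ ⟨_, _, D.mem₅₂⟩
  have h4 := ha _ ⟨_, _, D.mem₄₅⟩
  have h5 := ha _ ⟨_, _, D.mem₄₆⟩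
  simp at h1 h2 h3
  refine ⟨⟨h2.1, h1.1, h1.2, h2.2, h3.1⟩, ?_, ?_⟩
  · exact eq_of_diag h4.1 h4.2 (D.pair.2.trans h5.1)
  · apply ext_M2 <;> simp [h5.1, h5.2, ← D.pair.1, h4.2]

/-- By Berger's criterion some curvature endomorphism has a non-zero first entry of A₁. Its value at
(b₅, b₆) supplies the matrix unit, and its value at (b₆, b₂), whose linear part vanishes, supplies
the translation. -/
theorem IsAdapted.mem_of_diagonal_of_entry_zero {h : LieSubalgebra ℝ M7} (hh : IsAdapted h)
    (ha : ∀ A ∈ linearPart h, A 0 1 = 0 ∧ A 1 0 = 0) (h0 : ∃ A ∈ linearPart h, A 0 0 ≠ 0) :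
    !![1, 0; 0, 0] ∈ linearPart h ∧ ![1, 0] ∈ translationPart h := by
  by_contra hn
  obtain ⟨A, ⟨v, y, hA⟩, hA0⟩ := h0
  let T : Submodule ℝ M7 := LinearMap.ker (Matrix.entryLinearMap ℝ ℝ (1 : Fin 7) (1 : Fin 7))
  have hT : ∀ A v y, hMat A v y ∈ T ↔ A 0 0 = 0 := fun A v y => Iff.rfl
  refine hA0 ((hT A v y).1 (hh.le_of_curvatureData (T := T) ?_ hA))
  intro A₁ A₂ v₁ v₂ y₁₁ y₁₂ y₂₂ p q r s t D
  obtain ⟨⟨rfl, rfl, rfl, rfl, rfl⟩, e1, e2⟩ := D.of_diagonal ha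
  have hz : A₁ 0 0 = 0 := by
    by_contra hne
    refine hn ⟨?_, ?_⟩
    · have := (linearPart h).smul_mem (A₁ 0 0)⁻¹ ⟨_, _, D.mem₄₅⟩
      convert this using 1
      rw [e1]
      apply ext_M2 <;> simp [hne]
    · have := D.mem₅₁
      have e : (!![0, 0; 0, -0] : M2) = 0 := by apply ext_M2 <;> simp
      rw [e] at this
      have := (translationPart h).smul_mem (-A₁ 0 0)⁻¹ this
      convert this using 1
      rw [e1]
      ext i
      fin_cases i <;> simp [hne]
  refine ⟨D.pair, (hT ..).2 hz, (hT ..).2 ?_, (hT ..).2 rfl, (hT ..).2 rfl, (hT ..).2 rfl,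
    (hT ..).2 rfl, (hT ..).2 (by simp)⟩
  rw [e2]; rfl

theorem IsAdapted.mem_of_diagonal_of_entry_one {h : LieSubalgebra ℝ M7} (hh : IsAdapted h)
    (ha : ∀ A ∈ linearPart h, A 0 1 = 0 ∧ A 1 0 = 0) (h0 : ∃ A ∈ linearPart h, A 1 1 ≠ 0) :
    !![0, 0; 0, 1] ∈ linearPart h ∧ ![0, 1] ∈ translationPart h := by
  by_contra hn
  obtain ⟨A, ⟨v, y, hA⟩, hA0⟩ := h0
  let T : Submodule ℝ M7 := LinearMap.ker (Matrix.entryLinearMap ℝ ℝ (2 : Fin 7) (2 : Fin 7))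
  have hT : ∀ A v y, hMat A v y ∈ T ↔ A 1 1 = 0 := fun A v y => Iff.rfl
  refine hA0 ((hT A v y).1 (hh.le_of_curvatureData (T := T) ?_ hA))
  intro A₁ A₂ v₁ v₂ y₁₁ y₁₂ y₂₂ p q r s t D
  obtain ⟨⟨rfl, rfl, rfl, rfl, rfl⟩, e1, e2⟩ := D.of_diagonal ha
  have hz : A₂ 1 1 = 0 := by
    by_contra hne
    refine hn ⟨?_, ?_⟩
    · have := (linearPart h).smul_mem (A₂ 1 1)⁻¹ ⟨_, _, D.mem₄₆⟩
      convert this using 1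
      rw [e2]
      apply ext_M2 <;> simp [hne]
    · have := D.mem₆₂
      have e : (!![-0, -0; -0, 0] : M2) = 0 := by apply ext_M2 <;> simp
      rw [e] at this
      have := (translationPart h).smul_mem (-A₂ 1 1)⁻¹ this
      convert this using 1
      rw [e2]
      ext i
      fin_cases i <;> simp [hne]
  refine ⟨D.pair, (hT ..).2 ?_, (hT ..).2 hz, (hT ..).2 rfl, (hT ..).2 (by simp),
    (hT ..).2 (by simp), (hT ..).2 (by simp), (hT ..).2 rfl⟩
  rw [e1]; rfl

theorem IsAdapted.isListed_of_diagonal {h : LieSubalgebra ℝ M7} (hh : IsAdapted h)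
    (ha : ∀ A ∈ linearPart h, A 0 1 = 0 ∧ A 1 0 = 0) : IsListed h := by
  by_cases h0 : ∃ A ∈ linearPart h, A 0 0 ≠ 0
  · obtain ⟨hE, he⟩ := hh.mem_of_diagonal_of_entry_zero ha h0
    by_cases h1 : ∃ A ∈ linearPart h, A 1 1 ≠ 0
    · obtain ⟨hE', he'⟩ := hh.mem_of_diagonal_of_entry_one ha h1
      have hd : linearPart h = diag2 := by
        refine le_antisymm ha fun A hA => ?_
        have := add_mem ((linearPart h).smul_mem (A 0 0) hE) ((linearPart h).smul_mem (A 1 1) hE')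
        convert this using 1
        apply ext_M2 <;> simp [hA.1, hA.2]
      have hv : ∃ y, hMat 0 1 y ∈ h := by
        refine hh.exists_hMat_zero_one (B := 1) ?_ (by simp) fun A _ => by simp [Ring.lie_def]
        rw [hd]
        exact (show _ ∧ _ from ⟨by simp, by simp⟩)
      refine isListed_of_mem ?_
      rw [hh.eq_semi12 (eq_top_of_det_ne_zero he he' (by simp)) hv, hd]
      simp [typeIIIList]
    · push Not at h1
      exact hh.isListed_of_line (fun A hA => ⟨(ha A hA).1, (ha A hA).2, h1 A hA⟩) he
  push Not at h0
  by_cases h1 : ∃ A ∈ linearPart h, A 1 1 ≠ 0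
  · obtain ⟨hE', he'⟩ := hh.mem_of_diagonal_of_entry_one ha h1
    -- Exchanging b₂ and b₃, up to sign changes elsewhere, reduces to the previous case.
    let g := columnUnit ![0, 1] ![1, 0] (by simp)
    have hg : g.val = !![0, 1; 1, 0] := rfl
    refine .of_conj (blockUnit_orthogonal g) ((hh.conj_blockUnit g).isListed_of_line ?_ ?_)
    · intro A hA
      rw [linearPart_conj_blockUnit] at hA
      have hB : !![A 1 1, A 1 0; A 0 1, A 0 0] ∈ linearPart h := by
        refine (mem_conjSubalgebra_of_mul_eq ?_).1 hA
        rw [hg]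
        apply ext_M2 <;> simp [Matrix.mul_apply, Fin.sum_univ_two]
      exact ⟨(ha _ hB).2, (ha _ hB).1, h0 _ hB⟩
    · rw [mem_translationPart, hMat_mem_conj_blockUnit, mul_zero, zero_mul, mul_zero,
        ← mem_translationPart]
      refine (translationPart h).smul_mem _ ?_
      convert he' using 1
      rw [mulVec_fin_two, hg]
      simp
  · push Not at h1
    have hbot : ∀ A ∈ linearPart h, A = 0 := fun A hA => by
      apply ext_M2 <;> simp [ha A hA, h0 A hA, h1 A hA]
    obtain ⟨z, hz, hz0⟩ := hh.exists_mem_translationPart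
    have hdet : z 0 * ![-z 1, z 0] 1 - z 1 * ![-z 1, z 0] 0 ≠ 0 := by
      intro e
      simp at e
      refine hz0 ?_
      ext i
      fin_cases i
      · change z 0 = 0
        nlinarith
      · change z 1 = 0
        nlinarith
    -- With vanishing linear part, any non-zero translation may be moved to the first coordinate
    -- direction.
    let g := columnUnit z ![-z 1, z 0] hdet
    have hg : g.val = !![z 0, -z 1; z 1, z 0] := rfl
    refine .of_conj (blockUnit_orthogonal g) ((hh.conj_blockUnit g).isListed_of_line ?_ ?_)
    · intro A hA
      rw [linearPart_conj_blockUnit] at hA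
      have hB := hbot _ (mem_conjSubalgebra.1 hA)
      have : A = 0 := by
        calc A = (g⁻¹).val * (g.val * A * (g⁻¹).val) * g.val := by
              simp [mul_assoc]
          _ = 0 := by rw [hB, mul_zero, zero_mul]
      simp [this]
    · rw [mem_translationPart, hMat_mem_conj_blockUnit, mul_zero, zero_mul, mul_zero,
        ← mem_translationPart]
      refine (translationPart h).smul_mem _ ?_
      convert hz using 1
      rw [mulVec_fin_two, hg]
      ext i
      fin_cases i <;> simp

/-! ### Linear part containing a rotation -/

/-- The translations are invariant under Z + tr Z, which has no real eigenvector, so they cannot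
form a line. -/
theorem IsAdapted.translationPart_eq_top_of_rotation {h : LieSubalgebra ℝ M7} (hh : IsAdapted h)
    {α β : ℝ} (hβ : β ≠ 0) (hZ : !![α, -β; β, α] ∈ linearPart h) : translationPart h = ⊤ := by
  obtain ⟨z, hz, hz0⟩ := hh.exists_mem_translationPart
  refine eq_top_of_det_ne_zero hz (mulVec_mem_translationPart hZ hz) ?_
  rw [mulVec_fin_two]
  simp [Matrix.trace_fin_two]
  intro e
  have e' : β * (z 0 ^ 2 + z 1 ^ 2) = 0 := by linear_combination e
  have e'' := (mul_eq_zero.1 e').resolve_left hβ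
  refine hz0 ?_
  ext i
  fin_cases i
  · change z 0 = 0
    nlinarith
  · change z 1 = 0
    nlinarith

/-- In 𝔠𝔬(2), row compatibility determines A₂ from A₁: if A₁ = a + bJ then A₂ = b - aJ, with J the
rotation by a right angle. These are independent unless both vanish, and they cannot vanish for
every curvature endomorphism. -/
theorem IsAdapted.linearPart_eq_co2 {h : LieSubalgebra ℝ M7} (hh : IsAdapted h) {α β : ℝ}
    (hβ : β ≠ 0) (hZ : !![α, -β; β, α] ∈ linearPart h) (hle : linearPart h ≤ co2) :
    linearPart h = co2 := by
  refine le_antisymm hle ?_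
  by_contra hn
  obtain ⟨v, y, hZ⟩ := hZ
  let T : Submodule ℝ M7 := LinearMap.ker (Matrix.entryLinearMap ℝ ℝ (2 : Fin 7) (1 : Fin 7))
  have hT : ∀ A v y, hMat A v y ∈ T ↔ A 1 0 = 0 := fun A v y => Iff.rfl
  refine hβ ((hT _ v y).1 (hh.le_of_curvatureData (T := T) ?_ hZ))
  intro A₁ A₂ v₁ v₂ y₁₁ y₁₂ y₂₂ p q r s t D
  have c1 := hle ⟨_, _, D.mem₅₁⟩
  have c2 := hle ⟨_, _, D.mem₆₁⟩
  have c3 := hle ⟨_, _, D.mem₅₂⟩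
  have c4 : A₁ 0 0 = A₁ 1 1 ∧ A₁ 0 1 = -A₁ 1 0 := hle ⟨_, _, D.mem₄₅⟩
  have c5 : A₂ 0 0 = A₂ 1 1 ∧ A₂ 0 1 = -A₂ 1 0 := hle ⟨_, _, D.mem₄₆⟩
  obtain ⟨c11, c12⟩ : p = -p ∧ q = -r := c1
  obtain ⟨c21, c22⟩ : r = -r ∧ -p = -s := c2
  have hpair := D.pair
  obtain ⟨e1, e2⟩ := hpair
  have hz : A₁ 0 0 = 0 ∧ A₁ 1 0 = 0 := by
    by_contra hne
    refine hn fun B hB => ?_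
    obtain ⟨b1, b2⟩ : B 0 0 = B 1 1 ∧ B 0 1 = -B 1 0 := hB
    have hN : A₁ 0 0 ^ 2 + A₁ 1 0 ^ 2 ≠ 0 := by
      intro h0
      exact hne ⟨by nlinarith, by nlinarith⟩
    -- A₁ and A₂ are orthogonal of equal norm in the basis 1, J, so the coefficients of `B` are
    -- orthogonal projections.
    have := add_mem
      ((linearPart h).smul_mem ((B 0 0 * A₁ 0 0 + B 1 0 * A₁ 1 0) / (A₁ 0 0 ^ 2 + A₁ 1 0 ^ 2))
        ⟨_, _, D.mem₄₅⟩)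
      ((linearPart h).smul_mem ((B 0 0 * A₁ 1 0 - B 1 0 * A₁ 0 0) / (A₁ 0 0 ^ 2 + A₁ 1 0 ^ 2))
        ⟨_, _, D.mem₄₆⟩)
    convert this using 1
    have f1 : A₁ 1 1 = A₁ 0 0 := c4.1.symm
    have f2 : A₂ 0 1 = A₁ 0 0 := by rw [← e2, f1]
    have f3 : A₂ 1 0 = -A₁ 0 0 := by linarith [c5.2]
    have f4 : A₂ 1 1 = A₁ 1 0 := by rw [← c5.1, e1]
    apply ext_M2 <;>
      simp only [Matrix.add_apply, Matrix.smul_apply, smul_eq_mul, f1, f2, f3, f4, c4.2, ← e1,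
        ← b1, b2] <;>
      field_simp <;> ring
  refine ⟨D.pair, (hT ..).2 hz.2, (hT ..).2 ?_, (hT ..).2 rfl, (hT ..).2 ?_, (hT ..).2 ?_,
    (hT ..).2 ?_, (hT ..).2 ?_⟩
  · linarith [c5.2, c4.1, hz.1]
  all_goals simp; linarith

/-- Brackets with the similarity act as rotations on the plane of symmetric trace-free matrices. An
element outside 𝔠𝔬(2) has a non-zero component there, so the whole plane is obtained, and the
bracket of two of its elements is a rotation. -/
theorem sl_le_of_rotation {a : LieSubalgebra ℝ M2} {α β : ℝ} (hβ : β ≠ 0)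
    (hZ : !![α, -β; β, α] ∈ a) {A : M2} (hA : A ∈ a) (hn : ¬ (A 0 0 = A 1 1 ∧ A 0 1 = -A 1 0))
    {C : M2} (hC : C 0 0 + C 1 1 = 0) : C ∈ a := by
  set m := -(A 0 1 + A 1 0) with hm
  set n := A 0 0 - A 1 1 with hn'
  have hK : m ^ 2 + n ^ 2 ≠ 0 := by
    intro h0
    have h1 : m = 0 := by nlinarith
    have h2 : n = 0 := by nlinarith
    exact hn ⟨by linarith, by linarith⟩
  have hS : !![m, n; n, -m] ∈ a := by
    have := a.smul_mem β⁻¹ (a.lie_mem hZ hA)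
    convert this using 1
    rw [lie_fin_two]
    apply ext_M2 <;> simp [hm, hn'] <;> field_simp <;> ring
  have hS' : !![-n, m; m, n] ∈ a := by
    have := a.smul_mem (2 * β)⁻¹ (a.lie_mem hZ hS)
    convert this using 1
    rw [lie_fin_two]
    apply ext_M2 <;> simp <;> field_simp <;> ring
  have hJ : !![0, 1; -1, 0] ∈ a := by
    have := a.smul_mem (2 * (m ^ 2 + n ^ 2))⁻¹ (a.lie_mem hS hS')
    convert this using 1
    rw [lie_fin_two]
    apply ext_M2 <;> simp <;> first | (right; ring) | (field_simp; ring)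
  have := add_mem (add_mem
    (a.smul_mem ((m * C 0 0 + n * ((C 0 1 + C 1 0) / 2)) / (m ^ 2 + n ^ 2)) hS)
    (a.smul_mem ((m * ((C 0 1 + C 1 0) / 2) - n * C 0 0) / (m ^ 2 + n ^ 2)) hS'))
    (a.smul_mem ((C 0 1 - C 1 0) / 2) hJ)
  convert this using 1
  have hC' : C 1 1 = -C 0 0 := by linarith
  apply ext_M2 <;> simp [hC'] <;> field_simp <;> ring

/-- There is no central element of non-zero trace here. Instead 𝔰𝔩(2) is perfect, and brackets of
trace-free elements have v = 0; subtracting such brackets from an element with v ≠ 0 removes its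
linear part. -/
theorem IsAdapted.exists_hMat_zero_one_of_sl {h : LieSubalgebra ℝ M7} (hh : IsAdapted h)
    (hsl : ∀ C : M2, C 0 0 + C 1 1 = 0 → C ∈ linearPart h)
    (htr : ∀ A ∈ linearPart h, A 0 0 + A 1 1 = 0) : ∃ y, hMat 0 1 y ∈ h := by
  have hlie : ∀ B ∈ linearPart h, ∀ C ∈ linearPart h, ∃ y, hMat ⁅B, C⁆ 0 y ∈ h := by
    rintro B hB C hC
    have hB' := htr B hB
    have hC' := htr C hC
    obtain ⟨v, y, hB⟩ := hB
    obtain ⟨w, z, hC⟩ := hC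
    have := h.lie_mem hB hC
    rw [hMat_lie, Matrix.trace_fin_two, Matrix.trace_fin_two, hB', hC', zero_mul, mul_zero,
      sub_zero] at this
    exact ⟨_, this⟩
  obtain ⟨A, v, y, hA, hv⟩ := hh.exists_ne_smul_trace 0
  rw [zero_mul] at hv
  have hA' := htr A ⟨v, y, hA⟩
  obtain ⟨y₁, h₁⟩ := hlie !![0, 1; 0, 0] (hsl _ (by simp)) !![0, 0; 1, 0] (hsl _ (by simp))
  obtain ⟨y₂, h₂⟩ := hlie !![1, 0; 0, -1] (hsl _ (by simp)) !![0, 1; 0, 0] (hsl _ (by simp))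
  obtain ⟨y₃, h₃⟩ := hlie !![1, 0; 0, -1] (hsl _ (by simp)) !![0, 0; 1, 0] (hsl _ (by simp))
  have := h.smul_mem v⁻¹ (hMat_sub_mem (hMat_sub_mem (hMat_sub_mem hA h₁ (A 0 0)) h₂ (A 0 1 / 2))
    h₃ (-A 1 0 / 2))
  rw [hMat_smul] at this
  refine ⟨v⁻¹ • (y - A 0 0 • y₁ - (A 0 1 / 2) • y₂ - (-A 1 0 / 2) • y₃), ?_⟩
  convert this using 2
  · rw [lie_fin_two, lie_fin_two, lie_fin_two]
    apply ext_M2 <;> simp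
    · right; ring
    · right; ring
    · right; linarith
  · simp [hv]

/-- The translations already fill ℝ², so 𝔥 is determined by its linear part, which is 𝔠𝔬(2) or
contains 𝔰𝔩(2). -/
theorem IsAdapted.isListed_of_rotation {h : LieSubalgebra ℝ M7} (hh : IsAdapted h) {α β : ℝ}
    (hβ : β ≠ 0) (hZ : !![α, -β; β, α] ∈ linearPart h) : IsListed h := by
  have hY := hh.translationPart_eq_top_of_rotation hβ hZ
  refine isListed_of_mem ?_
  by_cases hle : linearPart h ≤ co2
  · have hco := hh.linearPart_eq_co2 hβ hZ hle
    have hv : ∃ y, hMat 0 1 y ∈ h := by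
      refine hh.exists_hMat_zero_one (B := 1) ?_ (by simp) fun A _ => by simp [Ring.lie_def]
      rw [hco]
      exact (show _ ∧ _ from ⟨by simp, by simp⟩)
    rw [hh.eq_semi12 hY hv, hco]
    simp [typeIIIList]
  obtain ⟨A, hA, hn⟩ := SetLike.not_le_iff_exists.1 hle
  have hsl : ∀ C : M2, C 0 0 + C 1 1 = 0 → C ∈ linearPart h := fun C =>
    sl_le_of_rotation hβ hZ hA hn
  by_cases htr : ∀ A ∈ linearPart h, A 0 0 + A 1 1 = 0
  · have heq : linearPart h = LieAlgebra.SpecialLinear.sl (Fin 2) ℝ :=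
      le_antisymm (fun A hA => mem_sl_iff.2 (htr A hA)) fun A hA => hsl A (mem_sl_iff.1 hA)
    rw [hh.eq_semi12 hY (hh.exists_hMat_zero_one_of_sl hsl htr), heq]
    simp [typeIIIList]
  · push Not at htr
    obtain ⟨B, hB, hB0⟩ := htr
    have htop : linearPart h = ⊤ := by
      refine eq_top_iff.2 fun C _ => ?_
      set c := (C 0 0 + C 1 1) / (B 0 0 + B 1 1) with hc
      have hm : C - c • B ∈ linearPart h := hsl _ (by
        simp only [Matrix.sub_apply, Matrix.smul_apply, smul_eq_mul, hc]
        field_simp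
        ring)
      simpa using add_mem hm ((linearPart h).smul_mem c hB)
    have hv : ∃ y, hMat 0 1 y ∈ h := by
      refine hh.exists_hMat_zero_one (B := 1) ?_ (by simp) fun A _ => by simp [Ring.lie_def]
      rw [htop]
      trivial
    rw [hh.eq_semi12 hY hv, htop]
    simp [typeIIIList]

/-! ### The classification -/

theorem IsPossibleTypeIII.exists_isConjugate {h : LieSubalgebra ℝ M7} (hh : IsPossibleTypeIII h) :
    ∃ h₀ ∈ typeIIIList, IsConjugate h h₀ := by
  suffices IsListed h by
    obtain ⟨P, hP, hl⟩ := this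
    exact ⟨_, hl, isConjugate_of_orthogonal hP⟩
  obtain ⟨P, hP, had, hss⟩ := hh.exists_conj_isAdapted
  refine .of_conj hP ?_
  obtain ⟨g, hg⟩ := exists_conj_diagonal_or_rotation (a := linearPart (conjSubalgebra P h)) (by
    intro u hu hk
    obtain ⟨u', hd, hk'⟩ := hss u hu fun A v y hA => hk A ⟨v, y, hA⟩
    exact ⟨u', hd, fun A ⟨v, y, hA⟩ => hk' A v y hA⟩)
  refine .of_conj (blockUnit_orthogonal g) ?_
  rw [← linearPart_conj_blockUnit] at hg
  rcases hg with hg | ⟨α, β, hβ, hg⟩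
  · exact (had.conj_blockUnit g).isListed_of_diagonal hg
  · exact (had.conj_blockUnit g).isListed_of_rotation hβ hg

end G2Hol

end

/-- Every possible holonomy algebra of Type III is the holonomy algebra of a pseudo-Riemannian
metric of signature `(4,3)`; up to conjugation these algebras are exactly the eight listed ones. -/
theorem theorem1 :
    (∀ h : LieSubalgebra ℝ G2Hol.M7, G2Hol.IsPossibleTypeIII h → G2Hol.IsRealised h) ∧
    (∀ h : LieSubalgebra ℝ G2Hol.M7, G2Hol.IsPossibleTypeIII h →
      ∃ h₀ ∈ G2Hol.typeIIIList, G2Hol.IsConjugate h h₀) ∧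
    (∀ h₀ ∈ G2Hol.typeIIIList, G2Hol.IsPossibleTypeIII h₀) := by
  exact ⟨fun h hh => by
    obtain ⟨h₀, h₀mem, hc⟩ := hh.exists_isConjugate
    exact (G2Hol.isRealised_of_mem_typeIIIList h₀mem).of_isConjugate hc,
    fun h hh => hh.exists_isConjugate,
    fun h₀ h₀mem => G2Hol.isPossibleTypeIII_of_mem_typeIIIList h₀mem⟩
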